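/- **Setting.** Let $(\Omega,\mathcal F,P)$ be a probability space, $\mathbb K\in\{\mathbb R,\mathbb C\}$, $L^0(\mathcal F,\mathbb K)$ the algebra of $P$-a.s. equivalence classes of $\mathbb K$-valued random variables, and $L^0_+(\mathcal F)=\{f\in L^0(\mathcal F,\mathbb R): f\ge 0\}$. A random normed module over $\mathbb K$ with base $(\Omega,\mathcal F,P)$ is an $L^0(\mathcal F,\mathbb K)$-module $S$ with a map $\|\cdot\|:S\to L^0_+(\mathcal F)$ such that $\|x\|=0\Rightarrow x=0$, $\|\zeta x\|=|\zeta|\,\|x\|$ and $\|x+y\|\le\|x\|+\|y\|$ for all $x,y\in S$, $\zeta\in L^0(\mathcal F,\mathbb K)$. The $(\varepsilon,\lambda)$-topology $\mathcal T_{\varepsilon,\lambda}$ on $S$ is the translation-invariant topology with local base $\{z: P\{\|z\|<\varepsilon\}>1-\lambda\}$ ($\varepsilon>0$, $0<\lambda<1$) at $0$. All limits and continuity statements in $S$ refer to it, and so do all integrals: $\int_0^L$ is the limit of Riemann sums as the mesh tends to $0$, and $\int_0^\infty=\lim_{L\to\infty}\int_0^L$. $B(S)$ is the set of almost surely bounded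 module homomorphisms $T:S\to S$, i.e. those with $\|Tz\|\le\eta\|z\|$ for all $z\in S$ and some $\eta\in L^0_+(\mathcal F)$; $\|T\|\in L^0_+(\mathcal F)$ is the infimum of all such $\eta$. For an operator $T$, $R(T)$ denotes its range. Let $S$ be $\mathcal T_{\varepsilon,\lambda}$-complete and let $C\in B(S)$ be injective. A family $\{W(s)\}_{s\ge0}\subset B(S)$ is strongly continuous if $s\mapsto W(s)x$ is continuous on $[0,\infty)$ for every $x\in S$. It is a $C$-semigroup if it is strongly continuous, $W(0)=C$ and $CW(s+t)=W(t)W(s)$ for all $s,t\ge 0$; its infinitesimal generator is the operator $A$ with $$D(A)=\Big\{x\in S:\ \lim_{s\to0^+}\tfrac{W(s)x-Cx}{s}\text{ exists and belongs to }R(C)\Big\},\qquad Ax=C^{-1}\lim_{s\to0^+}\tfrac{W(s)x-Cx}{s}.$$ For a module homomorphism $A:D(A)\to S$ defined on a submodule $D(A)$ of $S$, let $C^{-1}AC$ be the operator $x\mapsto C^{-1}(A(Cx))$ with domain $\{x: Cx\in D(A),\ A(Cx)\in R(C)\}$; let $\rho_C(A)$ be the set of $\eta\in L^0(\mathcal F,\mathbb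 K)$ for which $\eta-A:D(A)\to S$ is injective and $R(C)\subseteq R(\eta-A)$, and put $R_C(\eta,A)=(\eta-A)^{-1}C$ for $\eta\in\rho_C(A)$. For $\xi\in L^0(\mathcal F,\mathbb R)$ let $G_\xi=\{\eta\in L^0(\mathcal F,\mathbb R):\eta>\xi \text{ a.s.}\}$. **Theorem 4.7 (Hille–Yosida, nondense case).** Let $(A,D(A))$ be a module homomorphism from a submodule $D(A)$ of $S$ to $S$, and let $W:[0,\infty)\to B(S)$ be a strongly continuous family satisfying $\|W(s)\|\le Me^{\xi s}$ for all $s\ge0$, for some $M\in L^0_+(\mathcal F)$ and $\xi\in L^0(\mathcal F,\mathbb R)$. Then the following are equivalent: (a) $\{W(s):s\ge0\}$ is a $C$-semigroup on $S$ with infinitesimal generator $(A,D(A))$; (b) $A=C^{-1}AC$, and for every $\eta\in G_\xi$ one has $\eta\in\rho_C(A)$ and $$R_C(\eta,A)x=\int_0^\infty e^{-\eta s}W(s)x\,ds\qquad\text{for all }x\in S$$ (including that the integral exists). -/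

import Mathlib

open MeasureTheory Filter Topology
open scoped NNReal

namespace RNM

section L0

variable {Ω : Type*} [MeasurableSpace Ω]

/-- `L⁰(F, 𝕜)`: the algebra of equivalence classes of `𝕜`-valued random variables on the
probability space `(Ω, F, P)`. It carries Mathlib's almost everywhere pointwise operations
and, for `𝕜 = ℝ`, the almost sure order `≤`. -/
abbrev L0 (𝕜 : Type*) [RCLike 𝕜] (P : Measure Ω) : Type _ := Ω →ₘ[P] 𝕜

/-- The pointwise addition and multiplication make `L⁰(F, 𝕜)` a commutative ring. -/
noncomputable instance instCommRingL0 {𝕜 : Type*} [RCLike 𝕜] {P : Measure Ω} :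
    CommRing (L0 𝕜 P) :=
  { (inferInstance : AddCommGroup (L0 𝕜 P)), (inferInstance : CommMonoid (L0 𝕜 P)) with
    left_distrib := by
      intro a b c
      refine AEEqFun.induction_on₃ a b c fun f hf g hg h hh => ?_
      simp only [AEEqFun.mk_add_mk, AEEqFun.mk_mul_mk, mul_add]
    right_distrib := by
      intro a b c
      refine AEEqFun.induction_on₃ a b c fun f hf g hg h hh => ?_
      simp only [AEEqFun.mk_add_mk, AEEqFun.mk_mul_mk, add_mul]
    zero_mul := by
      intro a
      refine AEEqFun.induction_on a fun f hf => ?_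
      simp only [AEEqFun.zero_def, AEEqFun.mk_mul_mk, Pi.mul_def, zero_mul]
    mul_zero := by
      intro a
      refine AEEqFun.induction_on a fun f hf => ?_
      simp only [AEEqFun.zero_def, AEEqFun.mk_mul_mk, Pi.mul_def, mul_zero] }

/-- The absolute value `|ζ| ∈ L⁰(F, ℝ)` of `ζ ∈ L⁰(F, 𝕜)`. -/
noncomputable def L0.absVal {𝕜 : Type*} [RCLike 𝕜] {P : Measure Ω} (ζ : L0 𝕜 P) : L0 ℝ P :=
  AEEqFun.comp (fun z : 𝕜 => ‖z‖) continuous_norm ζ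

/-- The exponential `e^f` of `f ∈ L⁰(F, ℝ)`. -/
noncomputable def L0.exp {P : Measure Ω} (f : L0 ℝ P) : L0 ℝ P :=
  AEEqFun.comp Real.exp Real.continuous_exp f

/-- The inclusion `L⁰(F, ℝ) ⊆ L⁰(F, 𝕜)`. -/
noncomputable def L0.ofReal (𝕜 : Type*) [RCLike 𝕜] {P : Measure Ω} (f : L0 ℝ P) : L0 𝕜 P :=
  AEEqFun.comp (fun r : ℝ => (r : 𝕜)) RCLike.continuous_ofReal f

/-- `f > g` on `Ω`, i.e. `f(ω) > g(ω)` for almost every `ω` (written as `g < f`). -/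
def L0.LtOn {P : Measure Ω} (g f : L0 ℝ P) : Prop := ∀ᵐ ω ∂P, g ω < f ω

/-- A nonempty family in `L⁰₊` that is closed under pairwise minima has an infimum. -/
theorem L0.exists_isGLB {P : Measure Ω} [IsProbabilityMeasure P] (B : Set (L0 ℝ P))
    (hne : B.Nonempty) (h0 : ∀ f ∈ B, 0 ≤ f) (hinf : ∀ f ∈ B, ∀ g ∈ B, f ⊓ g ∈ B) :
    ∃ ν, IsGLB B ν := by
  have hint : ∀ f : L0 ℝ P, Integrable (fun ω => Real.arctan (f ω)) P := by
    intro f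
    refine Integrable.of_bound
      (Real.continuous_arctan.comp_aestronglyMeasurable f.aestronglyMeasurable)
      (Real.pi / 2) (Eventually.of_forall fun ω => ?_)
    rw [Real.norm_eq_abs, abs_le]
    exact ⟨(Real.neg_pi_div_two_lt_arctan _).le, (Real.arctan_lt_pi_div_two _).le⟩
  set φ : L0 ℝ P → ℝ := fun f => ∫ ω, Real.arctan (f ω) ∂P with hφ
  have hφ0 : ∀ f ∈ B, 0 ≤ φ f := by
    intro f hf
    refine integral_nonneg_of_ae ?_
    filter_upwards [AEEqFun.coeFn_le.2 (h0 f hf), AEEqFun.coeFn_zero (μ := P) (β := ℝ)]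
      with ω h1 h2
    rw [h2] at h1
    exact Real.arctan_nonneg.2 h1
  have hbdd : BddBelow (φ '' B) := ⟨0, by rintro _ ⟨f, hf, rfl⟩; exact hφ0 f hf⟩
  have hseq : ∀ n : ℕ, ∃ f ∈ B, φ f < sInf (φ '' B) + 1 / ((n : ℝ) + 1) := by
    intro n
    obtain ⟨_, ⟨f, hf, rfl⟩, h⟩ := exists_lt_of_csInf_lt (hne.image φ)
      (lt_add_of_pos_right (sInf (φ '' B)) (Nat.one_div_pos_of_nat (α := ℝ) (n := n)))
    exact ⟨f, hf, h⟩
  choose u huB hu using hseq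
  have hgm : AEStronglyMeasurable (fun ω => ⨅ n, u n ω) P :=
    (AEMeasurable.iInf fun n => (u n).aemeasurable).aestronglyMeasurable
  have hpos : ∀ᵐ ω ∂P, ∀ n, 0 ≤ u n ω := by
    rw [ae_all_iff]
    intro n
    filter_upwards [AEEqFun.coeFn_le.2 (h0 _ (huB n)), AEEqFun.coeFn_zero (μ := P) (β := ℝ)]
      with ω h1 h2
    rw [h2] at h1
    exact h1
  have hg : ∀ᵐ ω ∂P, ∀ n, AEEqFun.mk _ hgm ω ≤ u n ω := by
    filter_upwards [hpos, AEEqFun.coeFn_mk _ hgm] with ω h1 h2 n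
    rw [h2]
    exact ciInf_le ⟨0, by rintro _ ⟨k, rfl⟩; exact h1 k⟩ n
  refine ⟨AEEqFun.mk _ hgm, ?_, ?_⟩
  · intro f hf
    set g : L0 ℝ P := AEEqFun.mk _ hgm
    have hI : Integrable (fun ω => max (Real.arctan (g ω) - Real.arctan (f ω)) 0) P :=
      ((hint g).sub (hint f)).pos_part
    have hle : ∀ n : ℕ, ∫ ω, max (Real.arctan (g ω) - Real.arctan (f ω)) 0 ∂P
        ≤ 1 / ((n : ℝ) + 1) := by
      intro n
      calc ∫ ω, max (Real.arctan (g ω) - Real.arctan (f ω)) 0 ∂P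
          ≤ ∫ ω, (Real.arctan (u n ω) - Real.arctan ((f ⊓ u n) ω)) ∂P := by
            refine integral_mono_ae hI ((hint _).sub (hint _)) ?_
            filter_upwards [hg, AEEqFun.coeFn_inf f (u n)] with ω h1 h2
            have h3 := Real.arctan_strictMono.monotone (h1 n)
            simp only [h2]
            rcases le_total (f ω) (u n ω) with h | h
            · rw [inf_eq_left.2 h]
              have := Real.arctan_strictMono.monotone h
              exact max_le (by linarith) (by linarith)
            · rw [inf_eq_right.2 h]
              have := Real.arctan_strictMono.monotone h
              exact max_le (by linarith) (by linarith)
        _ = φ (u n) - φ (f ⊓ u n) := integral_sub (hint _) (hint _)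
        _ ≤ 1 / ((n : ℝ) + 1) := by
            have := csInf_le hbdd ⟨_, hinf f hf _ (huB n), rfl⟩
            linarith [hu n]
    have hzero : ∫ ω, max (Real.arctan (g ω) - Real.arctan (f ω)) 0 ∂P = 0 := by
      refine le_antisymm ?_ (integral_nonneg fun ω => le_max_right _ _)
      exact ge_of_tendsto' (tendsto_one_div_add_atTop_nhds_zero_nat (𝕜 := ℝ)) hle
    have hzero := (integral_eq_zero_iff_of_nonneg
      (f := fun ω => max (Real.arctan (g ω) - Real.arctan (f ω)) 0)
      (fun ω => le_max_right _ _) hI).1 hzero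
    rw [← AEEqFun.coeFn_le]
    filter_upwards [hzero] with ω h
    have h1 : Real.arctan (g ω) - Real.arctan (f ω) ≤ 0 := by
      have := le_max_left (Real.arctan (g ω) - Real.arctan (f ω)) 0
      rw [show max (Real.arctan (g ω) - Real.arctan (f ω)) 0 = 0 from h] at this
      exact this
    exact Real.arctan_strictMono.le_iff_le.1 (by linarith)
  · intro ν hν
    rw [← AEEqFun.coeFn_le]
    have : ∀ᵐ ω ∂P, ∀ n, ν ω ≤ u n ω :=
      ae_all_iff.2 fun n => AEEqFun.coeFn_le.2 (hν (huB n))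
    filter_upwards [this, AEEqFun.coeFn_mk _ hgm] with ω h1 h2
    rw [h2]
    exact le_ciInf h1

end L0

/-- A random normed module over `𝕜` with base `(Ω, F, P)`: a module `S` over `L⁰(F, 𝕜)` with
an `L⁰`-norm `S → L⁰₊(F)`. -/
class RNModule {Ω : Type*} [MeasurableSpace Ω] (𝕜 : Type*) [RCLike 𝕜] (P : Measure Ω)
    (S : Type*) [AddCommGroup S] [Module (L0 𝕜 P) S] where
  /-- the `L⁰`-norm -/
  l0norm : S → L0 ℝ P
  l0norm_nonneg : ∀ x, 0 ≤ l0norm x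
  eq_zero_of_l0norm : ∀ x, l0norm x = 0 → x = 0
  l0norm_smul : ∀ (ζ : L0 𝕜 P) (x : S), l0norm (ζ • x) = ζ.absVal * l0norm x
  l0norm_add_le : ∀ x y, l0norm (x + y) ≤ l0norm x + l0norm y

section Module

variable {Ω : Type*} [MeasurableSpace Ω] (𝕜 : Type*) [RCLike 𝕜]
  (P : Measure Ω) (S : Type*) [AddCommGroup S] [Module (L0 𝕜 P) S] [RNModule 𝕜 P S]

variable {S} in
/-- The `L⁰`-norm `‖x‖ ∈ L⁰₊(F)` of `x ∈ S`. -/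
abbrev nrm (x : S) : L0 ℝ P := RNModule.l0norm 𝕜 x

variable {S} in
theorem nrm_zero : nrm 𝕜 P (0 : S) = 0 := by
  have h := RNModule.l0norm_smul (P := P) (0 : L0 𝕜 P) (0 : S)
  have h2 : (0 : L0 𝕜 P).absVal = 0 := by
    rw [L0.absVal, AEEqFun.zero_def, AEEqFun.comp_mk, AEEqFun.zero_def]
    congr 1
    ext ω
    simp
  rwa [h2, zero_mul, zero_smul] at h

variable {S} in
theorem nrm_neg (x : S) : nrm 𝕜 P (-x) = nrm 𝕜 P x := by
  have h := RNModule.l0norm_smul (P := P) (-1 : L0 𝕜 P) x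
  have h2 : (-1 : L0 𝕜 P).absVal = 1 := by
    rw [L0.absVal, AEEqFun.one_def, AEEqFun.neg_mk, AEEqFun.comp_mk, AEEqFun.one_def]
    congr 1
    ext ω
    simp
  rwa [h2, one_mul, neg_one_smul] at h

/-- The set `U_θ(ε, l) = {z : P{‖z‖ < ε} > 1 - l}`. -/
def ball (ε l : ℝ) : Set S := {z | 1 - l < P.real {ω | nrm 𝕜 P z ω < ε}}

theorem ball_mono [IsProbabilityMeasure P] {ε₁ ε₂ l₁ l₂ : ℝ} (hε : ε₁ ≤ ε₂) (hl : l₁ ≤ l₂) :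
    ball 𝕜 P S ε₁ l₁ ⊆ ball 𝕜 P S ε₂ l₂ := by
  intro z hz
  have hz' : 1 - l₁ < P.real {ω | nrm 𝕜 P z ω < ε₁} := hz
  have : P.real {ω | nrm 𝕜 P z ω < ε₁} ≤ P.real {ω | nrm 𝕜 P z ω < ε₂} :=
    measureReal_mono fun ω h => lt_of_lt_of_le h hε
  change 1 - l₂ < P.real {ω | nrm 𝕜 P z ω < ε₂}
  linarith

/-- The sets `U_θ(ε, l)`, `ε > 0`, `0 < l < 1`, as a base at `0` of a group topology. -/
@[reducible]
noncomputable def epsLamBasis [IsProbabilityMeasure P] : AddGroupFilterBasis S :=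
  addGroupFilterBasisOfComm {U | ∃ ε l : ℝ, 0 < ε ∧ 0 < l ∧ l < 1 ∧ U = ball 𝕜 P S ε l}
    ⟨_, 1, 1 / 2, by norm_num, by norm_num, by norm_num, rfl⟩
    (by
      rintro _ _ ⟨ε₁, l₁, h1, h2, h3, rfl⟩ ⟨ε₂, l₂, h4, h5, h6, rfl⟩
      refine ⟨_, ⟨min ε₁ ε₂, min l₁ l₂, lt_min h1 h4, lt_min h2 h5,
        (min_le_left _ _).trans_lt h3, rfl⟩, fun z hz => ⟨?_, ?_⟩⟩
      · exact ball_mono 𝕜 P S (min_le_left _ _) (min_le_left _ _) hz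
      · exact ball_mono 𝕜 P S (min_le_right _ _) (min_le_right _ _) hz)
    (by
      rintro _ ⟨ε, l, h1, h2, h3, rfl⟩
      have : P.real {ω | nrm 𝕜 P (0 : S) ω < ε} = 1 := by
        rw [nrm_zero, measureReal_def, (prob_compl_eq_zero_iff₀ ?_).1 ?_, ENNReal.toReal_one]
        · exact (nullMeasurableSet_lt (AEEqFun.aemeasurable _) aemeasurable_const)
        · change ∀ᵐ ω ∂P, (0 : L0 ℝ P) ω < ε
          filter_upwards [AEEqFun.coeFn_zero (μ := P) (β := ℝ)] with ω h
          rw [h]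
          exact h1
      change 1 - l < P.real {ω | nrm 𝕜 P (0 : S) ω < ε}
      rw [this]
      linarith)
    (by
      rintro _ ⟨ε, l, h1, h2, h3, rfl⟩
      refine ⟨_, ⟨ε / 2, l / 2, by linarith, by linarith, by linarith, rfl⟩, ?_⟩
      rintro _ ⟨x, hx, y, hy, rfl⟩
      change 1 - l < P.real {ω | nrm 𝕜 P (x + y) ω < ε}
      have hx' : 1 - l / 2 < P.real {ω | nrm 𝕜 P x ω < ε / 2} := hx
      have hy' : 1 - l / 2 < P.real {ω | nrm 𝕜 P y ω < ε / 2} := hy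
      have hun := measureReal_union_add_inter₀ (μ := P) (s := {ω | nrm 𝕜 P x ω < ε / 2})
        (nullMeasurableSet_lt (AEEqFun.aemeasurable (nrm 𝕜 P y))
          (aemeasurable_const (b := ε / 2)))
      have h1' : P.real ({ω | nrm 𝕜 P x ω < ε / 2} ∪ {ω | nrm 𝕜 P y ω < ε / 2}) ≤ 1 :=
        measureReal_le_one
      have hle : P.real ({ω | nrm 𝕜 P x ω < ε / 2} ∩ {ω | nrm 𝕜 P y ω < ε / 2})
          ≤ P.real {ω | nrm 𝕜 P (x + y) ω < ε} := by
        refine ENNReal.toReal_mono (measure_ne_top _ _) (measure_mono_ae ?_)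
        filter_upwards [AEEqFun.coeFn_le.2 (RNModule.l0norm_add_le (𝕜 := 𝕜) (P := P) x y),
          AEEqFun.coeFn_add (nrm 𝕜 P x) (nrm 𝕜 P y)] with ω ha hb hc
        rw [hb] at ha
        have hc1 : nrm 𝕜 P x ω < ε / 2 := hc.1
        have hc2 : nrm 𝕜 P y ω < ε / 2 := hc.2
        change nrm 𝕜 P (x + y) ω < ε
        simp only [Pi.add_apply] at ha
        linarith
      linarith)
    (by
      rintro U ⟨ε, l, h1, h2, h3, rfl⟩
      refine ⟨_, ⟨ε, l, h1, h2, h3, rfl⟩, fun z hz => ?_⟩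
      change 1 - l < P.real {ω | nrm 𝕜 P (-z) ω < ε}
      rw [nrm_neg]
      exact hz)

/-- The `(ε, λ)`-topology. -/
@[reducible]
noncomputable def epsLam [IsProbabilityMeasure P] : TopologicalSpace S :=
  (epsLamBasis 𝕜 P S).topology

/-- `S` is complete for the (translation invariant) uniformity of the `(ε, λ)`-topology. -/
def IsEpsLamComplete [IsProbabilityMeasure P] : Prop :=
  @CompleteSpace S
    (@IsTopologicalAddGroup.rightUniformSpace S _ (epsLam 𝕜 P S)
      (epsLamBasis 𝕜 P S).isTopologicalAddGroup)

/-- Convergence of `f` to `x` along `l` in the `(ε, λ)`-topology. -/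
def TendstoEL [IsProbabilityMeasure P] {S : Type*} [AddCommGroup S] [Module (L0 𝕜 P) S]
    [RNModule 𝕜 P S] {α : Type*} (f : α → S) (l : Filter α) (x : S) : Prop :=
  Tendsto f l (@nhds S (epsLam 𝕜 P S) x)

variable {𝕜 P S}

/-- The `η ∈ L⁰₊` with `‖T z‖ ≤ η ‖z‖` for all `z`. -/
def bounds (T : S →ₗ[L0 𝕜 P] S) : Set (L0 ℝ P) :=
  {η | 0 ≤ η ∧ ∀ z, nrm 𝕜 P (T z) ≤ η * nrm 𝕜 P z}

variable (𝕜 P S) in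
/-- `B(S)`: the almost surely bounded module homomorphisms of `S`. -/
def BOp : Type _ := {T : S →ₗ[L0 𝕜 P] S // (bounds T).Nonempty}

noncomputable instance : CoeFun (BOp 𝕜 P S) (fun _ => S → S) := ⟨fun T => T.1⟩

theorem exists_isGLB_bounds [IsProbabilityMeasure P] (T : BOp 𝕜 P S) :
    ∃ ν, IsGLB (bounds T.1) ν := by
  refine L0.exists_isGLB _ T.2 (fun f hf => hf.1) fun f hf g hg => ⟨le_inf hf.1 hg.1, fun z => ?_⟩
  rw [← AEEqFun.coeFn_le]
  filter_upwards [AEEqFun.coeFn_le.2 (hf.2 z), AEEqFun.coeFn_le.2 (hg.2 z),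
    AEEqFun.coeFn_inf f g, AEEqFun.coeFn_mul f (nrm 𝕜 P z), AEEqFun.coeFn_mul g (nrm 𝕜 P z),
    AEEqFun.coeFn_mul (f ⊓ g) (nrm 𝕜 P z)] with ω h1 h2 h3 h4 h5 h6
  rw [h4] at h1
  rw [h5] at h2
  rw [h6]
  simp only [Pi.mul_apply] at h1 h2 ⊢
  rw [h3]
  rcases le_total (f ω) (g ω) with h | h
  · rwa [inf_eq_left.2 h]
  · rwa [inf_eq_right.2 h]

/-- The `L⁰`-norm `‖T‖ = ⋀ {η ∈ L⁰₊ : ‖T z‖ ≤ η ‖z‖ for all z}` of `T ∈ B(S)`. -/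
noncomputable def opNrm [IsProbabilityMeasure P] (T : BOp 𝕜 P S) : L0 ℝ P :=
  (exists_isGLB_bounds T).choose

theorem isGLB_opNrm [IsProbabilityMeasure P] (T : BOp 𝕜 P S) : IsGLB (bounds T.1) (opNrm T) :=
  (exists_isGLB_bounds T).choose_spec

/-- Strong continuity of `W : [0, ∞) → B(S)`. -/
def StronglyContinuous [IsProbabilityMeasure P] (W : ℝ≥0 → BOp 𝕜 P S) : Prop :=
  ∀ x : S, @Continuous ℝ≥0 S _ (epsLam 𝕜 P S) (fun s => W s x)

/-- `W` is a `C`-semigroup on `S` (where `C ∈ B(S)` is injective). -/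
structure IsCSemigroup [IsProbabilityMeasure P] (C : BOp 𝕜 P S) (W : ℝ≥0 → BOp 𝕜 P S) :
    Prop where
  injective : Function.Injective C
  mul : ∀ s t x, C (W (s + t) x) = W t (W s x)
  zero : W 0 = C
  continuous : StronglyContinuous W

variable (𝕜 P) in
/-- The scalar multiple `r x` of `x ∈ S` by a real number, i.e. by a constant in `L⁰(F, 𝕜)`. -/
noncomputable def rsmul (r : ℝ) (x : S) : S := (AEEqFun.const Ω (r : 𝕜) : L0 𝕜 P) • x

/-- The difference quotient `(W(s) x - C x) / s`. -/
noncomputable def diffQuot (C : BOp 𝕜 P S) (W : ℝ≥0 → BOp 𝕜 P S) (x : S) (s : ℝ≥0) : S :=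
  rsmul 𝕜 P ((s : ℝ)⁻¹) (W s x - C x)

/-- `(A, D(A))` is the infinitesimal generator of `W`: `D(A)` is the set of all `x` for which
`lim_{s → 0+} (W(s) x - C x) / s` exists and lies in the range of `C`, and
`A x = C⁻¹ lim_{s → 0+} (W(s) x - C x) / s` for `x ∈ D(A)`. -/
structure IsGenerator [IsProbabilityMeasure P] (C : BOp 𝕜 P S) (W : ℝ≥0 → BOp 𝕜 P S)
    (A : S →ₗ.[L0 𝕜 P] S) : Prop where
  domain : (A.domain : Set S) =
    {x | ∃ y ∈ Set.range C, TendstoEL 𝕜 P (diffQuot C W x) (𝓝[>] 0) y}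
  apply : ∀ x : A.domain, TendstoEL 𝕜 P (diffQuot C W (x : S)) (𝓝[>] 0) (C (A x))

/-- The domain `{x : C x ∈ D(A), A (C x) ∈ R(C)}` of `C⁻¹ A C`. -/
def conjDomain (C : BOp 𝕜 P S) (A : S →ₗ.[L0 𝕜 P] S) : Submodule (L0 𝕜 P) S where
  carrier := {x | ∃ h : C.1 x ∈ A.domain, A ⟨C.1 x, h⟩ ∈ LinearMap.range C.1}
  zero_mem' := by
    have h0 : C.1 0 = 0 := map_zero _
    have h1 : C.1 0 ∈ A.domain := by rw [h0]; exact zero_mem _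
    refine ⟨h1, 0, ?_⟩
    have h2 : (⟨C.1 0, h1⟩ : A.domain) = 0 := Subtype.ext h0
    rw [h2, A.map_zero, map_zero]
  add_mem' := by
    rintro x y ⟨hx, u, hu⟩ ⟨hy, v, hv⟩
    have h0 : C.1 (x + y) = C.1 x + C.1 y := map_add _ _ _
    have h1 : C.1 (x + y) ∈ A.domain := by rw [h0]; exact add_mem hx hy
    refine ⟨h1, u + v, ?_⟩
    have h2 : (⟨C.1 (x + y), h1⟩ : A.domain) = ⟨C.1 x, hx⟩ + ⟨C.1 y, hy⟩ := Subtype.ext h0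
    rw [h2, A.map_add, map_add, hu, hv]
  smul_mem' := by
    rintro c x ⟨hx, u, hu⟩
    have h0 : C.1 (c • x) = c • C.1 x := map_smul _ _ _
    have h1 : C.1 (c • x) ∈ A.domain := by rw [h0]; exact A.domain.smul_mem c hx
    refine ⟨h1, c • u, ?_⟩
    have h2 : (⟨C.1 (c • x), h1⟩ : A.domain) = c • ⟨C.1 x, hx⟩ := Subtype.ext h0
    rw [h2, A.map_smul, map_smul, hu]

/-- The operator `C⁻¹ A C` for injective `C`, with value `C⁻¹ (A (C x))` at `x`. -/
noncomputable def conj (C : BOp 𝕜 P S) (hC : Function.Injective C) (A : S →ₗ.[L0 𝕜 P] S) :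
    S →ₗ.[L0 𝕜 P] S where
  domain := conjDomain C A
  toFun := (LinearEquiv.ofInjective C.1 hC).symm.toLinearMap ∘ₗ
    (A.toFun ∘ₗ (C.1 ∘ₗ (conjDomain C A).subtype).codRestrict A.domain
      (fun x => x.2.1)).codRestrict (LinearMap.range C.1) (fun x => x.2.2)

/-- The module homomorphism `η - A : D(A) → S`. -/
noncomputable def etaSub (η : L0 𝕜 P) (A : S →ₗ.[L0 𝕜 P] S) : A.domain →ₗ[L0 𝕜 P] S :=
  η • A.domain.subtype - A.toFun

/-- The `C`-resolvent set `ρ_C(A)`. -/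
def cResolventSet (C : BOp 𝕜 P S) (A : S →ₗ.[L0 𝕜 P] S) : Set (L0 𝕜 P) :=
  {η | Function.Injective (etaSub η A) ∧ Set.range C ⊆ Set.range (etaSub η A)}

/-- The `C`-resolvent `R_C(η, A) = (η - A)⁻¹ C` for `η ∈ ρ_C(A)`. -/
noncomputable def cResolvent {C : BOp 𝕜 P S} {A : S →ₗ.[L0 𝕜 P] S} {η : L0 𝕜 P}
    (h : η ∈ cResolventSet C A) (x : S) : S :=
  ((LinearEquiv.ofInjective (etaSub η A) h.1).symm ⟨C x, h.2 ⟨x, rfl⟩⟩ : A.domain)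

variable (𝕜 P) in
/-- `I` is the Riemann integral of `f` over `[0, L]` for the `(ε, λ)`-topology: the Riemann sums
over tagged partitions `0 = t 0 ≤ τ 0 ≤ t 1 ≤ τ 1 ≤ ⋯ ≤ t n = L` tend to `I` as the mesh tends
to `0`. -/
def HasRiemannIntegral [IsProbabilityMeasure P] (f : ℝ≥0 → S) (L : ℝ≥0) (I : S) : Prop :=
  ∀ U ∈ @nhds S (epsLam 𝕜 P S) I, ∃ δ : ℝ, 0 < δ ∧
    ∀ (n : ℕ) (t τ : ℕ → ℝ≥0), t 0 = 0 → t n = L →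
      (∀ i < n, t i ≤ τ i ∧ τ i ≤ t (i + 1) ∧ (t (i + 1) : ℝ) - t i < δ) →
      ∑ i ∈ Finset.range n, rsmul 𝕜 P ((t (i + 1) : ℝ) - t i) (f (τ i)) ∈ U

variable (𝕜 P) in
/-- `I = ∫₀^∞ f(s) ds`: `f` is Riemann integrable over every `[0, L]`, and these integrals
converge to `I` in the `(ε, λ)`-topology as `L → ∞`. -/
def HasImproperIntegral [IsProbabilityMeasure P] (f : ℝ≥0 → S) (I : S) : Prop :=
  ∃ F : ℝ≥0 → S, (∀ L, HasRiemannIntegral 𝕜 P f L (F L)) ∧ TendstoEL 𝕜 P F atTop I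

variable (𝕜) in
/-- `I = ∫₀^∞ e^{-η s} h(s) ds` for `η ∈ L⁰(F, ℝ)`. -/
def HasLaplaceTransform [IsProbabilityMeasure P] (h : ℝ≥0 → S) (η : L0 ℝ P) (I : S) : Prop :=
  HasImproperIntegral 𝕜 P (fun s => L0.ofReal 𝕜 (L0.exp (-((s : ℝ) • η))) • h s) I

end Module

end RNM

/-! Everything is reduced to classical Laplace transform theory in a real Banach space.

Convergence in the $(\varepsilon,\lambda)$-topology is convergence in probability of the
$L^0$-norms. If $\|f(s)\|\le b$ for all $s$, with a fixed random variable $b$, then $f$ takes values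
in the space of those $x\in S$ with $E[\|x\|/(1+|b|)]<\infty$. This is a Banach space because $S$ is
complete (`WSpace.completeSpace`), and on the elements dominated by $b$ its norm convergence agrees
with the $(\varepsilon,\lambda)$-topology. Hence the Riemann and improper integrals in $S$ are
images of Bochner integrals, and a dominated continuous function is determined by its Laplace
transform at the positive integers (`IsDominated.eq_of_laplace_eq`, through Weierstrass
approximation).

The random growth rate is removed by passing to $V(s)=e^{-\xi s}W(s)$, which is bounded by $M$. In
general the family $e^{-\eta s}W(s)$ has generator $A-\eta$ (`genRel_escale_iff`), so a statement
about $\eta-A$ becomes one about a bounded family.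

(a) to (b). For a bounded $C$-semigroup $V$ with generator $B$, $Bx=y$ holds exactly when
$V(t)x-Cx=\int_0^tV(s)y\,ds$ for all $t$. Since $C$ is injective and commutes with $V$, this
identity for $(Cx,Cy)$ implies it for $(x,y)$, which gives $A=C^{-1}AC$. It also shows that
$I=\int_0^\infty V(s)x\,ds$ satisfies $BI=-Cx$, and that $Bx=0$ forces the orbit to be constantly
$Cx$, hence $x=0$ when the orbit tends to $0$. For $V=e^{-\eta s}W$ these are the range condition
with the Laplace formula, and the injectivity of $\eta-A$.

(b) to (a). Put $R_q=R_C(\xi+q,A)$ for constants $q>0$. From $A=C^{-1}AC$ follow $CR_q=R_qC$ and the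
resolvent equation $(r-q)R_qR_r=R_qC-R_rC$. On the side of Laplace transforms the latter says
$V(s)R_rx=\int_0^\infty e^{-rt}V(s+t)Cx\,dt$ (`IsDominated.hasLaplace_shift`). The left side is also
$\int_0^\infty e^{-rt}V(s)V(t)x\,dt$, so uniqueness gives $V(s)V(t)=V(s+t)C$. The generator is then
identified with $A$ by comparing the two at a single $\eta$. -/

namespace RNM

/-! ### Convergence in probability -/

section Small

variable {Ω : Type*} [MeasurableSpace Ω] {P : Measure Ω} {α : Type*}

variable (P) in
/-- The nonnegative parts of the functions `u a` tend to `0` in probability along `l`. -/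
def Small (u : α → Ω → ℝ) (l : Filter α) : Prop :=
  ∀ ε : ℝ, 0 < ε → Tendsto (fun a => P.real {ω | ε ≤ u a ω}) l (𝓝 0)

theorem exists_measureReal_abs_gt_lt [IsProbabilityMeasure P] {g : Ω → ℝ} (hg : AEMeasurable g P)
    {δ : ℝ} (hδ : 0 < δ) : ∃ N : ℝ, 0 < N ∧ P.real {ω | N < |g ω|} < δ := by
  have h : Tendsto (fun n : ℕ => P {ω | (n : ℝ) < |g ω|}) atTop
      (𝓝 (P (⋂ n : ℕ, {ω | (n : ℝ) < |g ω|}))) := by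
    refine tendsto_measure_iInter_atTop (fun n => nullMeasurableSet_lt aemeasurable_const
      (hg.abs)) ?_ ⟨0, measure_ne_top _ _⟩
    intro m n hmn ω hω
    exact lt_of_le_of_lt (Nat.cast_le.2 hmn) (show (n : ℝ) < |g ω| from hω)
  have h0 : (⋂ n : ℕ, {ω | (n : ℝ) < |g ω|}) = ∅ := by
    ext ω
    simp only [Set.mem_iInter, Set.mem_ofPred_eq, Set.mem_empty_iff_false, iff_false, not_forall,
      not_lt]
    exact exists_nat_ge _
  rw [h0, measure_empty] at h
  have h' := (ENNReal.tendsto_toReal ENNReal.zero_ne_top).comp h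
  rw [ENNReal.toReal_zero] at h'
  obtain ⟨n, hn, hn'⟩ := ((h'.eventually (gt_mem_nhds hδ)).and (eventually_gt_atTop 0)).exists
  exact ⟨n, Nat.cast_pos.2 hn', hn⟩

/-- A single random variable is tight: outside a set of small probability $|g|\le N$, and there
$v\ge\varepsilon$ forces $u\ge\varepsilon/N$. This is how random constants are absorbed in all later
estimates. -/
theorem Small.of_le_mul [IsProbabilityMeasure P] {u v : α → Ω → ℝ} {l : Filter α} {g : Ω → ℝ}
    (hg : AEMeasurable g P) (hu : Small P u l)
    (h : ∀ᶠ a in l, ∀ᵐ ω ∂P, v a ω ≤ |g ω| * u a ω) : Small P v l := by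
  intro ε hε
  rw [Metric.tendsto_nhds]
  intro δ hδ
  obtain ⟨N, hN, hNδ⟩ := exists_measureReal_abs_gt_lt hg (half_pos hδ)
  filter_upwards [h, (hu (ε / N) (div_pos hε hN)).eventually (gt_mem_nhds (half_pos hδ))]
    with a ha ha'
  rw [Real.dist_eq, sub_zero, abs_of_nonneg measureReal_nonneg]
  have hsub : P.real {ω | ε ≤ v a ω} ≤ P.real ({ω | N < |g ω|} ∪ {ω | ε / N ≤ u a ω}) := by
    refine ENNReal.toReal_mono (measure_ne_top _ _) (measure_mono_ae ?_)
    filter_upwards [ha] with ω h1 h2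
    have h2 : ε ≤ v a ω := h2
    by_cases h3 : N < |g ω|
    · exact Or.inl h3
    · refine Or.inr ?_
      change ε / N ≤ u a ω
      rw [div_le_iff₀ hN]
      have h4 : 0 < |g ω| * u a ω := lt_of_lt_of_le hε (h2.trans h1)
      have h5 : 0 < u a ω := pos_of_mul_pos_right h4 (abs_nonneg _)
      nlinarith [not_lt.1 h3]
  have := measureReal_union_le (μ := P) {ω | N < |g ω|} {ω | ε / N ≤ u a ω}
  linarith

theorem Small.of_le [IsProbabilityMeasure P] {u v : α → Ω → ℝ} {l : Filter α} (hu : Small P u l)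
    (h : ∀ᶠ a in l, ∀ᵐ ω ∂P, v a ω ≤ u a ω) : Small P v l := by
  refine hu.of_le_mul (g := fun _ => 1) aemeasurable_const ?_
  simpa using h

theorem Small.add [IsProbabilityMeasure P] {u v : α → Ω → ℝ} {l : Filter α} (hu : Small P u l)
    (hv : Small P v l) : Small P (fun a ω => u a ω + v a ω) l := by
  intro ε hε
  have := (hu _ (half_pos hε)).add (hv _ (half_pos hε))
  rw [add_zero] at this
  refine squeeze_zero (fun _ => measureReal_nonneg) (fun a => ?_) this
  refine (measureReal_mono ?_).trans (measureReal_union_le _ _)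
  intro ω hω
  have hω : ε ≤ u a ω + v a ω := hω
  by_contra hcon
  simp only [Set.mem_union, Set.mem_ofPred_eq, not_or, not_le] at hcon
  linarith [hcon.1, hcon.2]

theorem small_const [IsProbabilityMeasure P] {u : α → ℝ} {l : Filter α} (hu : Tendsto u l (𝓝 0)) :
    Small P (fun a _ => u a) l := by
  intro ε hε
  refine tendsto_const_nhds.congr' ?_
  filter_upwards [hu.eventually (gt_mem_nhds hε)] with a ha
  have : {ω : Ω | ε ≤ u a} = ∅ := by
    ext ω
    simpa using ha
  rw [this, measureReal_empty]

/-- Gives uniqueness of limits, and lets almost sure inequalities pass to limits in probability. -/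
theorem Small.le_zero_of_const [IsProbabilityMeasure P] {v : Ω → ℝ} {l : Filter α} [l.NeBot]
    (h : Small P (fun _ : α => v) l) : ∀ᵐ ω ∂P, v ω ≤ 0 := by
  have hn : ∀ n : ℕ, ∀ᵐ ω ∂P, v ω < 1 / ((n : ℝ) + 1) := by
    intro n
    have h1 := tendsto_nhds_unique (h (1 / ((n : ℝ) + 1)) Nat.one_div_pos_of_nat)
      tendsto_const_nhds
    have h1 := (measureReal_eq_zero_iff (measure_ne_top _ _)).1 h1.symm
    filter_upwards [measure_eq_zero_iff_ae_notMem.1 h1] with ω hω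
    exact not_le.1 hω
  filter_upwards [ae_all_iff.2 hn] with ω hω
  exact ge_of_tendsto' tendsto_one_div_add_atTop_nhds_zero_nat fun n => (hω n).le

end Small

/-! ### The $L^0$-norm, convergence in the $(\varepsilon,\lambda)$-topology and bounded operators -/

section Norm

variable {Ω : Type*} [MeasurableSpace Ω] {𝕜 : Type*} [RCLike 𝕜] {P : Measure Ω}

theorem L0.coeFn_absVal (ζ : L0 𝕜 P) : ⇑ζ.absVal =ᵐ[P] fun ω => ‖ζ ω‖ :=
  AEEqFun.coeFn_comp _ _ _

theorem L0.coeFn_exp (f : L0 ℝ P) : ⇑f.exp =ᵐ[P] fun ω => Real.exp (f ω) :=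
  AEEqFun.coeFn_comp _ _ _

theorem L0.coeFn_ofReal (f : L0 ℝ P) : ⇑(L0.ofReal 𝕜 f) =ᵐ[P] fun ω => (f ω : 𝕜) :=
  AEEqFun.coeFn_comp _ _ _

theorem L0.ofReal_add (f g : L0 ℝ P) : L0.ofReal 𝕜 (f + g) = L0.ofReal 𝕜 f + L0.ofReal 𝕜 g := by
  refine AEEqFun.ext ?_
  filter_upwards [L0.coeFn_ofReal (𝕜 := 𝕜) (f + g), L0.coeFn_ofReal (𝕜 := 𝕜) f,
    L0.coeFn_ofReal (𝕜 := 𝕜) g, AEEqFun.coeFn_add f g,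
    AEEqFun.coeFn_add (L0.ofReal 𝕜 f) (L0.ofReal 𝕜 g)] with ω h1 h2 h3 h4 h5
  simp [h1, h5, h2, h3, h4]

theorem L0.ofReal_mul (f g : L0 ℝ P) : L0.ofReal 𝕜 (f * g) = L0.ofReal 𝕜 f * L0.ofReal 𝕜 g := by
  refine AEEqFun.ext ?_
  filter_upwards [L0.coeFn_ofReal (𝕜 := 𝕜) (f * g), L0.coeFn_ofReal (𝕜 := 𝕜) f,
    L0.coeFn_ofReal (𝕜 := 𝕜) g, AEEqFun.coeFn_mul f g,
    AEEqFun.coeFn_mul (L0.ofReal 𝕜 f) (L0.ofReal 𝕜 g)] with ω h1 h2 h3 h4 h5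
  simp [h1, h5, h2, h3, h4]

theorem L0.exp_add (f g : L0 ℝ P) : (f + g).exp = f.exp * g.exp := by
  refine AEEqFun.ext ?_
  filter_upwards [L0.coeFn_exp (f + g), L0.coeFn_exp f, L0.coeFn_exp g, AEEqFun.coeFn_add f g,
    AEEqFun.coeFn_mul f.exp g.exp] with ω h1 h2 h3 h4 h5
  simp [h1, h5, h2, h3, h4, Real.exp_add]

theorem L0.ofReal_exp_zero : L0.ofReal 𝕜 (L0.exp (0 : L0 ℝ P)) = 1 := by
  refine AEEqFun.ext ?_
  filter_upwards [L0.coeFn_ofReal (𝕜 := 𝕜) (L0.exp (0 : L0 ℝ P)), L0.coeFn_exp (0 : L0 ℝ P),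
    AEEqFun.coeFn_zero (μ := P) (β := ℝ), AEEqFun.coeFn_one (μ := P) (β := 𝕜)] with ω h1 h2 h3 h4
  simp [h1, h2, h3, h4]

variable (𝕜 P) in
/-- The inclusion of the constants into `L⁰(F, 𝕜)`, as a ring homomorphism. -/
noncomputable def constHom : ℝ →+* L0 𝕜 P where
  toFun r := AEEqFun.const Ω (r : 𝕜)
  map_one' := by
    rw [RCLike.ofReal_one]; rfl
  map_zero' := by
    rw [RCLike.ofReal_zero]; rfl
  map_add' r s := by
    rw [RCLike.ofReal_add]; rfl
  map_mul' r s := by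
    rw [RCLike.ofReal_mul]; rfl

theorem coeFn_constHom (r : ℝ) : ⇑(constHom 𝕜 P r) =ᵐ[P] fun _ => (r : 𝕜) :=
  AEEqFun.coeFn_const _ _

theorem L0.ofReal_const (r : ℝ) : L0.ofReal 𝕜 (AEEqFun.const Ω r : L0 ℝ P) = constHom 𝕜 P r :=
  rfl

variable {S : Type*} [AddCommGroup S] [Module (L0 𝕜 P) S]

theorem rsmul_eq (r : ℝ) (x : S) : rsmul 𝕜 P r x = constHom 𝕜 P r • x := rfl

variable [RNModule 𝕜 P S]

theorem ae_nrm_nonneg (x : S) : ∀ᵐ ω ∂P, 0 ≤ nrm 𝕜 P x ω := by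
  filter_upwards [AEEqFun.coeFn_le.2 (RNModule.l0norm_nonneg (𝕜 := 𝕜) (P := P) x),
    AEEqFun.coeFn_zero (μ := P) (β := ℝ)] with ω h1 h2
  rwa [h2] at h1

theorem ae_nrm_add_le (x y : S) : ∀ᵐ ω ∂P, nrm 𝕜 P (x + y) ω ≤ nrm 𝕜 P x ω + nrm 𝕜 P y ω := by
  filter_upwards [AEEqFun.coeFn_le.2 (RNModule.l0norm_add_le (𝕜 := 𝕜) (P := P) x y),
    AEEqFun.coeFn_add (nrm 𝕜 P x) (nrm 𝕜 P y)] with ω h1 h2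
  rwa [h2] at h1

theorem ae_nrm_sub_le (x y : S) : ∀ᵐ ω ∂P, nrm 𝕜 P (x - y) ω ≤ nrm 𝕜 P x ω + nrm 𝕜 P y ω := by
  have := ae_nrm_add_le (𝕜 := 𝕜) (P := P) x (-y)
  rwa [nrm_neg, ← sub_eq_add_neg] at this

theorem ae_nrm_smul (ζ : L0 𝕜 P) (x : S) :
    ∀ᵐ ω ∂P, nrm 𝕜 P (ζ • x) ω = ‖ζ ω‖ * nrm 𝕜 P x ω := by
  rw [nrm, RNModule.l0norm_smul]
  filter_upwards [AEEqFun.coeFn_mul ζ.absVal (RNModule.l0norm 𝕜 x), L0.coeFn_absVal ζ]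
    with ω h1 h2
  rw [h1, Pi.mul_apply, h2]

theorem ae_nrm_rsmul (r : ℝ) (x : S) :
    ∀ᵐ ω ∂P, nrm 𝕜 P (rsmul 𝕜 P r x) ω = |r| * nrm 𝕜 P x ω := by
  filter_upwards [ae_nrm_smul (constHom 𝕜 P r) x, coeFn_constHom (𝕜 := 𝕜) (P := P) r] with ω h1 h2
  rw [rsmul_eq, h1, h2, RCLike.norm_ofReal]

theorem eq_zero_of_ae_nrm_le {x : S} (h : ∀ᵐ ω ∂P, nrm 𝕜 P x ω ≤ 0) : x = 0 := by
  refine RNModule.eq_zero_of_l0norm (𝕜 := 𝕜) (P := P) x (AEEqFun.ext ?_)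
  filter_upwards [h, ae_nrm_nonneg (𝕜 := 𝕜) (P := P) x, AEEqFun.coeFn_zero (μ := P) (β := ℝ)]
    with ω h1 h2 h3
  rw [h3]
  exact le_antisymm h1 h2

variable [IsProbabilityMeasure P] {α : Type*} {l : Filter α}

theorem tendstoEL_iff {f : α → S} {x : S} :
    TendstoEL 𝕜 P f l x ↔ Small P (fun a => ⇑(nrm 𝕜 P (f a - x))) l := by
  have key : ∀ (z : S) (ε : ℝ), P.real {ω | ε ≤ nrm 𝕜 P z ω} =
      1 - P.real {ω | nrm 𝕜 P z ω < ε} := by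
    intro z ε
    have h := probReal_compl_eq_one_sub₀ (μ := P) (s := {ω | nrm 𝕜 P z ω < ε})
      (nullMeasurableSet_lt (AEEqFun.aemeasurable _) aemeasurable_const)
    rw [← h]
    congr 1
    ext ω
    simp
  have hb := (epsLamBasis 𝕜 P S).nhds_hasBasis x
  rw [TendstoEL, hb.tendsto_right_iff]
  constructor
  · intro h ε hε
    rw [Metric.tendsto_nhds]
    intro δ hδ
    -- The base sets require $\lambda<1$, while $\delta$ is arbitrary.
    have hl : 0 < min δ (1 / 2) := lt_min hδ (by norm_num)
    filter_upwards [h (ball 𝕜 P S ε (min δ (1 / 2))) ⟨ε, _, hε, hl,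
      (min_le_right _ _).trans_lt (by norm_num), rfl⟩] with a ha
    obtain ⟨z, hz, hza⟩ := ha
    have hz : 1 - min δ (1 / 2) < P.real {ω | nrm 𝕜 P z ω < ε} := hz
    have hz' : f a - x = z := by
      rw [← hza]; simp
    rw [Real.dist_eq, sub_zero, abs_of_nonneg measureReal_nonneg, hz', key]
    linarith [min_le_left δ (1 / 2)]
  · rintro h _ ⟨ε, r, hε, hr, hr1, rfl⟩
    filter_upwards [(h ε hε).eventually (gt_mem_nhds hr)] with a ha
    rw [key] at ha
    refine ⟨f a - x, ?_, by simp⟩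
    change 1 - r < P.real {ω | nrm 𝕜 P (f a - x) ω < ε}
    linarith

theorem TendstoEL.unique [l.NeBot] {f : α → S} {x y : S} (hx : TendstoEL 𝕜 P f l x)
    (hy : TendstoEL 𝕜 P f l y) : x = y := by
  rw [tendstoEL_iff] at hx hy
  rw [← sub_eq_zero]
  refine eq_zero_of_ae_nrm_le (𝕜 := 𝕜) (P := P) ((hx.add hy).of_le
    (v := fun _ => ⇑(nrm 𝕜 P (x - y))) (Eventually.of_forall fun a => ?_)).le_zero_of_const
  have := ae_nrm_sub_le (𝕜 := 𝕜) (P := P) (f a - y) (f a - x)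
  rw [sub_sub_sub_cancel_left] at this
  filter_upwards [this] with ω h1
  linarith

theorem TendstoEL.congr' {f g : α → S} {x : S} (h : f =ᶠ[l] g) (hf : TendstoEL 𝕜 P f l x) :
    TendstoEL 𝕜 P g l x :=
  Tendsto.congr' h hf

theorem TendstoEL.add {f g : α → S} {x y : S} (hf : TendstoEL 𝕜 P f l x)
    (hg : TendstoEL 𝕜 P g l y) : TendstoEL 𝕜 P (fun a => f a + g a) l (x + y) := by
  let := epsLam 𝕜 P S
  have := (epsLamBasis 𝕜 P S).isTopologicalAddGroup
  exact Tendsto.add (α := α) (M := S) hf hg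

theorem TendstoEL.sub {f g : α → S} {x y : S} (hf : TendstoEL 𝕜 P f l x)
    (hg : TendstoEL 𝕜 P g l y) : TendstoEL 𝕜 P (fun a => f a - g a) l (x - y) := by
  let := epsLam 𝕜 P S
  have := (epsLamBasis 𝕜 P S).isTopologicalAddGroup
  exact Tendsto.sub (α := α) (G := S) hf hg

theorem tendstoEL_const (x : S) : TendstoEL 𝕜 P (fun _ : α => x) l x :=
  @tendsto_const_nhds S (epsLam 𝕜 P S) α _ _

/-- An additive map that is bounded by multiplication with a fixed random variable is
continuous. -/
theorem TendstoEL.map_of_bound {S' : Type*} [AddCommGroup S'] [Module (L0 𝕜 P) S']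
    [RNModule 𝕜 P S'] {f : α → S} {x : S} (hf : TendstoEL 𝕜 P f l x) (T : S → S')
    (hT : ∀ y z, T (y - z) = T y - T z) (g : L0 ℝ P)
    (hg : ∀ z, ∀ᵐ ω ∂P, nrm 𝕜 P (T z) ω ≤ |g ω| * nrm 𝕜 P z ω) :
    TendstoEL 𝕜 P (fun a => T (f a)) l (T x) := by
  rw [tendstoEL_iff] at hf ⊢
  refine hf.of_le_mul g.aemeasurable (Eventually.of_forall fun a => ?_)
  rw [← hT]
  exact hg _

omit [IsProbabilityMeasure P] in
theorem BOp.exists_bound (T : BOp 𝕜 P S) :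
    ∃ g : L0 ℝ P, ∀ z, ∀ᵐ ω ∂P, nrm 𝕜 P (T z) ω ≤ |g ω| * nrm 𝕜 P z ω := by
  obtain ⟨g, -, hg⟩ := T.2
  refine ⟨g, fun z => ?_⟩
  filter_upwards [AEEqFun.coeFn_le.2 (hg z), AEEqFun.coeFn_mul g (nrm 𝕜 P z),
    ae_nrm_nonneg (𝕜 := 𝕜) (P := P) z] with ω h1 h2 h3
  rw [h2] at h1
  exact h1.trans (mul_le_mul_of_nonneg_right (le_abs_self _) h3)

theorem TendstoEL.map {f : α → S} {x : S} (hf : TendstoEL 𝕜 P f l x) (T : BOp 𝕜 P S) :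
    TendstoEL 𝕜 P (fun a => T (f a)) l (T x) := by
  obtain ⟨g, hg⟩ := T.exists_bound
  exact hf.map_of_bound T (fun y z => map_sub T.1 y z) g hg

/-- The homomorphism `ζ T` of `B(S)`. -/
noncomputable def BOp.smul (ζ : L0 𝕜 P) (T : BOp 𝕜 P S) : BOp 𝕜 P S :=
  ⟨ζ • T.1, by
    obtain ⟨g, hg0, hg⟩ := T.2
    have h0 : ∀ᵐ ω ∂P, 0 ≤ g ω := by
      filter_upwards [AEEqFun.coeFn_le.2 hg0, AEEqFun.coeFn_zero (μ := P) (β := ℝ)] with ω h1 h2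
      rwa [h2] at h1
    refine ⟨ζ.absVal * g, ?_, fun z => ?_⟩
    · rw [← AEEqFun.coeFn_le]
      filter_upwards [h0, AEEqFun.coeFn_zero (μ := P) (β := ℝ), AEEqFun.coeFn_mul ζ.absVal g,
        L0.coeFn_absVal ζ] with ω h1 h2 h3 h4
      rw [h2, h3, Pi.mul_apply, h4]
      exact mul_nonneg (norm_nonneg _) h1
    · rw [← AEEqFun.coeFn_le]
      filter_upwards [AEEqFun.coeFn_le.2 (hg z), AEEqFun.coeFn_mul g (nrm 𝕜 P z),
        AEEqFun.coeFn_mul (ζ.absVal * g) (nrm 𝕜 P z), AEEqFun.coeFn_mul ζ.absVal g,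
        L0.coeFn_absVal ζ, ae_nrm_smul ζ (T z)] with ω h1 h2 h3 h4 h5 h6
      rw [h2] at h1
      rw [h3, Pi.mul_apply, h4, Pi.mul_apply, h5]
      change nrm 𝕜 P (ζ • T z) ω ≤ _
      rw [h6, mul_assoc]
      exact mul_le_mul_of_nonneg_left h1 (norm_nonneg _)⟩

theorem TendstoEL.smul {f : α → S} {x : S} (hf : TendstoEL 𝕜 P f l x) (ζ : L0 𝕜 P) :
    TendstoEL 𝕜 P (fun a => ζ • f a) l (ζ • x) :=
  hf.map_of_bound (ζ • ·) (fun y z => smul_sub ζ y z) ζ.absVal fun z => by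
    filter_upwards [ae_nrm_smul ζ z, L0.coeFn_absVal ζ] with ω h1 h2
    rw [h1, h2, abs_norm]

/-- The operator norm is only an infimum, so it has to be shown that it is itself a bound. For fixed
$z$ the quotient $\|Tz\|/\|z\|$, read as $0$ where $\|z\|=0$, is a lower bound of all bounds, hence
at most the infimum. Where $\|z\|=0$, any one bound shows $\|Tz\|=0$. -/
theorem nrm_map_le_opNrm (T : BOp 𝕜 P S) (z : S) :
    ∀ᵐ ω ∂P, nrm 𝕜 P (T z) ω ≤ opNrm T ω * nrm 𝕜 P z ω := by
  have hm : AEStronglyMeasurable (fun ω => nrm 𝕜 P (T z) ω / nrm 𝕜 P z ω) P :=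
    ((AEEqFun.aemeasurable _).div (AEEqFun.aemeasurable _)).aestronglyMeasurable
  have hlow : AEEqFun.mk _ hm ∈ lowerBounds (bounds T.1) := by
    intro g hg
    rw [← AEEqFun.coeFn_le]
    filter_upwards [AEEqFun.coeFn_mk _ hm, AEEqFun.coeFn_le.2 (hg.2 z),
      AEEqFun.coeFn_mul g (nrm 𝕜 P z), AEEqFun.coeFn_le.2 hg.1,
      AEEqFun.coeFn_zero (μ := P) (β := ℝ), ae_nrm_nonneg (𝕜 := 𝕜) (P := P) z]
      with ω h1 h2 h3 h4 h5 h6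
    rw [h1]
    rw [h3] at h2
    rw [h5] at h4
    exact div_le_of_le_mul₀ h6 h4 h2
  have hle := (isGLB_opNrm T).2 hlow
  obtain ⟨g, hg⟩ := T.2
  filter_upwards [AEEqFun.coeFn_mk _ hm, AEEqFun.coeFn_le.2 (hg.2 z),
      AEEqFun.coeFn_mul g (nrm 𝕜 P z), AEEqFun.coeFn_le.2 hle,
      ae_nrm_nonneg (𝕜 := 𝕜) (P := P) z] with ω h1 h2 h3 h4 h6
  rcases h6.eq_or_lt with h | h
  · rw [h3, Pi.mul_apply, ← h, mul_zero] at h2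
    rwa [← h, mul_zero]
  · rw [h1] at h4
    exact (div_le_iff₀ h).1 h4

end Norm

/-! ### Weighted $L^1$-type Banach spaces inside $S$ -/

section WSpace

variable {Ω : Type*} [MeasurableSpace Ω] {P : Measure Ω}

/-- The weight `1 / (1 + |b|)`. -/
noncomputable def wt (b : L0 ℝ P) (ω : Ω) : ℝ := (1 + |b ω|)⁻¹

theorem wt_pos (b : L0 ℝ P) (ω : Ω) : 0 < wt b ω := by
  unfold wt; positivity

theorem wt_le_one (b : L0 ℝ P) (ω : Ω) : wt b ω ≤ 1 :=
  inv_le_one_of_one_le₀ (by linarith [abs_nonneg (b ω)])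

theorem wt_mul_le_one (b : L0 ℝ P) {ω : Ω} {r : ℝ} (h : r ≤ b ω) : wt b ω * r ≤ 1 := by
  rw [wt, inv_mul_le_iff₀ (by positivity), mul_one]
  linarith [le_abs_self (b ω)]

theorem aemeasurable_wt (b : L0 ℝ P) : AEMeasurable (wt b) P :=
  (aemeasurable_const.add b.aemeasurable.abs).inv

variable (𝕜 : Type*) [RCLike 𝕜] (S : Type*) [AddCommGroup S] [Module (L0 𝕜 P) S]
  [RNModule 𝕜 P S]

variable {S} in
theorem aemeasurable_wt_mul_nrm (b : L0 ℝ P) (x : S) :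
    AEMeasurable (fun ω => wt b ω * nrm 𝕜 P x ω) P :=
  (aemeasurable_wt b).mul (AEEqFun.aemeasurable _)

variable {S} in
theorem ae_wt_mul_nrm_nonneg (b : L0 ℝ P) (x : S) : ∀ᵐ ω ∂P, 0 ≤ wt b ω * nrm 𝕜 P x ω := by
  filter_upwards [ae_nrm_nonneg (𝕜 := 𝕜) (P := P) x] with ω h
  exact mul_nonneg (wt_pos b ω).le h

variable {S} in
theorem integrable_wt_nrm_of_le {b : L0 ℝ P} {x : S} {u : Ω → ℝ} (hu : Integrable u P)
    (h : ∀ᵐ ω ∂P, wt b ω * nrm 𝕜 P x ω ≤ u ω) :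
    Integrable (fun ω => wt b ω * nrm 𝕜 P x ω) P := by
  refine hu.mono' (aemeasurable_wt_mul_nrm 𝕜 b x).aestronglyMeasurable ?_
  filter_upwards [h, ae_wt_mul_nrm_nonneg 𝕜 b x] with ω h1 h2
  rwa [Real.norm_of_nonneg h2]

/-- The elements of `S` whose norm is integrable with respect to the weight `1 / (1 + |b|)`. -/
def wSub (b : L0 ℝ P) : AddSubgroup S where
  carrier := {x | Integrable (fun ω => wt b ω * nrm 𝕜 P x ω) P}
  zero_mem' := by
    refine integrable_wt_nrm_of_le 𝕜 (integrable_zero Ω ℝ P) ?_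
    rw [nrm_zero]
    filter_upwards [AEEqFun.coeFn_zero (μ := P) (β := ℝ)] with ω h
    simp [h]
  add_mem' := by
    intro x y hx hy
    refine integrable_wt_nrm_of_le 𝕜 (hx.add hy) ?_
    filter_upwards [ae_nrm_add_le (𝕜 := 𝕜) (P := P) x y] with ω h
    rw [Pi.add_apply, ← mul_add]
    exact mul_le_mul_of_nonneg_left h (wt_pos b ω).le
  neg_mem' := by
    intro x hx
    change Integrable (fun ω => wt b ω * nrm 𝕜 P (-x) ω) P
    rw [nrm_neg]
    exact hx

/-- The elements of `S` whose norm is integrable with respect to the weight `1 / (1 + |b|)`. -/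
def WSpace (b : L0 ℝ P) : Type _ := wSub 𝕜 S b

variable {𝕜 S} {b : L0 ℝ P}

noncomputable instance : AddCommGroup (WSpace 𝕜 S b) :=
  inferInstanceAs (AddCommGroup (wSub 𝕜 S b))

/-- The inclusion of the weighted space into `S`. -/
def WSpace.val : WSpace 𝕜 S b →+ S := (wSub 𝕜 S b).subtype

theorem WSpace.val_injective : Function.Injective (WSpace.val (𝕜 := 𝕜) (S := S) (b := b)) :=
  Subtype.val_injective

theorem WSpace.integrable (x : WSpace 𝕜 S b) :
    Integrable (fun ω => wt b ω * nrm 𝕜 P x.val ω) P := x.2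

noncomputable instance : NormedAddCommGroup (WSpace 𝕜 S b) :=
  AddGroupNorm.toNormedAddCommGroup
    { toFun := fun x => ∫ ω, wt b ω * nrm 𝕜 P x.val ω ∂P
      map_zero' := by
        refine integral_eq_zero_of_ae ?_
        rw [map_zero, nrm_zero]
        filter_upwards [AEEqFun.coeFn_zero (μ := P) (β := ℝ)] with ω h
        simp [h]
      add_le' := by
        intro x y
        rw [← integral_add x.integrable y.integrable]
        refine integral_mono_ae (x + y).integrable (x.integrable.add y.integrable) ?_
        filter_upwards [ae_nrm_add_le (𝕜 := 𝕜) (P := P) x.val y.val] with ω h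
        rw [map_add, ← mul_add]
        exact mul_le_mul_of_nonneg_left h (wt_pos b ω).le
      neg' := by
        intro x
        simp only [map_neg, nrm_neg]
      eq_zero_of_map_eq_zero' := by
        intro x hx
        have := (integral_eq_zero_iff_of_nonneg_ae (ae_wt_mul_nrm_nonneg 𝕜 b x.val)
          x.integrable).1 hx
        refine WSpace.val_injective ?_
        rw [map_zero]
        refine eq_zero_of_ae_nrm_le (𝕜 := 𝕜) (P := P) ?_
        filter_upwards [this] with ω h
        exact ((mul_eq_zero.1 h).resolve_left (wt_pos b ω).ne').le }

theorem WSpace.norm_def (x : WSpace 𝕜 S b) : ‖x‖ = ∫ ω, wt b ω * nrm 𝕜 P x.val ω ∂P := rfl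

theorem ae_wt_mul_nrm_rsmul (r : ℝ) (x : S) :
    ∀ᵐ ω ∂P, wt b ω * nrm 𝕜 P (rsmul 𝕜 P r x) ω = |r| * (wt b ω * nrm 𝕜 P x ω) := by
  filter_upwards [ae_nrm_rsmul (𝕜 := 𝕜) (P := P) r x] with ω h
  rw [h]
  ring

noncomputable instance : SMul ℝ (WSpace 𝕜 S b) :=
  ⟨fun r x => ⟨rsmul 𝕜 P r x.val, by
    refine integrable_wt_nrm_of_le 𝕜 (x.integrable.const_mul |r|) ?_
    filter_upwards [ae_wt_mul_nrm_rsmul (𝕜 := 𝕜) (b := b) r x.val] with ω h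
    exact h.le⟩⟩

theorem WSpace.val_smul (r : ℝ) (x : WSpace 𝕜 S b) : (r • x).val = rsmul 𝕜 P r x.val := rfl

noncomputable instance : NormedSpace ℝ (WSpace 𝕜 S b) where
  one_smul x := WSpace.val_injective (by rw [WSpace.val_smul, rsmul_eq, map_one, one_smul])
  mul_smul r s x := WSpace.val_injective (by
    simp only [WSpace.val_smul, rsmul_eq, map_mul, mul_smul])
  smul_zero r := WSpace.val_injective (by
    rw [WSpace.val_smul, map_zero, rsmul_eq, smul_zero])
  smul_add r x y := WSpace.val_injective (by
    simp only [WSpace.val_smul, rsmul_eq, map_add, smul_add])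
  add_smul r s x := WSpace.val_injective (by
    simp only [WSpace.val_smul, rsmul_eq, map_add, add_smul])
  zero_smul x := WSpace.val_injective (by
    rw [WSpace.val_smul, map_zero, rsmul_eq, map_zero, zero_smul])
  norm_smul_le r x := by
    rw [WSpace.norm_def, WSpace.norm_def, WSpace.val_smul, Real.norm_eq_abs,
      ← integral_const_mul]
    exact (integral_congr_ae (ae_wt_mul_nrm_rsmul (𝕜 := 𝕜) (b := b) r x.val)).le

variable [IsProbabilityMeasure P]

omit [IsProbabilityMeasure P] in
theorem WSpace.small_of_tendsto {α : Type*} {l : Filter α} {f : α → WSpace 𝕜 S b}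
    (hf : Tendsto f l (𝓝 0)) : Small P (fun a ω => wt b ω * nrm 𝕜 P (f a).val ω) l := by
  intro ε hε
  have h := (tendsto_zero_iff_norm_tendsto_zero.1 hf).const_mul ε⁻¹
  rw [mul_zero] at h
  refine squeeze_zero (fun _ => measureReal_nonneg) (fun a => ?_) h
  have := mul_meas_ge_le_integral_of_nonneg (ae_wt_mul_nrm_nonneg 𝕜 b (f a).val)
    (f a).integrable ε
  rw [le_inv_mul_iff₀ hε]
  exact this

/-- Markov's inequality makes the weighted norms small in probability; multiplying by the fixed
random variable $1+|b|$ removes the weight. -/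
theorem WSpace.tendstoEL_val {α : Type*} {l : Filter α} {f : α → WSpace 𝕜 S b}
    {x : WSpace 𝕜 S b} (hf : Tendsto f l (𝓝 x)) :
    TendstoEL 𝕜 P (fun a => (f a).val) l x.val := by
  rw [tendstoEL_iff]
  have h0 : Tendsto (fun a => f a - x) l (𝓝 0) := by
    simpa using hf.sub_const x
  refine (WSpace.small_of_tendsto h0).of_le_mul (g := fun ω => (wt b ω)⁻¹)
    (aemeasurable_wt b).inv (Eventually.of_forall fun a => ?_)
  refine Eventually.of_forall fun ω => ?_
  rw [abs_of_pos (inv_pos.2 (wt_pos b ω)), inv_mul_cancel_left₀ (wt_pos b ω).ne', map_sub]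

/-- Bounded convergence in probability: where the norm is below $\varepsilon/2$ the weight is at
most $1$, and the remaining set has small probability while the integrand there is at most $N$. -/
theorem WSpace.tendsto_of_tendstoEL {α : Type*} {l : Filter α} {f : α → WSpace 𝕜 S b}
    {x : WSpace 𝕜 S b} {N : ℝ} (hN : ∀ a, ∀ᵐ ω ∂P, wt b ω * nrm 𝕜 P (f a - x).val ω ≤ N)
    (hf : TendstoEL 𝕜 P (fun a => (f a).val) l x.val) : Tendsto f l (𝓝 x) := by
  rw [tendstoEL_iff] at hf
  rw [tendsto_iff_norm_sub_tendsto_zero, Metric.tendsto_nhds]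
  intro ε hε
  have h := (hf (ε / 2) (half_pos hε)).const_mul N
  rw [mul_zero] at h
  filter_upwards [h.eventually (gt_mem_nhds (half_pos hε))] with a ha
  rw [Real.dist_eq, sub_zero, abs_of_nonneg (norm_nonneg _), WSpace.norm_def]
  have hms : MeasurableSet {ω | ε / 2 ≤ nrm 𝕜 P ((f a).val - x.val) ω} :=
    measurableSet_le measurable_const (AEEqFun.measurable _)
  have hind : Integrable ({ω | ε / 2 ≤ nrm 𝕜 P ((f a).val - x.val) ω}.indicator
      fun _ => N) P := (integrable_const N).indicator hms
  calc ∫ ω, wt b ω * nrm 𝕜 P (f a - x).val ω ∂P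
      ≤ ∫ ω, (ε / 2 + {ω | ε / 2 ≤ nrm 𝕜 P ((f a).val - x.val) ω}.indicator
          (fun _ => N) ω) ∂P := by
        refine integral_mono_ae (f a - x).integrable ((integrable_const _).add hind) ?_
        filter_upwards [hN a, ae_nrm_nonneg (𝕜 := 𝕜) (P := P) (f a - x).val] with ω h1 h2
        by_cases h3 : ε / 2 ≤ nrm 𝕜 P ((f a).val - x.val) ω
        · rw [Set.indicator_of_mem (show ω ∈ {ω | ε / 2 ≤ nrm 𝕜 P ((f a).val - x.val) ω} from h3)]
          linarith
        · rw [Set.indicator_of_notMem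
            (show ω ∉ {ω | ε / 2 ≤ nrm 𝕜 P ((f a).val - x.val) ω} from h3), add_zero]
          rw [map_sub] at h2 ⊢
          have := mul_le_mul_of_nonneg_right (wt_le_one b ω) h2
          linarith [not_le.1 h3]
    _ = ε / 2 + N * P.real {ω | ε / 2 ≤ nrm 𝕜 P ((f a).val - x.val) ω} := by
        rw [integral_add (integrable_const _) hind, integral_const, integral_indicator hms,
          setIntegral_const]
        simp [mul_comm]
    _ < ε := by linarith

/-- The element of the weighted space given by `x ∈ S` with `‖x‖ ≤ b`. -/
def WSpace.mk (x : S) (hx : ∀ᵐ ω ∂P, nrm 𝕜 P x ω ≤ b ω) : WSpace 𝕜 S b :=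
  ⟨x, integrable_wt_nrm_of_le 𝕜 (integrable_const 1) (by
    filter_upwards [hx] with ω h
    exact wt_mul_le_one b h)⟩

theorem WSpace.val_mk (x : S) (hx : ∀ᵐ ω ∂P, nrm 𝕜 P x ω ≤ b ω) : (WSpace.mk x hx).val = x := rfl

theorem WSpace.norm_le_of_ae {x : WSpace 𝕜 S b} {r : ℝ}
    (h : ∀ᵐ ω ∂P, wt b ω * nrm 𝕜 P x.val ω ≤ r) : ‖x‖ ≤ r := by
  rw [WSpace.norm_def]
  refine (integral_mono_ae x.integrable (integrable_const r) h).trans ?_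
  simp

theorem WSpace.norm_mk_le (x : S) (hx : ∀ᵐ ω ∂P, nrm 𝕜 P x ω ≤ b ω) : ‖WSpace.mk x hx‖ ≤ 1 := by
  refine WSpace.norm_le_of_ae ?_
  filter_upwards [hx] with ω h
  exact wt_mul_le_one b h

theorem WSpace.tendsto_mk {α : Type*} {l : Filter α} {f : α → S} {x : S}
    (hf : ∀ a, ∀ᵐ ω ∂P, nrm 𝕜 P (f a) ω ≤ b ω) (hx : ∀ᵐ ω ∂P, nrm 𝕜 P x ω ≤ b ω)
    (h : TendstoEL 𝕜 P f l x) :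
    Tendsto (fun a => WSpace.mk (f a) (hf a)) l (𝓝 (WSpace.mk x hx)) := by
  refine WSpace.tendsto_of_tendstoEL (N := 2) (fun a => ?_) h
  filter_upwards [hf a, hx, ae_nrm_sub_le (𝕜 := 𝕜) (P := P) (f a) x] with ω h1 h2 h3
  rw [map_sub, WSpace.val_mk, WSpace.val_mk]
  have := mul_le_mul_of_nonneg_left h3 (wt_pos b ω).le
  linarith [wt_mul_le_one b h1, wt_mul_le_one b h2, mul_add (wt b ω) (nrm 𝕜 P (f a) ω)
    (nrm 𝕜 P x ω)]

theorem exists_tendstoEL_of_cauchy (hS : IsEpsLamComplete 𝕜 P S) {u : ℕ → S}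
    (hu : Small P (fun a : ℕ × ℕ => ⇑(nrm 𝕜 P (u a.2 - u a.1))) atTop) :
    ∃ x, TendstoEL 𝕜 P u atTop x := by
  let := epsLam 𝕜 P S
  have := (epsLamBasis 𝕜 P S).isTopologicalAddGroup
  let := IsTopologicalAddGroup.rightUniformSpace S
  have : CompleteSpace S := hS
  have hcs : CauchySeq u := by
    rw [cauchySeq_iff_tendsto]
    change Tendsto _ _ (comap (fun p : S × S => p.2 + -p.1) (𝓝 0))
    rw [tendsto_comap_iff]
    have h := (tendstoEL_iff (𝕜 := 𝕜) (P := P) (f := fun a : ℕ × ℕ => u a.2 - u a.1) (x := 0)).2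
      (by simpa only [sub_zero] using hu)
    refine Tendsto.congr (fun a => ?_) h
    simp [sub_eq_add_neg]
  exact cauchySeq_tendsto_of_complete hcs

theorem TendstoEL.exists_subseq_ae {u : ℕ → S} {x : S} (h : TendstoEL 𝕜 P u atTop x) :
    ∃ φ : ℕ → ℕ, StrictMono φ ∧
      ∀ᵐ ω ∂P, Tendsto (fun k => nrm 𝕜 P (u (φ k) - x) ω) atTop (𝓝 0) := by
  rw [tendstoEL_iff] at h
  have hm : TendstoInMeasure P (fun n => ⇑(nrm 𝕜 P (u n - x))) atTop (fun _ => (0 : ℝ)) := by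
    rw [tendstoInMeasure_iff_measureReal_norm]
    intro ε hε
    refine (h ε hε).congr fun n => measureReal_congr ?_
    filter_upwards [ae_nrm_nonneg (𝕜 := 𝕜) (P := P) (u n - x)] with ω hω
    refine propext ?_
    change ε ≤ _ ↔ ε ≤ _
    rw [sub_zero, Real.norm_of_nonneg hω]
  exact hm.exists_seq_tendsto_ae

omit [IsProbabilityMeasure P] in
theorem WSpace.lintegral_eq (x : WSpace 𝕜 S b) :
    ∫⁻ ω, ENNReal.ofReal (wt b ω * nrm 𝕜 P x.val ω) ∂P = ENNReal.ofReal ‖x‖ :=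
  (ofReal_integral_eq_lintegral_ofReal x.integrable (ae_wt_mul_nrm_nonneg 𝕜 b x.val)).symm

/-- Fatou's lemma along an almost surely convergent subsequence. It is stated with the lower
integral because the limit is not yet known to lie in the weighted space. -/
theorem WSpace.lintegral_le_of_tendstoEL {u : ℕ → WSpace 𝕜 S b} {x : S} {r : ℝ}
    (h : TendstoEL 𝕜 P (fun n => (u n).val) atTop x) (hr : ∀ᶠ n in atTop, ‖u n‖ ≤ r) :
    ∫⁻ ω, ENNReal.ofReal (wt b ω * nrm 𝕜 P x ω) ∂P ≤ ENNReal.ofReal r := by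
  obtain ⟨φ, hφ, hae⟩ := h.exists_subseq_ae
  have hpt : ∀ᵐ ω ∂P, ENNReal.ofReal (wt b ω * nrm 𝕜 P x ω) ≤
      liminf (fun k => ENNReal.ofReal (wt b ω * nrm 𝕜 P (u (φ k)).val ω)) atTop := by
    have hle : ∀ᵐ ω ∂P, ∀ k, nrm 𝕜 P x ω - nrm 𝕜 P ((u (φ k)).val - x) ω ≤
        nrm 𝕜 P (u (φ k)).val ω := by
      refine ae_all_iff.2 fun k => ?_
      have := ae_nrm_sub_le (𝕜 := 𝕜) (P := P) (u (φ k)).val ((u (φ k)).val - x)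
      rw [sub_sub_cancel] at this
      filter_upwards [this] with ω h1
      linarith
    filter_upwards [hae, hle] with ω h1 h2
    have h3 : Tendsto (fun k => ENNReal.ofReal
        (wt b ω * (nrm 𝕜 P x ω - nrm 𝕜 P ((u (φ k)).val - x) ω))) atTop
        (𝓝 (ENNReal.ofReal (wt b ω * (nrm 𝕜 P x ω - 0)))) :=
      ENNReal.tendsto_ofReal ((tendsto_const_nhds.sub h1).const_mul _)
    rw [sub_zero] at h3
    rw [← h3.liminf_eq]
    refine liminf_le_liminf (Eventually.of_forall fun k => ?_)
    exact ENNReal.ofReal_le_ofReal (mul_le_mul_of_nonneg_left (h2 k) (wt_pos b ω).le)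
  calc ∫⁻ ω, ENNReal.ofReal (wt b ω * nrm 𝕜 P x ω) ∂P
      ≤ ∫⁻ ω, liminf (fun k => ENNReal.ofReal (wt b ω * nrm 𝕜 P (u (φ k)).val ω)) atTop ∂P :=
        lintegral_mono_ae hpt
    _ ≤ liminf (fun k => ∫⁻ ω, ENNReal.ofReal (wt b ω * nrm 𝕜 P (u (φ k)).val ω) ∂P) atTop :=
        lintegral_liminf_le' fun k => (aemeasurable_wt_mul_nrm 𝕜 b _).ennreal_ofReal
    _ ≤ liminf (fun _ : ℕ => ENNReal.ofReal r) atTop := by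
        refine liminf_le_liminf ?_
        filter_upwards [hφ.tendsto_atTop.eventually hr] with k hk
        rw [WSpace.lintegral_eq]
        exact ENNReal.ofReal_le_ofReal hk
    _ = ENNReal.ofReal r := liminf_const _

/-- A norm Cauchy sequence is Cauchy in the $(\varepsilon,\lambda)$-topology and so has a limit in
$S$. Fatou's lemma, applied to $u_m-u_n$ as $m\to\infty$, shows both that the limit is in the
weighted space and that convergence holds in norm. -/
theorem WSpace.completeSpace (hS : IsEpsLamComplete 𝕜 P S) : CompleteSpace (WSpace 𝕜 S b) := by
  refine Metric.complete_of_cauchySeq_tendsto fun u hu => ?_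
  have hdiff : Tendsto (fun a : ℕ × ℕ => u a.2 - u a.1) atTop (𝓝 0) := by
    rw [cauchySeq_iff_tendsto, uniformity_eq_comap_nhds_zero, tendsto_comap_iff] at hu
    exact hu
  obtain ⟨x, hx⟩ := exists_tendstoEL_of_cauchy hS (u := fun n => (u n).val) (by
    have := tendstoEL_iff.1 (WSpace.tendstoEL_val hdiff)
    simpa only [map_zero, sub_zero, map_sub] using this)
  have hint : ∀ (n : ℕ) (r : ℝ), (∀ m ≥ n, ‖u m - u n‖ ≤ r) →
      ∫⁻ ω, ENNReal.ofReal (wt b ω * nrm 𝕜 P (x - (u n).val) ω) ∂P ≤ ENNReal.ofReal r := by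
    intro n r h
    refine WSpace.lintegral_le_of_tendstoEL (u := fun m => u m - u n) ?_
      (eventually_atTop.2 ⟨n, h⟩)
    simp only [map_sub]
    exact hx.sub (tendstoEL_const _)
  have hmem : ∀ n r, (∀ m ≥ n, ‖u m - u n‖ ≤ r) → x - (u n).val ∈ wSub 𝕜 S b := by
    intro n r h
    refine ⟨(aemeasurable_wt_mul_nrm 𝕜 b _).aestronglyMeasurable, ?_⟩
    rw [hasFiniteIntegral_iff_ofReal (ae_wt_mul_nrm_nonneg 𝕜 b _)]
    exact (hint n r h).trans_lt ENNReal.ofReal_lt_top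
  rw [Metric.cauchySeq_iff'] at hu
  have hu' : ∀ ε > 0, ∃ N, ∀ n ≥ N, ∀ m ≥ n, ‖u m - u n‖ ≤ ε := by
    intro ε hε
    obtain ⟨N, hN⟩ := hu (ε / 2) (half_pos hε)
    refine ⟨N, fun n hn m hm => ?_⟩
    rw [← dist_eq_norm]
    have h1 := hN n hn
    have h2 := hN m (hn.trans hm)
    have h3 := dist_triangle_right (u m) (u n) (u N)
    linarith
  have hxm : x ∈ wSub 𝕜 S b := by
    obtain ⟨N, hN⟩ := hu' 1 one_pos
    have h1 := (wSub 𝕜 S b).add_mem (hmem N 1 (hN N le_rfl)) (u N).2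
    have h2 : x - (u N).val + (u N).val = x := sub_add_cancel _ _
    rw [← h2]
    exact h1
  obtain ⟨y, rfl⟩ : ∃ y : WSpace 𝕜 S b, y.val = x := ⟨⟨x, hxm⟩, rfl⟩
  refine ⟨y, ?_⟩
  rw [Metric.tendsto_atTop]
  intro ε hε
  obtain ⟨N, hN⟩ := hu' (ε / 2) (half_pos hε)
  refine ⟨N, fun n hn => ?_⟩
  rw [dist_comm, dist_eq_norm]
  have h1 := hint n _ (hN n hn)
  have h2 := WSpace.lintegral_eq (y - u n)
  rw [map_sub] at h2
  have h3 := h2.symm.le.trans h1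
  rw [ENNReal.ofReal_le_ofReal_iff (half_pos hε).le] at h3
  linarith

end WSpace

/-! ### Riemann sums as a limit along a filter of tagged partitions -/

section RiemannSums

/-- Tagged partitions: the number of subintervals, the division points and the tags. -/
abbrev TaggedPartition : Type := ℕ × (ℕ → ℝ≥0) × (ℕ → ℝ≥0)

/-- The tagged partitions of `[0, L]` of mesh less than `δ`. -/
def meshSet (L : ℝ≥0) (δ : ℝ) : Set TaggedPartition :=
  {p | p.2.1 0 = 0 ∧ p.2.1 p.1 = L ∧ ∀ i < p.1, p.2.1 i ≤ p.2.2 i ∧ p.2.2 i ≤ p.2.1 (i + 1) ∧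
    (p.2.1 (i + 1) : ℝ) - p.2.1 i < δ}

/-- The filter of tagged partitions of `[0, L]` whose mesh tends to `0`. -/
def riemannFilter (L : ℝ≥0) : Filter TaggedPartition := ⨅ δ ∈ Set.Ioi (0 : ℝ), 𝓟 (meshSet L δ)

theorem hasBasis_riemannFilter (L : ℝ≥0) :
    (riemannFilter L).HasBasis (fun δ => 0 < δ) (meshSet L) := by
  refine hasBasis_biInf_principal ?_ ⟨1, Set.mem_Ioi.2 one_pos⟩
  intro a ha b hb
  refine ⟨min a b, Set.mem_Ioi.2 (lt_min ha hb), ?_, ?_⟩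
  · exact fun p hp => ⟨hp.1, hp.2.1, fun i hi => ⟨(hp.2.2 i hi).1, (hp.2.2 i hi).2.1,
      (hp.2.2 i hi).2.2.trans_le (min_le_left _ _)⟩⟩
  · exact fun p hp => ⟨hp.1, hp.2.1, fun i hi => ⟨(hp.2.2 i hi).1, (hp.2.2 i hi).2.1,
      (hp.2.2 i hi).2.2.trans_le (min_le_right _ _)⟩⟩

instance (L : ℝ≥0) : (riemannFilter L).NeBot := by
  rw [(hasBasis_riemannFilter L).neBot_iff]
  intro δ hδ
  obtain ⟨n, hn⟩ := exists_nat_gt ((L : ℝ) / δ)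
  have hn0 : (0 : ℝ) < n := lt_of_le_of_lt (div_nonneg L.2 hδ.le) hn
  have hn1 : (n : ℝ≥0) ≠ 0 := by
    intro h
    rw [Nat.cast_eq_zero] at h
    simp [h] at hn0
  refine ⟨(n, fun i => i * L / n, fun i => i * L / n), ?_, ?_, fun i _ => ⟨le_rfl, ?_, ?_⟩⟩
  · simp
  · exact mul_div_cancel_left₀ L hn1
  · change (i : ℝ≥0) * L / n ≤ ((i + 1 : ℕ) : ℝ≥0) * L / n
    gcongr
    exact i.le_succ
  · change (((((i + 1 : ℕ) : ℝ≥0) * L / n : ℝ≥0) : ℝ) - (((i : ℝ≥0) * L / n : ℝ≥0) : ℝ)) < δ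
    push_cast
    rw [← sub_div, ← sub_mul, add_sub_cancel_left, one_mul, div_lt_iff₀ hn0]
    rwa [div_lt_iff₀' hδ, mul_comm, mul_comm] at hn

theorem step_le_of_mem_meshSet {L : ℝ≥0} {δ : ℝ} {p : TaggedPartition} (hp : p ∈ meshSet L δ) {i : ℕ}
    (hi : i < p.1) : p.2.1 i ≤ p.2.1 (i + 1) :=
  (hp.2.2 i hi).1.trans (hp.2.2 i hi).2.1

theorem le_of_mem_meshSet {L : ℝ≥0} {δ : ℝ} {p : TaggedPartition} (hp : p ∈ meshSet L δ) {i : ℕ}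
    (hi : i ≤ p.1) : p.2.1 i ≤ L := by
  rw [← hp.2.1]
  induction hi using Nat.decreasingInduction with
  | self => exact le_rfl
  | of_succ k hk ih => exact (step_le_of_mem_meshSet hp hk).trans ih

theorem sum_eq_of_mem_meshSet {L : ℝ≥0} {δ : ℝ} {p : TaggedPartition} (hp : p ∈ meshSet L δ) :
    ∑ i ∈ Finset.range p.1, ((p.2.1 (i + 1) : ℝ) - p.2.1 i) = L := by
  rw [Finset.sum_range_sub (fun i => (p.2.1 i : ℝ)), hp.1, hp.2.1]
  simp

variable {E : Type*} [NormedAddCommGroup E] [NormedSpace ℝ E]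

/-- The Riemann sums of a continuous function converge to its integral. -/
theorem tendsto_riemannSum [CompleteSpace E] {K : ℝ → E} (hK : Continuous K) (L : ℝ≥0) :
    Tendsto (fun p : TaggedPartition => ∑ i ∈ Finset.range p.1,
      ((p.2.1 (i + 1) : ℝ) - p.2.1 i) • K (p.2.2 i)) (riemannFilter L)
      (𝓝 (∫ s in (0 : ℝ)..L, K s)) := by
  rw [(hasBasis_riemannFilter L).tendsto_iff Metric.nhds_basis_closedBall]
  intro ε hε
  have hL : (0 : ℝ) < L + 1 := by positivity
  -- Uniform continuity on $[0,L]$ with tolerance $\varepsilon/(L+1)$ gives total error at most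
  -- $\varepsilon L/(L+1)$; the $+1$ covers $L=0$.
  have huc := (isCompact_Icc (a := (0 : ℝ)) (b := L)).uniformContinuousOn_of_continuous
    hK.continuousOn
  rw [Metric.uniformContinuousOn_iff] at huc
  obtain ⟨δ, hδ, h⟩ := huc (ε / (L + 1)) (div_pos hε hL)
  refine ⟨δ, hδ, fun p hp => ?_⟩
  have h0 : (0 : ℝ) = p.2.1 0 := by rw [hp.1]; rfl
  have hn : (L : ℝ) = p.2.1 p.1 := by rw [hp.2.1]
  have hint : ∫ s in (0 : ℝ)..L, K s =
      ∑ i ∈ Finset.range p.1, ∫ s in (p.2.1 i : ℝ)..p.2.1 (i + 1), K s := by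
    rw [intervalIntegral.sum_integral_adjacent_intervals (a := fun i => (p.2.1 i : ℝ))
      fun k _ => hK.intervalIntegrable _ _, ← h0, ← hn]
  rw [mem_closedBall_iff_norm, hint, ← Finset.sum_sub_distrib]
  calc ‖∑ i ∈ Finset.range p.1, (((p.2.1 (i + 1) : ℝ) - p.2.1 i) • K (p.2.2 i) -
        ∫ s in (p.2.1 i : ℝ)..p.2.1 (i + 1), K s)‖
      ≤ ∑ i ∈ Finset.range p.1, ε / (L + 1) * ((p.2.1 (i + 1) : ℝ) - p.2.1 i) := by
        refine norm_sum_le_of_le _ fun i hi => ?_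
        have hi := Finset.mem_range.1 hi
        have hle : (p.2.1 i : ℝ) ≤ p.2.1 (i + 1) := step_le_of_mem_meshSet hp hi
        rw [← intervalIntegral.integral_const (E := E) (K (p.2.2 i)),
          ← intervalIntegral.integral_sub intervalIntegrable_const (hK.intervalIntegrable _ _)]
        have h1 : |(p.2.1 (i + 1) : ℝ) - p.2.1 i| = (p.2.1 (i + 1) : ℝ) - p.2.1 i :=
          abs_of_nonneg (sub_nonneg.2 hle)
        rw [← h1]
        refine intervalIntegral.norm_integral_le_of_norm_le_const fun s hs => ?_
        rw [Set.uIoc_of_le hle] at hs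
        have h2 := hp.2.2 i hi
        have h3 : (p.2.1 i : ℝ) ≤ p.2.2 i := h2.1
        have h4 : (p.2.2 i : ℝ) ≤ p.2.1 (i + 1) := h2.2.1
        have h5 : (p.2.1 (i + 1) : ℝ) ≤ L := le_of_mem_meshSet hp hi
        have h6 : (0 : ℝ) ≤ p.2.1 i := (p.2.1 i).2
        rw [← dist_eq_norm]
        refine (h _ ⟨h6.trans h3, h4.trans h5⟩ _ ⟨h6.trans hs.1.le, hs.2.trans h5⟩ ?_).le
        rw [Real.dist_eq, abs_lt]
        constructor <;> linarith [hs.1, hs.2, h2.2.2]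
    _ = ε / (L + 1) * L := by rw [← Finset.mul_sum, sum_eq_of_mem_meshSet hp]
    _ ≤ ε := by
        rw [div_mul_eq_mul_div, div_le_iff₀ hL]
        nlinarith

end RiemannSums

/-! ### Laplace transforms of bounded continuous functions in a Banach space -/

section Laplace

variable {E : Type*} [NormedAddCommGroup E] [NormedSpace ℝ E] {K : ℝ → E} {N : ℝ}

theorem integrableOn_exp_smul (hK : Continuous K) (hN : ∀ s, ‖K s‖ ≤ N) {r : ℝ} (hr : 0 < r) :
    IntegrableOn (fun s => Real.exp (-r * s) • K s) (Set.Ioi 0) := by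
  refine ((exp_neg_integrableOn_Ioi 0 hr).mul_const N).mono'
    (by fun_prop : Continuous fun s => Real.exp (-r * s) • K s).aestronglyMeasurable ?_
  refine Eventually.of_forall fun s => ?_
  rw [norm_smul, Real.norm_of_nonneg (Real.exp_nonneg _)]
  exact mul_le_mul_of_nonneg_left (hN s) (Real.exp_nonneg _)

theorem integrableOn_exp_smul_comp_exp (hK : Continuous K) (hN : ∀ s, ‖K s‖ ≤ N) {ψ : ℝ → ℝ}
    (hψ : Continuous ψ) :
    IntegrableOn (fun s => Real.exp (-1 * s) • (ψ (Real.exp (-s)) • K s)) (Set.Ioi 0) := by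
  obtain ⟨B, hB⟩ := (isCompact_Icc (a := (0 : ℝ)) (b := 1)).exists_bound_of_continuousOn
    hψ.continuousOn
  have hBN : IntegrableOn (fun s : ℝ => Real.exp (-1 * s) * (B * N)) (Set.Ioi 0) :=
    (exp_neg_integrableOn_Ioi 0 one_pos).mul_const _
  refine hBN.mono' (by fun_prop : Continuous fun s => Real.exp (-1 * s) •
    (ψ (Real.exp (-s)) • K s)).aestronglyMeasurable ?_
  refine (ae_restrict_iff' measurableSet_Ioi).2 (Eventually.of_forall fun s hs => ?_)
  rw [norm_smul, Real.norm_of_nonneg (Real.exp_nonneg _), norm_smul]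
  have hB1 := hB (Real.exp (-s)) ⟨Real.exp_nonneg _, Real.exp_le_one_iff.2 (by
    have : (0 : ℝ) < s := hs
    linarith)⟩
  exact mul_le_mul_of_nonneg_left (mul_le_mul hB1 (hN s) (norm_nonneg _)
    ((norm_nonneg _).trans hB1)) (Real.exp_nonneg _)

theorem integral_exp_smul_polynomial (hK : Continuous K) (hN : ∀ s, ‖K s‖ ≤ N)
    (h0 : ∀ n : ℕ, ∫ s in Set.Ioi 0, Real.exp (-(n + 1 : ℝ) * s) • K s = 0)
    (p : Polynomial ℝ) :
    ∫ s in Set.Ioi 0, Real.exp (-1 * s) • (p.eval (Real.exp (-s)) • K s) = 0 := by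
  have hint := fun q : Polynomial ℝ => integrableOn_exp_smul_comp_exp hK hN q.continuous
  induction p using Polynomial.induction_on' with
  | add p q hp hq =>
    simp only [Polynomial.eval_add, add_smul, smul_add]
    rw [integral_add (hint p) (hint q), hp, hq, add_zero]
  | monomial n a =>
    have : ∀ s : ℝ, Real.exp (-1 * s) • ((Polynomial.monomial n a).eval (Real.exp (-s)) • K s)
        = a • (Real.exp (-(n + 1 : ℝ) * s) • K s) := by
      intro s
      rw [Polynomial.eval_monomial, smul_smul, smul_smul, ← Real.exp_nat_mul, mul_left_comm,
        ← Real.exp_add]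
      congr 3
      ring
    simp only [this]
    rw [integral_smul, h0, smul_zero]

/-- Weierstrass approximation on $[0,1]$, where $e^{-s}$ takes its values. The polynomial integrals
vanish, and an approximation within $\varepsilon/(N+1)$ costs at most $\varepsilon$ because
$\int_0^\infty e^{-s}\,ds=1$. -/
theorem integral_exp_smul_continuous (hK : Continuous K) (hN : ∀ s, ‖K s‖ ≤ N)
    (h0 : ∀ n : ℕ, ∫ s in Set.Ioi 0, Real.exp (-(n + 1 : ℝ) * s) • K s = 0)
    {φ : ℝ → ℝ} (hφ : Continuous φ) :
    ∫ s in Set.Ioi 0, Real.exp (-1 * s) • (φ (Real.exp (-s)) • K s) = 0 := by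
  have hN0 : 0 ≤ N := (norm_nonneg _).trans (hN 0)
  rw [← norm_le_zero_iff]
  refine le_of_forall_pos_le_add fun ε hε => ?_
  rw [zero_add]
  obtain ⟨p, hp⟩ := exists_polynomial_near_of_continuousOn 0 1 φ hφ.continuousOn (ε / (N + 1))
    (by positivity)
  have hb : ∀ s ∈ Set.Ioi (0 : ℝ), Real.exp (-s) ∈ Set.Icc (0 : ℝ) 1 := fun s hs =>
    ⟨Real.exp_nonneg _, Real.exp_le_one_iff.2 (by
      have : (0 : ℝ) < s := hs
      linarith)⟩
  have hsub := integral_sub (integrableOn_exp_smul_comp_exp hK hN hφ)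
    (integrableOn_exp_smul_comp_exp hK hN p.continuous)
  rw [integral_exp_smul_polynomial hK hN h0 p, sub_zero] at hsub
  rw [← hsub]
  have hg : IntegrableOn (fun s : ℝ => Real.exp (-1 * s) * (ε / (N + 1) * N)) (Set.Ioi 0) :=
    (exp_neg_integrableOn_Ioi 0 one_pos).mul_const _
  refine (norm_integral_le_of_norm_le hg ?_).trans ?_
  · refine (ae_restrict_iff' measurableSet_Ioi).2 (Eventually.of_forall fun s hs => ?_)
    rw [← smul_sub, ← sub_smul, norm_smul, Real.norm_of_nonneg (Real.exp_nonneg _), norm_smul,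
      Real.norm_eq_abs, abs_sub_comm]
    exact mul_le_mul_of_nonneg_left (mul_le_mul (hp _ (hb s hs)).le (hN s) (norm_nonneg _)
      (by positivity)) (Real.exp_nonneg _)
  · rw [integral_mul_const, integral_exp_mul_Ioi (by norm_num)]
    simp only [mul_zero, Real.exp_zero]
    rw [neg_div_neg_eq, div_one, one_mul, div_mul_eq_mul_div, div_le_iff₀ (by positivity)]
    nlinarith

/-- A bounded continuous function is determined on `[0, ∞)` by the values of its Laplace
transform at the positive integers. -/
theorem eq_zero_of_laplace_eq_zero [CompleteSpace E] (hK : Continuous K) (hN : ∀ s, ‖K s‖ ≤ N)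
    (h0 : ∀ n : ℕ, ∫ s in Set.Ioi 0, Real.exp (-(n + 1 : ℝ) * s) • K s = 0)
    {s : ℝ} (hs : 0 ≤ s) : K s = 0 := by
  have hae : ∀ᵐ s : ℝ, s ∈ Set.Ioi (0 : ℝ) → K s = 0 := by
    refine isOpen_Ioi.ae_eq_zero_of_integral_contDiff_smul_eq_zero
      (hK.locallyIntegrable.locallyIntegrableOn _) fun g hg hcs hsub => ?_
    obtain ⟨c, hc⟩ : ∃ c : ℝ, ∀ s, c < s → g s = 0 := by
      obtain ⟨c, hc⟩ := hcs.isCompact.bddAbove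
      exact ⟨c, fun s hs => image_eq_zero_of_notMem_tsupport fun h => not_lt.2 (hc h) hs⟩
    -- A test function has the form $g(s)=e^{-s}\varphi(e^{-s})$ with $\varphi(u)=g(-\log u)/u$. The
    -- support of $g$ is bounded above, so $\varphi$ vanishes near $0$ and is continuous there too.
    have hφ : Continuous fun u : ℝ => g (-Real.log u) * u⁻¹ := by
      rw [continuous_iff_continuousAt]
      intro u
      by_cases hu : u = 0
      · subst hu
        have : (fun u : ℝ => g (-Real.log u) * u⁻¹) =ᶠ[𝓝 0] fun _ => 0 := by
          filter_upwards [Metric.ball_mem_nhds (0 : ℝ) (Real.exp_pos (-c))] with u hu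
          rw [Metric.mem_ball, dist_zero_right, Real.norm_eq_abs] at hu
          by_cases h : u = 0
          · simp [h]
          · rw [hc, zero_mul]
            have := Real.log_lt_log (abs_pos.2 h) hu
            rw [Real.log_abs, Real.log_exp] at this
            linarith
        exact continuousAt_const.congr this.symm
      · exact (hg.continuous.continuousAt.comp (Real.continuousAt_log hu).neg).mul
          (continuousAt_inv₀ hu)
    have h1 := integral_exp_smul_continuous hK hN h0 hφ
    rw [← h1, ← integral_indicator measurableSet_Ioi]
    refine integral_congr_ae (Eventually.of_forall fun s => ?_)
    by_cases h : s ∈ Set.Ioi (0 : ℝ)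
    · simp only [Set.indicator_of_mem h]
      rw [Real.log_exp, neg_neg, smul_smul, ← Real.exp_neg, neg_neg, mul_left_comm,
        ← Real.exp_add]
      simp
    · simp only [Set.indicator_of_notMem h]
      rw [image_eq_zero_of_notMem_tsupport fun h' => h (hsub h'), zero_smul]
  -- Continuity upgrades the almost everywhere statement to the open half-line, and its closure
  -- contains $0$.
  have hEq : Set.EqOn K 0 (Set.Ioi 0) := by
    refine Measure.eqOn_open_of_ae_eq (μ := volume) ?_ isOpen_Ioi hK.continuousOn
      continuousOn_const
    exact (ae_restrict_iff' measurableSet_Ioi).2 hae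
  have := hEq.closure hK continuous_const
  rw [closure_Ioi] at this
  exact this hs

variable (K) in
/-- The function `s ↦ ∫₀^∞ e^{-r t} K(s + t) dt`, written with the help of the integral
`∫₀^s e^{-r u} K(u) du`. -/
noncomputable def laplaceShift (r s : ℝ) : E :=
  Real.exp (r * s) • ((∫ u in Set.Ioi 0, Real.exp (-r * u) • K u) -
    ∫ u in (0 : ℝ)..s, Real.exp (-r * u) • K u)

theorem tendsto_laplaceShift (hK : Continuous K) (hN : ∀ s, ‖K s‖ ≤ N) {r : ℝ}
    (hr : 0 < r) (s : ℝ) :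
    Tendsto (fun T => ∫ t in (0 : ℝ)..T, Real.exp (-r * t) • K (s + t)) atTop
      (𝓝 (laplaceShift K r s)) := by
  have hc : Continuous fun u => Real.exp (-r * u) • K u := by fun_prop
  have heq : ∀ T, ∫ t in (0 : ℝ)..T, Real.exp (-r * t) • K (s + t) =
      Real.exp (r * s) • ((∫ u in (0 : ℝ)..(s + T), Real.exp (-r * u) • K u) -
        ∫ u in (0 : ℝ)..s, Real.exp (-r * u) • K u) := by
    intro T
    rw [intervalIntegral.integral_interval_sub_left (hc.intervalIntegrable _ _)
      (hc.intervalIntegrable _ _)]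
    have h1 := intervalIntegral.integral_comp_add_left (a := 0) (b := T)
      (fun u => Real.exp (-r * u) • K u) s
    rw [add_zero] at h1
    rw [← h1, ← intervalIntegral.integral_smul]
    congr 1
    ext t
    rw [smul_smul, ← Real.exp_add]
    congr 2
    ring
  simp only [heq]
  refine Tendsto.const_smul (Tendsto.sub_const ?_ _) _
  exact intervalIntegral_tendsto_integral_Ioi 0 (integrableOn_exp_smul hK hN hr)
    (tendsto_atTop_add_const_left _ _ tendsto_id)

/-- The defining formula contains the growing factor $e^{rs}$. Boundedness becomes visible in the
form $\int_0^\infty e^{-rt}K(s+t)\,dt$, whose integrand is bounded by $Ne^{-rt}$. -/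
theorem norm_laplaceShift_le (hK : Continuous K) (hN : ∀ s, ‖K s‖ ≤ N) {r : ℝ}
    (hr : 0 < r) (s : ℝ) : ‖laplaceShift K r s‖ ≤ N / r := by
  have hKs : Continuous fun t => K (s + t) := by fun_prop
  have h1 := tendsto_nhds_unique (tendsto_laplaceShift hK hN hr s)
    (intervalIntegral_tendsto_integral_Ioi 0 (integrableOn_exp_smul hKs (fun t => hN _) hr)
      tendsto_id)
  rw [h1]
  refine (norm_integral_le_of_norm_le ((exp_neg_integrableOn_Ioi 0 hr).mul_const N)
    (Eventually.of_forall fun t => ?_)).trans ?_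
  · rw [norm_smul, Real.norm_of_nonneg (Real.exp_nonneg _)]
    exact mul_le_mul_of_nonneg_left (hN _) (Real.exp_nonneg _)
  · rw [integral_mul_const, integral_exp_mul_Ioi (by linarith)]
    simp only [mul_zero, Real.exp_zero]
    rw [neg_div_neg_eq, one_div, inv_mul_eq_div]

variable [CompleteSpace E]

/-- Product rule and the fundamental theorem of calculus: the shifted transform solves $H'=rH-K$
although $K$ is merely continuous. -/
theorem hasDerivAt_laplaceShift (hK : Continuous K) (r s : ℝ) :
    HasDerivAt (laplaceShift K r) (r • laplaceShift K r s - K s) s := by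
  have hc : Continuous fun u => Real.exp (-r * u) • K u := by fun_prop
  have h1 : HasDerivAt (fun s => ∫ u in (0 : ℝ)..s, Real.exp (-r * u) • K u)
      (Real.exp (-r * s) • K s) s :=
    intervalIntegral.integral_hasDerivAt_right (hc.intervalIntegrable _ _)
      (hc.stronglyMeasurableAtFilter _ _) hc.continuousAt
  have h2 : HasDerivAt (fun s => Real.exp (r * s)) (Real.exp (r * s) * r) s := by
    simpa using ((hasDerivAt_id s).const_mul r).exp
  have h3 := h2.smul (h1.const_sub (∫ u in Set.Ioi 0, Real.exp (-r * u) • K u))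
  refine h3.congr_deriv ?_
  rw [smul_neg, smul_smul, ← Real.exp_add, laplaceShift, smul_smul, mul_comm r (Real.exp _)]
  rw [neg_mul, add_neg_cancel, Real.exp_zero, one_smul]
  abel

theorem continuous_laplaceShift (hK : Continuous K) (r : ℝ) : Continuous (laplaceShift K r) :=
  continuous_iff_continuousAt.2 fun s => (hasDerivAt_laplaceShift hK r s).continuousAt

/-- Integrate $(e^{-qs}H(s))'=(r-q)e^{-qs}H(s)-e^{-qs}K(s)$ over the half-line. The boundary term at
infinity vanishes since $H$ is bounded, and $H(0)$ is the Laplace transform of $K$ at $r$. This is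
the scalar shadow of the resolvent equation. -/
theorem laplace_laplaceShift (hK : Continuous K) (hN : ∀ s, ‖K s‖ ≤ N) {r q : ℝ} (hr : 0 < r)
    (hq : 0 < q) :
    (r - q) • ∫ s in Set.Ioi 0, Real.exp (-q * s) • laplaceShift K r s =
      (∫ s in Set.Ioi 0, Real.exp (-q * s) • K s) -
        ∫ s in Set.Ioi 0, Real.exp (-r * s) • K s := by
  have hH := continuous_laplaceShift hK r
  have hHN := norm_laplaceShift_le hK hN hr
  have hiK := integrableOn_exp_smul hK hN hq
  have hiH := integrableOn_exp_smul hH hHN hq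
  have hderiv : ∀ s : ℝ, HasDerivAt (fun s => Real.exp (-q * s) • laplaceShift K r s)
      ((r - q) • (Real.exp (-q * s) • laplaceShift K r s) - Real.exp (-q * s) • K s) s := by
    intro s
    have h2 : HasDerivAt (fun s => Real.exp (-q * s)) (Real.exp (-q * s) * -q) s := by
      simpa using ((hasDerivAt_id s).const_mul (-q)).exp
    refine (h2.smul (hasDerivAt_laplaceShift hK r s)).congr_deriv ?_
    module
  have hlim : Tendsto (fun s => Real.exp (-q * s) • laplaceShift K r s) atTop (𝓝 0) := by
    rw [tendsto_zero_iff_norm_tendsto_zero]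
    have h1 : Tendsto (fun s => Real.exp (-q * s) * (N / r)) atTop (𝓝 (0 * (N / r))) := by
      refine Tendsto.mul_const _ (Real.tendsto_exp_atBot.comp ?_)
      exact tendsto_id.const_mul_atTop_of_neg (by linarith)
    rw [zero_mul] at h1
    refine squeeze_zero (fun _ => norm_nonneg _) (fun s => ?_) h1
    rw [norm_smul, Real.norm_of_nonneg (Real.exp_nonneg _)]
    exact mul_le_mul_of_nonneg_left (hHN s) (Real.exp_nonneg _)
  have h := integral_Ioi_of_hasDerivAt_of_tendsto' (a := 0) (fun s _ => hderiv s)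
    ((hiH.smul (r - q)).sub hiK) hlim
  have hsub := integral_sub (hiH.smul (r - q)) hiK
  simp only [Pi.smul_apply] at hsub
  rw [hsub, integral_smul, sub_eq_iff_eq_add] at h
  rw [h]
  simp only [laplaceShift, mul_zero, Real.exp_zero, one_smul, intervalIntegral.integral_same,
    sub_zero, zero_sub]
  abel

end Laplace

/-! ### Riemann, improper and Laplace integrals in $S$ -/

section Integral

variable {Ω : Type*} [MeasurableSpace Ω] {𝕜 : Type*} [RCLike 𝕜] {P : Measure Ω}
  {S : Type*} [AddCommGroup S] [Module (L0 𝕜 P) S]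

variable (𝕜 P) in
/-- The Riemann sum of `f` for a tagged partition. -/
noncomputable def rSum (f : ℝ≥0 → S) (p : TaggedPartition) : S :=
  ∑ i ∈ Finset.range p.1, rsmul 𝕜 P ((p.2.1 (i + 1) : ℝ) - p.2.1 i) (f (p.2.2 i))

variable [RNModule 𝕜 P S]

theorem ae_nrm_sum_le {ι : Type*} (s : Finset ι) (x : ι → S) :
    ∀ᵐ ω ∂P, nrm 𝕜 P (∑ i ∈ s, x i) ω ≤ ∑ i ∈ s, nrm 𝕜 P (x i) ω := by
  classical
  induction s using Finset.induction_on with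
  | empty =>
    simp only [Finset.sum_empty, nrm_zero]
    filter_upwards [AEEqFun.coeFn_zero (μ := P) (β := ℝ)] with ω h
    rw [h]
    rfl
  | insert i s hi ih =>
    filter_upwards [ih, ae_nrm_add_le (𝕜 := 𝕜) (P := P) (x i) (∑ j ∈ s, x j)] with ω h1 h2
    rw [Finset.sum_insert hi, Finset.sum_insert hi]
    linarith

theorem ae_nrm_rSum_le {f : ℝ≥0 → S} {b : L0 ℝ P} (hf : ∀ s, ∀ᵐ ω ∂P, nrm 𝕜 P (f s) ω ≤ b ω)
    {L : ℝ≥0} {δ : ℝ} {p : TaggedPartition} (hp : p ∈ meshSet L δ) :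
    ∀ᵐ ω ∂P, nrm 𝕜 P (rSum 𝕜 P f p) ω ≤ L * b ω := by
  have h1 : ∀ᵐ ω ∂P, ∀ i, nrm 𝕜 P (rsmul 𝕜 P ((p.2.1 (i + 1) : ℝ) - p.2.1 i) (f (p.2.2 i))) ω
      = |(p.2.1 (i + 1) : ℝ) - p.2.1 i| * nrm 𝕜 P (f (p.2.2 i)) ω :=
    ae_all_iff.2 fun i => ae_nrm_rsmul _ _
  filter_upwards [ae_nrm_sum_le (𝕜 := 𝕜) (P := P) (Finset.range p.1) fun i =>
    rsmul 𝕜 P ((p.2.1 (i + 1) : ℝ) - p.2.1 i) (f (p.2.2 i)), h1,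
    ae_all_iff.2 fun i => hf (p.2.2 i)] with ω h2 h3 h4
  refine h2.trans ?_
  rw [← sum_eq_of_mem_meshSet hp, Finset.sum_mul]
  refine Finset.sum_le_sum fun i hi => ?_
  have hle : (p.2.1 i : ℝ) ≤ p.2.1 (i + 1) := step_le_of_mem_meshSet hp (Finset.mem_range.1 hi)
  rw [h3, abs_of_nonneg (sub_nonneg.2 hle)]
  exact mul_le_mul_of_nonneg_left (h4 i) (sub_nonneg.2 hle)

variable [IsProbabilityMeasure P] {f g : ℝ≥0 → S} {L : ℝ≥0} {I J : S}

theorem hasRiemannIntegral_iff :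
    HasRiemannIntegral 𝕜 P f L I ↔ TendstoEL 𝕜 P (rSum 𝕜 P f) (riemannFilter L) I := by
  rw [TendstoEL, (hasBasis_riemannFilter L).tendsto_left_iff]
  refine forall₂_congr fun U _ => exists_congr fun δ => and_congr_right fun _ => ?_
  constructor
  · exact fun h p hp => h p.1 p.2.1 p.2.2 hp.1 hp.2.1 hp.2.2
  · exact fun h n t τ h0 h1 h2 => h (x := (n, t, τ)) ⟨h0, h1, h2⟩

theorem HasRiemannIntegral.unique (hI : HasRiemannIntegral 𝕜 P f L I)
    (hJ : HasRiemannIntegral 𝕜 P f L J) : I = J :=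
  (hasRiemannIntegral_iff.1 hI).unique (hasRiemannIntegral_iff.1 hJ)

theorem HasRiemannIntegral.sub (hf : HasRiemannIntegral 𝕜 P f L I)
    (hg : HasRiemannIntegral 𝕜 P g L J) :
    HasRiemannIntegral 𝕜 P (fun s => f s - g s) L (I - J) := by
  rw [hasRiemannIntegral_iff] at hf hg ⊢
  refine (hf.sub hg).congr' (Eventually.of_forall fun p => ?_)
  simp only [rSum, rsmul_eq, smul_sub, Finset.sum_sub_distrib]

theorem HasRiemannIntegral.map (hf : HasRiemannIntegral 𝕜 P f L I) (T : BOp 𝕜 P S) :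
    HasRiemannIntegral 𝕜 P (fun s => T (f s)) L (T I) := by
  rw [hasRiemannIntegral_iff] at hf ⊢
  refine (hf.map T).congr' (Eventually.of_forall fun p => ?_)
  simp only [rSum, rsmul_eq, map_sum, map_smul]

theorem HasRiemannIntegral.ae_nrm_le {b : L0 ℝ P} (h : HasRiemannIntegral 𝕜 P f L I)
    (hf : ∀ s, ∀ᵐ ω ∂P, nrm 𝕜 P (f s) ω ≤ b ω) : ∀ᵐ ω ∂P, nrm 𝕜 P I ω ≤ L * b ω := by
  rw [hasRiemannIntegral_iff, tendstoEL_iff] at h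
  have h2 := (h.of_le (v := fun _ ω => nrm 𝕜 P I ω - L * b ω) ?_).le_zero_of_const
  · filter_upwards [h2] with ω hω
    linarith
  · filter_upwards [(hasBasis_riemannFilter L).mem_of_mem one_pos] with p hp
    have := ae_nrm_sub_le (𝕜 := 𝕜) (P := P) (rSum 𝕜 P f p) (rSum 𝕜 P f p - I)
    rw [sub_sub_cancel] at this
    filter_upwards [this, ae_nrm_rSum_le hf hp] with ω h3 h4
    linarith

theorem HasImproperIntegral.unique (hI : HasImproperIntegral 𝕜 P f I)
    (hJ : HasImproperIntegral 𝕜 P f J) : I = J := by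
  obtain ⟨F, hF, hF'⟩ := hI
  obtain ⟨G, hG, hG'⟩ := hJ
  obtain rfl : F = G := funext fun L => (hF L).unique (hG L)
  exact hF'.unique hG'

theorem HasImproperIntegral.map (hf : HasImproperIntegral 𝕜 P f I) (T : BOp 𝕜 P S) :
    HasImproperIntegral 𝕜 P (fun s => T (f s)) (T I) := by
  obtain ⟨F, hF, hF'⟩ := hf
  exact ⟨fun L => T (F L), fun L => (hF L).map T, hF'.map T⟩

theorem hasRiemannIntegral_val (hS : IsEpsLamComplete 𝕜 P S) {b : L0 ℝ P}
    {K : ℝ → WSpace 𝕜 S b} (hK : Continuous K) (L : ℝ≥0) :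
    HasRiemannIntegral 𝕜 P (fun s => (K s).val) L (∫ s in (0 : ℝ)..L, K s).val := by
  have := WSpace.completeSpace (b := b) hS
  rw [hasRiemannIntegral_iff]
  refine (WSpace.tendstoEL_val (tendsto_riemannSum hK L)).congr'
    (Eventually.of_forall fun p => ?_)
  simp only [rSum, map_sum, WSpace.val_smul]

theorem hasImproperIntegral_val (hS : IsEpsLamComplete 𝕜 P S) {b : L0 ℝ P}
    {K : ℝ → WSpace 𝕜 S b} (hK : Continuous K) {I : WSpace 𝕜 S b}
    (h : Tendsto (fun T => ∫ s in (0 : ℝ)..T, K s) atTop (𝓝 I)) :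
    HasImproperIntegral 𝕜 P (fun s => (K s).val) I.val :=
  ⟨_, hasRiemannIntegral_val hS hK,
    WSpace.tendstoEL_val (h.comp (NNReal.tendsto_coe_atTop.2 tendsto_id))⟩

variable (𝕜) in
/-- `f` is continuous in the `(ε, λ)`-topology and almost surely bounded by `b`. -/
structure IsDominated (f : ℝ≥0 → S) (b : L0 ℝ P) : Prop where
  continuous : ∀ s, TendstoEL 𝕜 P f (𝓝 s) (f s)
  ae_le : ∀ s, ∀ᵐ ω ∂P, nrm 𝕜 P (f s) ω ≤ b ω

namespace IsDominated

variable {b : L0 ℝ P}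

theorem mono {c : L0 ℝ P} (h : IsDominated 𝕜 f b) (hbc : ∀ᵐ ω ∂P, b ω ≤ c ω) : IsDominated 𝕜 f c :=
  ⟨h.continuous, fun s => by
    filter_upwards [h.ae_le s, hbc] with ω h1 h2
    exact h1.trans h2⟩

theorem shift (h : IsDominated 𝕜 f b) (r : ℝ≥0) : IsDominated 𝕜 (fun s => f (r + s)) b := by
  refine ⟨fun s => ?_, fun s => h.ae_le _⟩
  exact Tendsto.comp (h.continuous (r + s)) (continuous_const_add r).continuousAt

/-- A dominated function as a function on the line with values in a weighted space. -/
noncomputable def lift (h : IsDominated 𝕜 f b) (s : ℝ) : WSpace 𝕜 S b :=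
  WSpace.mk (f s.toNNReal) (h.ae_le _)

theorem val_lift (h : IsDominated 𝕜 f b) (s : ℝ≥0) : (h.lift s).val = f s := by
  rw [lift, WSpace.val_mk, Real.toNNReal_coe]

theorem continuous_lift (h : IsDominated 𝕜 f b) : Continuous h.lift := by
  have : Continuous fun s : ℝ≥0 => WSpace.mk (f s) (h.ae_le s) :=
    continuous_iff_continuousAt.2 fun s => WSpace.tendsto_mk _ _ (h.continuous s)
  exact this.comp continuous_real_toNNReal

theorem norm_lift_le (h : IsDominated 𝕜 f b) (s : ℝ) : ‖h.lift s‖ ≤ 1 := WSpace.norm_mk_le _ _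

variable (hS : IsEpsLamComplete 𝕜 P S)
include hS

theorem hasRiemannIntegral (h : IsDominated 𝕜 f b) (L : ℝ≥0) :
    HasRiemannIntegral 𝕜 P f L (∫ s in (0 : ℝ)..L, h.lift s).val := by
  simpa only [h.val_lift] using hasRiemannIntegral_val hS h.continuous_lift L

theorem hasRiemannIntegral_shift (h : IsDominated 𝕜 f b) {t r : ℝ≥0}
    (hI : HasRiemannIntegral 𝕜 P f r I) (hJ : HasRiemannIntegral 𝕜 P f (r + t) J) :
    HasRiemannIntegral 𝕜 P (fun s => f (r + s)) t (J - I) := by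
  have hc := h.continuous_lift
  have h1 := hasRiemannIntegral_val hS (K := fun s => h.lift (r + s))
    (hc.comp (continuous_const_add _)) t
  rw [hI.unique (h.hasRiemannIntegral hS r), hJ.unique (h.hasRiemannIntegral hS (r + t)),
    ← map_sub, intervalIntegral.integral_interval_sub_left (hc.intervalIntegrable _ _)
      (hc.intervalIntegrable _ _), NNReal.coe_add]
  rw [intervalIntegral.integral_comp_add_left h.lift, add_zero] at h1
  have h2 : ∀ s : ℝ≥0, (h.lift (r + s)).val = f (r + s) := fun s => by
    rw [← NNReal.coe_add, h.val_lift]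
  simpa only [h2] using h1

/-- The fundamental theorem of calculus at $0$ in the weighted space. -/
theorem tendsto_average (h : IsDominated 𝕜 f b) {F : ℝ≥0 → S}
    (hF : ∀ L, HasRiemannIntegral 𝕜 P f L (F L)) :
    TendstoEL 𝕜 P (fun r : ℝ≥0 => rsmul 𝕜 P (r : ℝ)⁻¹ (F r)) (𝓝[>] 0) (f 0) := by
  have := WSpace.completeSpace (b := b) hS
  have hc := h.continuous_lift
  have h1 : HasDerivAt (fun s => ∫ u in (0 : ℝ)..s, h.lift u) (h.lift 0) 0 :=
    intervalIntegral.integral_hasDerivAt_right (hc.intervalIntegrable _ _)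
      (hc.stronglyMeasurableAtFilter _ _) hc.continuousAt
  have h2 := h1.tendsto_slope_zero_right
  have h3 : Tendsto (fun r : ℝ≥0 => (r : ℝ)) (𝓝[>] 0) (𝓝[>] 0) := by
    refine tendsto_nhdsWithin_iff.2 ⟨?_, ?_⟩
    · exact (NNReal.continuous_coe.tendsto' 0 0 rfl).mono_left nhdsWithin_le_nhds
    · filter_upwards [self_mem_nhdsWithin] with r hr
      exact NNReal.coe_pos.2 hr
  have h4 := WSpace.tendstoEL_val (h2.comp h3)
  have h5 : (h.lift 0).val = f 0 := h.val_lift 0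
  rw [h5] at h4
  refine h4.congr' (Eventually.of_forall fun r => ?_)
  simp only [Function.comp, zero_add, intervalIntegral.integral_same, sub_zero, WSpace.val_smul]
  rw [(hF r).unique (h.hasRiemannIntegral hS r)]

theorem hasLaplace (h : IsDominated 𝕜 f b) {r : ℝ} (hr : 0 < r) :
    HasImproperIntegral 𝕜 P (fun s => rsmul 𝕜 P (Real.exp (-r * s)) (f s))
      (∫ s in Set.Ioi 0, Real.exp (-r * s) • h.lift s).val := by
  have hc := h.continuous_lift
  have h1 := hasImproperIntegral_val hS (K := fun s => Real.exp (-r * s) • h.lift s)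
    (by fun_prop) (intervalIntegral_tendsto_integral_Ioi 0
      (integrableOn_exp_smul hc h.norm_lift_le hr) tendsto_id)
  simpa only [WSpace.val_smul, h.val_lift] using h1

/-- The common bound $b$ places $f$ and $g$ in one Banach space, where uniqueness of Laplace
transforms applies to their difference. -/
theorem eq_of_laplace_eq (hf : IsDominated 𝕜 f b) (hg : IsDominated 𝕜 g b)
    (h : ∀ n : ℕ, ∃ I, HasImproperIntegral 𝕜 P
        (fun s => rsmul 𝕜 P (Real.exp (-(n + 1 : ℝ) * s)) (f s)) I ∧
      HasImproperIntegral 𝕜 P (fun s => rsmul 𝕜 P (Real.exp (-(n + 1 : ℝ) * s)) (g s)) I)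
    (s : ℝ≥0) : f s = g s := by
  have := WSpace.completeSpace (b := b) hS
  have hcf := hf.continuous_lift
  have hcg := hg.continuous_lift
  have h0 : hf.lift s - hg.lift s = 0 := by
    refine eq_zero_of_laplace_eq_zero (K := fun s => hf.lift s - hg.lift s) (N := 2)
      (hcf.sub hcg) (fun s => ?_) (fun n => ?_) s.2
    · have := norm_sub_le (hf.lift s) (hg.lift s)
      linarith [hf.norm_lift_le s, hg.norm_lift_le s]
    · have hn : (0 : ℝ) < n + 1 := by positivity
      obtain ⟨I, h1, h2⟩ := h n
      have h3 := (hf.hasLaplace hS hn).unique h1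
      have h4 := (hg.hasLaplace hS hn).unique h2
      simp only [smul_sub]
      rw [integral_sub (integrableOn_exp_smul hcf hf.norm_lift_le hn)
        (integrableOn_exp_smul hcg hg.norm_lift_le hn), sub_eq_zero]
      exact WSpace.val_injective (h3.trans h4.symm)
  rw [← hf.val_lift, ← hg.val_lift, ← sub_eq_zero, ← map_sub, h0, map_zero]

/-- If the Laplace transforms of `f` and `g` are related by the resolvent equation at `r`, then
`g s` is the Laplace transform at `r` of the translate `f (s + ·)`. -/
theorem hasLaplace_shift (hf : IsDominated 𝕜 f b) (hg : IsDominated 𝕜 g b) {F G : ℝ → S}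
    (hF : ∀ q : ℝ, 0 < q →
      HasImproperIntegral 𝕜 P (fun s => rsmul 𝕜 P (Real.exp (-q * s)) (f s)) (F q))
    (hG : ∀ q : ℝ, 0 < q →
      HasImproperIntegral 𝕜 P (fun s => rsmul 𝕜 P (Real.exp (-q * s)) (g s)) (G q))
    {r : ℝ} (hr : 0 < r)
    (hres : ∀ q : ℝ, 0 < q → rsmul 𝕜 P (r - q) (G q) = F q - F r) (s : ℝ≥0) :
    HasImproperIntegral 𝕜 P (fun t => rsmul 𝕜 P (Real.exp (-r * t)) (f (s + t))) (g s) := by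
  have := WSpace.completeSpace (b := b) hS
  have hcf := hf.continuous_lift
  have hcg := hg.continuous_lift
  have hcl := continuous_laplaceShift hcf r
  have hbl := norm_laplaceShift_le hcf hf.norm_lift_le hr
  have hFv : ∀ q : ℝ, 0 < q → (∫ s in Set.Ioi 0, Real.exp (-q * s) • hf.lift s).val = F q :=
    fun q hq => (hf.hasLaplace hS hq).unique (hF q hq)
  have hGv : ∀ q : ℝ, 0 < q → (∫ s in Set.Ioi 0, Real.exp (-q * s) • hg.lift s).val = G q :=
    fun q hq => (hg.hasLaplace hS hq).unique (hG q hq)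
  -- After multiplication by $r-q$ both sides have the value $F(q)-F(r)$ in $S$; this is why $q=r$
  -- is left out.
  have key : ∀ q : ℝ, 0 < q → q ≠ r →
      ∫ s in Set.Ioi 0, Real.exp (-q * s) • laplaceShift hf.lift r s =
        ∫ s in Set.Ioi 0, Real.exp (-q * s) • hg.lift s := by
    intro q hq hqr
    refine smul_right_injective _ (sub_ne_zero.2 hqr.symm) ?_
    refine WSpace.val_injective ?_
    change WSpace.val ((r - q) • _) = WSpace.val ((r - q) • _)
    rw [laplace_laplaceShift hcf hf.norm_lift_le hr hq, WSpace.val_smul, hGv q hq, hres q hq,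
      map_sub, hFv q hq, hFv r hr]
  have heq : laplaceShift hf.lift r s - hg.lift s = 0 := by
    -- The factor $e^{-r|u|}$ moves the sample points from $n+1$ to $r+n+1$, which never equals $r$.
    -- The absolute value keeps the function bounded on the negative axis as well.
    have h0 := eq_zero_of_laplace_eq_zero
      (K := fun u => Real.exp (-r * |u|) • (laplaceShift hf.lift r u - hg.lift u)) (N := 1 / r + 1)
      (by fun_prop) (fun u => ?_) (fun n => ?_) s.2
    · exact (smul_eq_zero.1 h0).resolve_left (Real.exp_pos _).ne'
    · rw [norm_smul, Real.norm_of_nonneg (Real.exp_nonneg _)]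
      have h1 : Real.exp (-r * |u|) ≤ 1 := Real.exp_le_one_iff.2 (by
        have := mul_nonneg hr.le (abs_nonneg u)
        linarith)
      have h2 := norm_sub_le (laplaceShift hf.lift r u) (hg.lift u)
      have h3 := hbl u
      have h4 := hg.norm_lift_le u
      have h5 := mul_le_mul_of_nonneg_right h1 (norm_nonneg (laplaceShift hf.lift r u - hg.lift u))
      linarith
    · have hn : (0 : ℝ) < r + (n + 1) := by positivity
      have hn' : r + (n + 1 : ℝ) ≠ r := by
        have : (0 : ℝ) < n + 1 := by positivity
        linarith
      have h1 := integral_sub (integrableOn_exp_smul hcl hbl hn)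
        (integrableOn_exp_smul hcg hg.norm_lift_le hn)
      rw [key _ hn hn', sub_self] at h1
      rw [← h1]
      refine setIntegral_congr_fun measurableSet_Ioi fun u hu => ?_
      have hu : (0 : ℝ) < u := hu
      rw [← smul_sub, smul_smul, ← Real.exp_add, abs_of_pos hu]
      congr 2
      ring
  have h1 := hasImproperIntegral_val hS (K := fun t => Real.exp (-r * t) • hf.lift (s + t))
    (by fun_prop) (tendsto_laplaceShift hcf hf.norm_lift_le hr s)
  rw [sub_eq_zero.1 heq, hg.val_lift] at h1
  have h2 : ∀ t : ℝ≥0, (hf.lift (s + t)).val = f (s + t) := fun t => by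
    rw [← NNReal.coe_add, hf.val_lift]
  simpa only [WSpace.val_smul, h2] using h1

end IsDominated

/-- A continuous function with an exponential bound has an improper Riemann integral. -/
theorem exists_hasImproperIntegral (hS : IsEpsLamComplete 𝕜 P S)
    (hc : ∀ s, TendstoEL 𝕜 P f (𝓝 s) (f s)) {a θ : L0 ℝ P} (ha : ∀ᵐ ω ∂P, 0 ≤ a ω)
    (hθ : ∀ᵐ ω ∂P, 0 < θ ω)
    (hf : ∀ s : ℝ≥0, ∀ᵐ ω ∂P, nrm 𝕜 P (f s) ω ≤ a ω * Real.exp (-(θ ω * s))) :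
    ∃ I, HasImproperIntegral 𝕜 P f I := by
  -- The decay rate $\theta$ is random and may be arbitrarily close to $0$, so uniform exponential
  -- decay is not available. Enlarging the dominating variable to $a(1+\theta^{-2})$ makes the
  -- weighted norm at most $2/(1+s^2)$, which is integrable.
  have hm : AEStronglyMeasurable (fun ω => a ω * (1 + (θ ω ^ 2)⁻¹)) P :=
    (a.aemeasurable.mul (aemeasurable_const.add
      (θ.aemeasurable.pow_const 2).inv)).aestronglyMeasurable
  set b : L0 ℝ P := AEEqFun.mk _ hm
  have hb : ∀ᵐ ω ∂P, b ω = a ω * (1 + (θ ω ^ 2)⁻¹) := AEEqFun.coeFn_mk _ hm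
  have h : IsDominated 𝕜 f b := by
    refine ⟨hc, fun s => ?_⟩
    filter_upwards [hf s, hb, ha, hθ] with ω h1 h2 h3 h4
    rw [h2]
    refine h1.trans (mul_le_mul_of_nonneg_left ?_ h3)
    have h5 : Real.exp (-(θ ω * s)) ≤ 1 :=
      Real.exp_le_one_iff.2 (neg_nonpos.2 (mul_nonneg h4.le s.2))
    have : 0 ≤ (θ ω ^ 2)⁻¹ := by positivity
    linarith
  have hbound : ∀ s ∈ Set.Ioi (0 : ℝ), ‖h.lift s‖ ≤ 2 * (1 + s ^ 2)⁻¹ := by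
    intro s hs
    obtain ⟨s, rfl⟩ : ∃ t : ℝ≥0, (t : ℝ) = s := ⟨⟨s, le_of_lt hs⟩, rfl⟩
    refine WSpace.norm_le_of_ae ?_
    rw [h.val_lift]
    filter_upwards [hf s, hb, ha, hθ] with ω h1 h2 h3 h4
    rw [wt, h2, ← div_eq_mul_inv, inv_mul_le_iff₀ (by positivity), abs_of_nonneg (by positivity)]
    refine h1.trans ?_
    -- The quadratic term of the exponential series supplies decay of order $s^{-2}$, with the
    -- random constant $\theta^{-2}$ that the weight absorbs.
    have h5 := Real.quadratic_le_exp_of_nonneg (mul_nonneg h4.le s.coe_nonneg)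
    have h6 : Real.exp (-(θ ω * s)) ≤ (1 + (θ ω * s) ^ 2 / 2)⁻¹ := by
      rw [Real.exp_neg]
      refine inv_anti₀ (by positivity) ?_
      have : 0 ≤ θ ω * s := mul_nonneg h4.le s.coe_nonneg
      linarith
    have h7 : (1 + (θ ω * s) ^ 2 / 2)⁻¹ ≤ (1 + (θ ω ^ 2)⁻¹) * (2 / (1 + (s : ℝ) ^ 2)) := by
      rw [inv_le_iff_one_le_mul₀ (by positivity)]
      have h8 : (1 + (θ ω ^ 2)⁻¹) * (2 / (1 + (s : ℝ) ^ 2)) * (1 + (θ ω * s) ^ 2 / 2) =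
          (1 + (s : ℝ) ^ 2)⁻¹ * ((1 + (s : ℝ) ^ 2) + (1 + 2 * (θ ω ^ 2)⁻¹ + θ ω ^ 2 * s ^ 2)) := by
        field_simp
        ring
      rw [h8, mul_add, inv_mul_cancel₀ (by positivity)]
      have : 0 ≤ (1 + (s : ℝ) ^ 2)⁻¹ * (1 + 2 * (θ ω ^ 2)⁻¹ + θ ω ^ 2 * s ^ 2) := by positivity
      linarith
    calc a ω * Real.exp (-(θ ω * s)) ≤ a ω * ((1 + (θ ω ^ 2)⁻¹) * (2 / (1 + (s : ℝ) ^ 2))) :=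
          mul_le_mul_of_nonneg_left (h6.trans h7) h3
      _ ≤ (1 + a ω * (1 + (θ ω ^ 2)⁻¹)) * (2 / (1 + (s : ℝ) ^ 2)) := by
          have : 0 ≤ 2 / (1 + (s : ℝ) ^ 2) := by positivity
          linarith
  have hc' := h.continuous_lift
  have hint : IntegrableOn h.lift (Set.Ioi 0) := by
    refine (integrable_inv_one_add_sq.const_mul 2).integrableOn.mono'
      hc'.aestronglyMeasurable ?_
    exact (ae_restrict_iff' measurableSet_Ioi).2 (Eventually.of_forall hbound)
  have h1 := hasImproperIntegral_val hS hc'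
    (intervalIntegral_tendsto_integral_Ioi 0 hint tendsto_id)
  simp only [h.val_lift] at h1
  exact ⟨_, h1⟩

end Integral

/-! ### Rescaling a family by $e^{-\eta s}$ with random $\eta$ -/

theorem abs_exp_sub_exp_le {a b c : ℝ} (ha : a ≤ c) (hb : b ≤ c) :
    |Real.exp a - Real.exp b| ≤ |a - b| * Real.exp c := by
  wlog h : b ≤ a generalizing a b
  · rw [abs_sub_comm, abs_sub_comm a b]
    exact this hb ha (le_of_not_ge h)
  rw [abs_of_nonneg (sub_nonneg.2 (Real.exp_le_exp.2 h)), abs_of_nonneg (sub_nonneg.2 h)]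
  have h1 := Real.add_one_le_exp (b - a)
  have h2 : Real.exp b = Real.exp a * Real.exp (b - a) := by
    rw [← Real.exp_add]; congr 1; ring
  have h3 := Real.exp_le_exp.2 ha
  have h4 : Real.exp a * (1 - Real.exp (b - a)) ≤ Real.exp a * (a - b) :=
    mul_le_mul_of_nonneg_left (by linarith) (Real.exp_nonneg _)
  have h5 : Real.exp a * (a - b) ≤ Real.exp c * (a - b) :=
    mul_le_mul_of_nonneg_right h3 (sub_nonneg.2 h)
  rw [h2]
  linarith

theorem abs_exp_sub_one_sub_le (u : ℝ) :
    |Real.exp u - 1 - u| ≤ |u| * (|u| * Real.exp |u|) := by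
  have h0 := Real.add_one_le_exp u
  rw [abs_of_nonneg (by linarith)]
  have h1 := Real.add_one_le_exp (-u)
  have h2 : Real.exp u * Real.exp (-u) = 1 := by rw [← Real.exp_add]; simp
  have h3 := mul_le_mul_of_nonneg_left h1 (Real.exp_nonneg u)
  have h4 : Real.exp u - 1 - u ≤ u * (Real.exp u - 1) := by linarith
  have h5 := abs_exp_sub_exp_le (le_abs_self u) (abs_nonneg u)
  rw [Real.exp_zero, sub_zero] at h5
  calc Real.exp u - 1 - u ≤ u * (Real.exp u - 1) := h4
    _ ≤ |u| * |Real.exp u - 1| := by rw [← abs_mul]; exact le_abs_self _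
    _ ≤ _ := mul_le_mul_of_nonneg_left h5 (abs_nonneg _)

section Scaling

variable {Ω : Type*} [MeasurableSpace Ω] {𝕜 : Type*} [RCLike 𝕜] {P : Measure Ω}

variable (𝕜) in
/-- The scalar `e^{-η s}`. -/
noncomputable def expScalar (η : L0 ℝ P) (s : ℝ≥0) : L0 𝕜 P :=
  L0.ofReal 𝕜 (L0.exp (-((s : ℝ) • η)))

theorem coeFn_expScalar (η : L0 ℝ P) (s : ℝ≥0) :
    ∀ᵐ ω ∂P, expScalar 𝕜 η s ω = ((Real.exp (-(s * η ω)) : ℝ) : 𝕜) := by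
  filter_upwards [L0.coeFn_ofReal (𝕜 := 𝕜) (L0.exp (-((s : ℝ) • η))),
    L0.coeFn_exp (-((s : ℝ) • η)), AEEqFun.coeFn_neg ((s : ℝ) • η),
    AEEqFun.coeFn_smul (s : ℝ) η] with ω h1 h2 h3 h4
  rw [expScalar, h1, h2, h3, Pi.neg_apply, h4, Pi.smul_apply, smul_eq_mul]

theorem expScalar_add (η : L0 ℝ P) (s t : ℝ≥0) :
    expScalar 𝕜 η (s + t) = expScalar 𝕜 η s * expScalar 𝕜 η t := by
  rw [expScalar, expScalar, expScalar, ← L0.ofReal_mul, ← L0.exp_add, NNReal.coe_add, add_smul,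
    neg_add]

theorem expScalar_add_left (η ζ : L0 ℝ P) (s : ℝ≥0) :
    expScalar 𝕜 (η + ζ) s = expScalar 𝕜 η s * expScalar 𝕜 ζ s := by
  rw [expScalar, expScalar, expScalar, ← L0.ofReal_mul, ← L0.exp_add, smul_add, neg_add]

theorem expScalar_zero (η : L0 ℝ P) : expScalar 𝕜 η 0 = 1 := by
  rw [expScalar, NNReal.coe_zero, zero_smul, neg_zero, L0.ofReal_exp_zero]

theorem expScalar_zero_left (s : ℝ≥0) : expScalar 𝕜 (0 : L0 ℝ P) s = 1 := by
  rw [expScalar, smul_zero, neg_zero, L0.ofReal_exp_zero]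

theorem expScalar_const (r : ℝ) (s : ℝ≥0) :
    expScalar 𝕜 (AEEqFun.const Ω r : L0 ℝ P) s = constHom 𝕜 P (Real.exp (-r * s)) := by
  refine AEEqFun.ext ?_
  filter_upwards [coeFn_expScalar (𝕜 := 𝕜) (AEEqFun.const Ω r : L0 ℝ P) s,
    AEEqFun.coeFn_const (μ := P) Ω r, coeFn_constHom (𝕜 := 𝕜) (P := P) (Real.exp (-r * s))]
    with ω h1 h2 h3
  rw [h1, h2, h3, Function.const_apply, neg_mul, mul_comm r]

theorem L0.ofReal_neg (η : L0 ℝ P) : L0.ofReal 𝕜 (-η) = -L0.ofReal 𝕜 η := by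
  rw [eq_neg_iff_add_eq_zero, ← L0.ofReal_add, neg_add_cancel]
  exact map_zero (constHom 𝕜 P)

variable {S : Type*} [AddCommGroup S] [Module (L0 𝕜 P) S] [RNModule 𝕜 P S]
  [IsProbabilityMeasure P]

/-- Near $s_0$ the scalars are bounded by the fixed random variable $e^{(s_0+1)|\eta|}$ and
Lipschitz in $s$ with a random constant, so both terms of the usual product splitting tend to $0$ in
probability. -/
theorem TendstoEL.expScalar_smul (η : L0 ℝ P) {f : ℝ≥0 → S} {s₀ : ℝ≥0} {l : Filter ℝ≥0}
    (hl : l ≤ 𝓝 s₀) {z : S} (hf : TendstoEL 𝕜 P f l z) :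
    TendstoEL 𝕜 P (fun s => expScalar 𝕜 η s • f s) l (expScalar 𝕜 η s₀ • z) := by
  have hs : Tendsto (fun s : ℝ≥0 => |(s : ℝ) - s₀|) l (𝓝 0) := by
    have : Tendsto (fun s : ℝ≥0 => |(s : ℝ) - s₀|) (𝓝 s₀) (𝓝 |(s₀ : ℝ) - s₀|) :=
      (by fun_prop : Continuous fun s : ℝ≥0 => |(s : ℝ) - s₀|).tendsto s₀
    rw [sub_self, abs_zero] at this
    exact this.mono_left hl
  have hlt : ∀ᶠ s : ℝ≥0 in l, (s : ℝ) ≤ s₀ + 1 := by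
    filter_upwards [hs.eventually (gt_mem_nhds one_pos)] with s h
    linarith [le_abs_self ((s : ℝ) - s₀)]
  have hmeas : AEMeasurable (fun ω => Real.exp ((s₀ + 1) * |η ω|)) P :=
    Real.measurable_exp.comp_aemeasurable (η.aemeasurable.abs.const_mul _)
  have hb : ∀ (s : ℝ≥0) ω, (s : ℝ) ≤ s₀ + 1 → -(s * η ω) ≤ (s₀ + 1) * |η ω| := by
    intro s ω h
    calc -(s * η ω) ≤ |(s : ℝ) * η ω| := neg_le_abs _
      _ = s * |η ω| := by rw [abs_mul, abs_of_nonneg s.coe_nonneg]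
      _ ≤ _ := mul_le_mul_of_nonneg_right h (abs_nonneg _)
  rw [tendstoEL_iff] at hf ⊢
  have h1 : Small P (fun (s : ℝ≥0) ω => Real.exp (-(s * η ω)) * nrm 𝕜 P (f s - z) ω) l := by
    refine hf.of_le_mul hmeas ?_
    filter_upwards [hlt] with s h
    filter_upwards [ae_nrm_nonneg (𝕜 := 𝕜) (P := P) (f s - z)] with ω hω
    rw [Real.abs_exp]
    exact mul_le_mul_of_nonneg_right (Real.exp_le_exp.2 (hb s ω h)) hω
  have h2 : Small P (fun (s : ℝ≥0) ω => |Real.exp (-(s * η ω)) - Real.exp (-(s₀ * η ω))| *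
      nrm 𝕜 P z ω) l := by
    refine (small_const hs).of_le_mul
      ((η.aemeasurable.abs.mul hmeas).mul (nrm 𝕜 P z).aemeasurable) ?_
    filter_upwards [hlt] with s h
    filter_upwards [ae_nrm_nonneg (𝕜 := 𝕜) (P := P) z] with ω hω
    have h3 := abs_exp_sub_exp_le (hb s ω h) (hb s₀ ω (by linarith))
    have h4 : |-(s * η ω) - -(s₀ * η ω)| = |(s : ℝ) - s₀| * |η ω| := by
      rw [← abs_mul, ← abs_neg]
      congr 1
      ring
    rw [h4] at h3
    change _ ≤ |(|η ω| * Real.exp ((s₀ + 1) * |η ω|)) * nrm 𝕜 P z ω| * |(s : ℝ) - s₀|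
    rw [abs_of_nonneg (by positivity : 0 ≤ |η ω| * Real.exp ((s₀ + 1) * |η ω|) * nrm 𝕜 P z ω)]
    refine (mul_le_mul_of_nonneg_right h3 hω).trans (le_of_eq ?_)
    ring
  refine (h1.add h2).of_le (Eventually.of_forall fun s => ?_)
  have h3 : expScalar 𝕜 η s • f s - expScalar 𝕜 η s₀ • z =
      expScalar 𝕜 η s • (f s - z) + (expScalar 𝕜 η s - expScalar 𝕜 η s₀) • z := by
    rw [smul_sub, sub_smul]
    abel
  rw [h3]
  filter_upwards [ae_nrm_add_le (𝕜 := 𝕜) (P := P) (expScalar 𝕜 η s • (f s - z))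
    ((expScalar 𝕜 η s - expScalar 𝕜 η s₀) • z), ae_nrm_smul (expScalar 𝕜 η s) (f s - z),
    ae_nrm_smul (expScalar 𝕜 η s - expScalar 𝕜 η s₀) z, coeFn_expScalar (𝕜 := 𝕜) η s,
    coeFn_expScalar (𝕜 := 𝕜) η s₀, AEEqFun.coeFn_sub (expScalar 𝕜 η s) (expScalar 𝕜 η s₀)]
    with ω g1 g2 g3 g4 g5 g6
  rw [g2, g3, g6, Pi.sub_apply, g4, g5, ← RCLike.ofReal_sub, RCLike.norm_ofReal,
    RCLike.norm_ofReal, Real.abs_exp] at g1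
  exact g1

/-- The second order remainder of the exponential bounds the error by $s\,|\eta|^2e^{|\eta|}\|x\|$
for $s<1$, a null sequence times a fixed random variable. -/
theorem tendstoEL_expScalar_slope (η : L0 ℝ P) (x : S) :
    TendstoEL 𝕜 P (fun s : ℝ≥0 => rsmul 𝕜 P (s : ℝ)⁻¹ (expScalar 𝕜 η s • x - x)) (𝓝[>] 0)
      (-(L0.ofReal 𝕜 η • x)) := by
  rw [tendstoEL_iff]
  have hs : Tendsto (fun s : ℝ≥0 => (s : ℝ)) (𝓝[>] 0) (𝓝 0) :=
    (NNReal.continuous_coe.tendsto' 0 0 rfl).mono_left nhdsWithin_le_nhds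
  have hmeas : AEMeasurable (fun ω => |η ω| * (|η ω| * Real.exp |η ω|) * nrm 𝕜 P x ω) P :=
    (η.aemeasurable.abs.mul (η.aemeasurable.abs.mul
      (Real.measurable_exp.comp_aemeasurable η.aemeasurable.abs))).mul (nrm 𝕜 P x).aemeasurable
  refine (small_const hs).of_le_mul hmeas ?_
  filter_upwards [hs.eventually (gt_mem_nhds one_pos), self_mem_nhdsWithin] with s hs1 hs0
  have hs0 : (0 : ℝ) < s := NNReal.coe_pos.2 hs0
  have h1 : rsmul 𝕜 P (s : ℝ)⁻¹ (expScalar 𝕜 η s • x - x) - -(L0.ofReal 𝕜 η • x) =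
      (constHom 𝕜 P (s : ℝ)⁻¹ * (expScalar 𝕜 η s - 1) + L0.ofReal 𝕜 η) • x := by
    rw [rsmul_eq, add_smul, mul_smul, sub_smul, one_smul, sub_neg_eq_add]
  rw [h1]
  filter_upwards [ae_nrm_smul (constHom 𝕜 P (s : ℝ)⁻¹ * (expScalar 𝕜 η s - 1) + L0.ofReal 𝕜 η) x,
    AEEqFun.coeFn_add (constHom 𝕜 P (s : ℝ)⁻¹ * (expScalar 𝕜 η s - 1)) (L0.ofReal 𝕜 η),
    AEEqFun.coeFn_mul (constHom 𝕜 P (s : ℝ)⁻¹) (expScalar 𝕜 η s - 1),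
    AEEqFun.coeFn_sub (expScalar 𝕜 η s) 1, coeFn_expScalar (𝕜 := 𝕜) η s,
    coeFn_constHom (𝕜 := 𝕜) (P := P) (s : ℝ)⁻¹, L0.coeFn_ofReal (𝕜 := 𝕜) η,
    AEEqFun.coeFn_one (μ := P) (β := 𝕜), ae_nrm_nonneg (𝕜 := 𝕜) (P := P) x]
    with ω g1 g2 g3 g4 g5 g6 g7 g8 g9
  rw [g1, g2, Pi.add_apply, g3, Pi.mul_apply, g4, Pi.sub_apply, g5, g6, g7, g8, Pi.one_apply]
  have h2 : (((s : ℝ)⁻¹ : ℝ) : 𝕜) * (((Real.exp (-(s * η ω)) : ℝ) : 𝕜) - 1) + ((η ω : ℝ) : 𝕜) =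
      (((s : ℝ)⁻¹ * (Real.exp (-(s * η ω)) - 1 - -(s * η ω)) : ℝ) : 𝕜) := by
    have : (s : ℝ)⁻¹ * (Real.exp (-(s * η ω)) - 1 - -(s * η ω)) =
        (s : ℝ)⁻¹ * (Real.exp (-(s * η ω)) - 1) + η ω := by
      field_simp
      ring
    rw [this]
    push_cast
    rfl
  rw [h2, RCLike.norm_ofReal, abs_mul, abs_of_pos (inv_pos.2 hs0)]
  have h3 := abs_exp_sub_one_sub_le (-(s * η ω))
  rw [abs_neg, abs_mul, abs_of_pos hs0] at h3
  have h4 : Real.exp (s * |η ω|) ≤ Real.exp |η ω| :=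
    Real.exp_le_exp.2 (mul_le_of_le_one_left (abs_nonneg _) hs1.le)
  rw [abs_of_nonneg (by positivity : 0 ≤ |η ω| * (|η ω| * Real.exp |η ω|) * nrm 𝕜 P x ω)]
  have h5 : (s : ℝ)⁻¹ * |Real.exp (-(s * η ω)) - 1 - -(s * η ω)| ≤
      |η ω| * (|η ω| * Real.exp |η ω|) * s := by
    rw [inv_mul_le_iff₀ hs0]
    refine h3.trans ?_
    have : s * |η ω| * (s * |η ω| * Real.exp (s * |η ω|)) ≤
      s * |η ω| * (s * |η ω| * Real.exp |η ω|) := by gcongr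
    refine this.trans (le_of_eq ?_)
    ring
  calc _ ≤ |η ω| * (|η ω| * Real.exp |η ω|) * s * nrm 𝕜 P x ω :=
        mul_le_mul_of_nonneg_right h5 g9
    _ = _ := by ring

variable {C : BOp 𝕜 P S} {W : ℝ≥0 → BOp 𝕜 P S}

/-- The family `e^{-η s} W(s)`. -/
noncomputable def escale (η : L0 ℝ P) (W : ℝ≥0 → BOp 𝕜 P S) (s : ℝ≥0) : BOp 𝕜 P S :=
  (W s).smul (expScalar 𝕜 η s)

omit [IsProbabilityMeasure P] in
theorem escale_apply (η : L0 ℝ P) (W : ℝ≥0 → BOp 𝕜 P S) (s : ℝ≥0) (x : S) :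
    escale η W s x = expScalar 𝕜 η s • W s x := rfl

omit [IsProbabilityMeasure P] in
theorem BOp.ext {T U : BOp 𝕜 P S} (h : ∀ x, T x = U x) : T = U :=
  Subtype.ext (LinearMap.ext h)

omit [IsProbabilityMeasure P] in
theorem escale_neg_escale (η : L0 ℝ P) (W : ℝ≥0 → BOp 𝕜 P S) : escale (-η) (escale η W) = W := by
  funext s
  refine BOp.ext fun x => ?_
  rw [escale_apply, escale_apply, smul_smul, ← expScalar_add_left, neg_add_cancel,
    expScalar_zero_left, one_smul]

theorem StronglyContinuous.tendstoEL (hW : StronglyContinuous W) (x : S) (s : ℝ≥0) :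
    TendstoEL 𝕜 P (fun s => W s x) (𝓝 s) (W s x) :=
  @Continuous.tendsto ℝ≥0 S _ (epsLam 𝕜 P S) _ (hW x) s

theorem StronglyContinuous.escale (hW : StronglyContinuous W) (η : L0 ℝ P) :
    StronglyContinuous (escale η W) := by
  intro x
  let := epsLam 𝕜 P S
  rw [continuous_iff_continuousAt]
  exact fun s => (hW.tendstoEL x s).expScalar_smul η le_rfl

theorem IsCSemigroup.escale (hW : IsCSemigroup C W) (η : L0 ℝ P) :
    IsCSemigroup C (escale η W) where
  injective := hW.injective
  mul s t x := by
    have h : ∀ (T : BOp 𝕜 P S) (ζ : L0 𝕜 P) (y : S), T (ζ • y) = ζ • T y := fun T ζ y =>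
      map_smul T.1 ζ y
    rw [escale_apply, escale_apply, escale_apply, h, h, hW.mul, expScalar_add, smul_smul,
      mul_comm]
  zero := by
    refine BOp.ext fun x => ?_
    rw [escale_apply, expScalar_zero, one_smul, hW.zero]
  continuous := hW.continuous.escale η

/-- `x` lies in the domain of the generator of `W`, with value `y`. -/
def GenRel (C : BOp 𝕜 P S) (W : ℝ≥0 → BOp 𝕜 P S) (x y : S) : Prop :=
  TendstoEL 𝕜 P (diffQuot C W x) (𝓝[>] 0) (C y)

/-- The product rule at $s=0$ for $e^{-\eta s}W(s)x$: the generator is shifted by $-\eta$. -/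
theorem GenRel.escale {x y : S} (h : GenRel C W x y) (η : L0 ℝ P) :
    GenRel C (escale η W) x (y - L0.ofReal 𝕜 η • x) := by
  have h1 := (TendstoEL.expScalar_smul η nhdsWithin_le_nhds h).add
    (tendstoEL_expScalar_slope η (C x))
  rw [expScalar_zero, one_smul] at h1
  have h2 : C y + -(L0.ofReal 𝕜 η • C x) = C (y - L0.ofReal 𝕜 η • x) := by
    rw [map_sub, map_smul, sub_eq_add_neg]
  rw [h2] at h1
  refine h1.congr' (Eventually.of_forall fun s => ?_)
  simp only [diffQuot, escale_apply, rsmul_eq]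
  rw [smul_sub, smul_sub, smul_sub, smul_sub, smul_comm (expScalar 𝕜 η s),
    smul_comm (expScalar 𝕜 η s)]
  abel

theorem genRel_escale_iff {x y : S} (η : L0 ℝ P) :
    GenRel C (escale η W) x (y - L0.ofReal 𝕜 η • x) ↔ GenRel C W x y := by
  refine ⟨fun h => ?_, fun h => h.escale η⟩
  have := h.escale (-η)
  rwa [escale_neg_escale, L0.ofReal_neg, neg_smul, sub_neg_eq_add, sub_add_cancel] at this

theorem GenRel.sub {x y x' y' : S} (h : GenRel C W x y) (h' : GenRel C W x' y') :
    GenRel C W (x - x') (y - y') := by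
  have h1 := TendstoEL.sub h h'
  have h2 : ∀ (T : BOp 𝕜 P S) (u v : S), T (u - v) = T u - T v := fun T u v => map_sub T.1 u v
  rw [GenRel, h2]
  refine h1.congr' (Eventually.of_forall fun s => ?_)
  simp only [diffQuot, rsmul_eq, h2, smul_sub]
  abel

end Scaling

/-! ### Bounded $C$-semigroups and their generators -/

section Semigroup

variable {Ω : Type*} [MeasurableSpace Ω] {𝕜 : Type*} [RCLike 𝕜] {P : Measure Ω}
  {S : Type*} [AddCommGroup S] [Module (L0 𝕜 P) S] [RNModule 𝕜 P S] [IsProbabilityMeasure P]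

omit [IsProbabilityMeasure P] in
theorem BOp.apply_sub (T : BOp 𝕜 P S) (x y : S) : T (x - y) = T x - T y := map_sub T.1 x y

omit [IsProbabilityMeasure P] in
theorem BOp.apply_smul (T : BOp 𝕜 P S) (ζ : L0 𝕜 P) (x : S) : T (ζ • x) = ζ • T x :=
  map_smul T.1 ζ x

omit [IsProbabilityMeasure P] in
theorem BOp.apply_zero (T : BOp 𝕜 P S) : T 0 = 0 := map_zero T.1

omit [IsProbabilityMeasure P] in
theorem BOp.apply_rsmul (T : BOp 𝕜 P S) (r : ℝ) (x : S) : T (rsmul 𝕜 P r x) = rsmul 𝕜 P r (T x) :=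
  map_smul T.1 _ x

/-- `V` is strongly continuous and `‖V(s)‖` is bounded by `|K|` for all `s`. -/
structure IsBoundedFamily (V : ℝ≥0 → BOp 𝕜 P S) (K : L0 ℝ P) : Prop where
  continuous : StronglyContinuous V
  ae_le : ∀ s x, ∀ᵐ ω ∂P, nrm 𝕜 P (V s x) ω ≤ |K ω| * nrm 𝕜 P x ω

/-- The integral `∫₀^t f(s) ds`, and `0` if `f` is not integrable. -/
noncomputable def rint (𝕜 : Type*) [RCLike 𝕜] (P : Measure Ω) [IsProbabilityMeasure P] {S : Type*}
    [AddCommGroup S] [Module (L0 𝕜 P) S] [RNModule 𝕜 P S] (f : ℝ≥0 → S) (t : ℝ≥0) : S :=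
  open Classical in
  if h : ∃ I, HasRiemannIntegral 𝕜 P f t I then h.choose else 0

theorem HasRiemannIntegral.hasRiemannIntegral_rint {f : ℝ≥0 → S} {t : ℝ≥0} {I : S}
    (h : HasRiemannIntegral 𝕜 P f t I) : HasRiemannIntegral 𝕜 P f t (rint 𝕜 P f t) := by
  have h' : ∃ I, HasRiemannIntegral 𝕜 P f t I := ⟨I, h⟩
  rw [rint, dif_pos h']
  exact h'.choose_spec

theorem HasRiemannIntegral.rint_eq {f : ℝ≥0 → S} {t : ℝ≥0} {I : S}
    (h : HasRiemannIntegral 𝕜 P f t I) : rint 𝕜 P f t = I :=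
  h.hasRiemannIntegral_rint.unique h

theorem HasRiemannIntegral.smul {f : ℝ≥0 → S} {t : ℝ≥0} {I : S}
    (h : HasRiemannIntegral 𝕜 P f t I) (ζ : L0 𝕜 P) :
    HasRiemannIntegral 𝕜 P (fun s => ζ • f s) t (ζ • I) := by
  rw [hasRiemannIntegral_iff] at h ⊢
  refine (h.smul ζ).congr' (Eventually.of_forall fun p => ?_)
  simp only [rSum, rsmul_eq, Finset.smul_sum, smul_comm ζ]

variable {C : BOp 𝕜 P S} {V : ℝ≥0 → BOp 𝕜 P S} {K : L0 ℝ P}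

namespace IsBoundedFamily

theorem isDominated (h : IsBoundedFamily V K) (x : S) :
    ∃ b : L0 ℝ P, IsDominated 𝕜 (fun s => V s x) b := by
  refine ⟨K.absVal * nrm 𝕜 P x, h.continuous.tendstoEL x, fun s => ?_⟩
  filter_upwards [h.ae_le s x, AEEqFun.coeFn_mul K.absVal (nrm 𝕜 P x), L0.coeFn_absVal K]
    with ω h1 h2 h3
  rwa [h2, Pi.mul_apply, h3, Real.norm_eq_abs]

variable (hS : IsEpsLamComplete 𝕜 P S)
include hS

theorem hasRiemannIntegral (h : IsBoundedFamily V K) (x : S) (t : ℝ≥0) :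
    HasRiemannIntegral 𝕜 P (fun s => V s x) t (rint 𝕜 P (fun s => V s x) t) := by
  obtain ⟨b, hb⟩ := h.isDominated x
  exact (hb.hasRiemannIntegral hS t).hasRiemannIntegral_rint

theorem rint_sub (h : IsBoundedFamily V K) (x y : S) (t : ℝ≥0) :
    rint 𝕜 P (fun s => V s (x - y)) t =
      rint 𝕜 P (fun s => V s x) t - rint 𝕜 P (fun s => V s y) t := by
  simp only [BOp.apply_sub]
  exact ((h.hasRiemannIntegral hS x t).sub (h.hasRiemannIntegral hS y t)).rint_eq

theorem rint_zero (h : IsBoundedFamily V K) (t : ℝ≥0) : rint 𝕜 P (fun s => V s 0) t = 0 := by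
  have := h.rint_sub hS 0 0 t
  rwa [sub_self, sub_self] at this

theorem rint_rsmul (h : IsBoundedFamily V K) (r : ℝ) (x : S) (t : ℝ≥0) :
    rint 𝕜 P (fun s => V s (rsmul 𝕜 P r x)) t = rsmul 𝕜 P r (rint 𝕜 P (fun s => V s x) t) := by
  simp only [BOp.apply_rsmul]
  exact ((h.hasRiemannIntegral hS x t).smul (constHom 𝕜 P r)).rint_eq

theorem map_rint (h : IsBoundedFamily V K) {T : BOp 𝕜 P S} (hT : ∀ s x, T (V s x) = V s (T x))
    (x : S) (t : ℝ≥0) :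
    T (rint 𝕜 P (fun s => V s x) t) = rint 𝕜 P (fun s => V s (T x)) t := by
  have := (h.hasRiemannIntegral hS x t).map T
  simp only [hT] at this
  exact this.rint_eq.symm

/-- For fixed $t$ the map $x\mapsto\int_0^tV(s)x\,ds$ is additive and bounded by $t|K|$, so limits
in $x$ pass through the integral. -/
theorem tendstoEL_rint (h : IsBoundedFamily V K) (t : ℝ≥0) {α : Type*} {l : Filter α} {f : α → S}
    {x : S} (hf : TendstoEL 𝕜 P f l x) :
    TendstoEL 𝕜 P (fun a => rint 𝕜 P (fun s => V s (f a)) t) l (rint 𝕜 P (fun s => V s x) t) := by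
  refine hf.map_of_bound (fun x => rint 𝕜 P (fun s => V s x) t) (fun y z => h.rint_sub hS y z t)
    ((t : ℝ) • K) fun z => ?_
  have hb : ∀ s, ∀ᵐ ω ∂P, nrm 𝕜 P (V s z) ω ≤ (K.absVal * nrm 𝕜 P z) ω := by
    intro s
    filter_upwards [h.ae_le s z, AEEqFun.coeFn_mul K.absVal (nrm 𝕜 P z), L0.coeFn_absVal K]
      with ω h1 h2 h3
    rwa [h2, Pi.mul_apply, h3, Real.norm_eq_abs]
  filter_upwards [(h.hasRiemannIntegral hS z t).ae_nrm_le hb, AEEqFun.coeFn_smul (t : ℝ) K,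
    AEEqFun.coeFn_mul K.absVal (nrm 𝕜 P z), L0.coeFn_absVal K] with ω h1 h2 h3 h4
  rw [h3, Pi.mul_apply, h4, Real.norm_eq_abs] at h1
  rw [h2, Pi.smul_apply, smul_eq_mul, abs_mul, abs_of_nonneg t.coe_nonneg, mul_assoc]
  exact h1

theorem tendsto_average (h : IsBoundedFamily V K) (x : S) :
    TendstoEL 𝕜 P (fun r : ℝ≥0 => rsmul 𝕜 P (r : ℝ)⁻¹ (rint 𝕜 P (fun s => V s x) r)) (𝓝[>] 0)
      (V 0 x) := by
  obtain ⟨b, hb⟩ := h.isDominated x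
  exact hb.tendsto_average hS (h.hasRiemannIntegral hS x)

theorem tendsto_average_shift (h : IsBoundedFamily V K) (x : S) (t : ℝ≥0) :
    TendstoEL 𝕜 P (fun r : ℝ≥0 => rsmul 𝕜 P (r : ℝ)⁻¹ (rint 𝕜 P (fun s => V s x) (t + r) -
      rint 𝕜 P (fun s => V s x) t)) (𝓝[>] 0) (V t x) := by
  obtain ⟨b, hb⟩ := h.isDominated x
  have := (hb.shift t).tendsto_average hS fun r => hb.hasRiemannIntegral_shift hS
    (h.hasRiemannIntegral hS x t) (h.hasRiemannIntegral hS x (t + r))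
  rwa [add_zero] at this

end IsBoundedFamily

theorem IsCSemigroup.comm (hV : IsCSemigroup C V) (s : ℝ≥0) (x : S) : C (V s x) = V s (C x) := by
  have := hV.mul 0 s x
  rwa [zero_add, hV.zero] at this

theorem IsCSemigroup.comm_apply (hV : IsCSemigroup C V) (s t : ℝ≥0) (x : S) :
    V s (V t x) = V t (V s x) := by
  rw [← hV.mul, ← hV.mul, add_comm]

theorem IsCSemigroup.diffQuot_map (hV : IsCSemigroup C V) (x : S) (s : ℝ≥0) :
    diffQuot C V (C x) s = C (diffQuot C V x s) := by
  rw [diffQuot, diffQuot, BOp.apply_rsmul, BOp.apply_sub, hV.comm]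

theorem GenRel.map (hV : IsCSemigroup C V) {x y : S} (h : GenRel C V x y) :
    GenRel C V (C x) (C y) :=
  (TendstoEL.map h C).congr' (Eventually.of_forall fun s => (hV.diffQuot_map x s).symm)

section Bounded

variable (hS : IsEpsLamComplete 𝕜 P S) (hV : IsCSemigroup C V) (hK : IsBoundedFamily V K)
include hS hV hK

/-- From $V(s)V(r)x=CV(r+s)x$, integrating an increment of the orbit amounts to shifting the
interval of integration. -/
theorem rint_orbit_sub (r t : ℝ≥0) (x : S) :
    rint 𝕜 P (fun s => V s (V r x - C x)) t = C (rint 𝕜 P (fun s => V s x) (r + t) -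
      rint 𝕜 P (fun s => V s x) r - rint 𝕜 P (fun s => V s x) t) := by
  obtain ⟨b, hb⟩ := hK.isDominated x
  have h1 := (hb.hasRiemannIntegral_shift hS (hK.hasRiemannIntegral hS x r)
    (hK.hasRiemannIntegral hS x (r + t))).map C
  simp only [hV.mul] at h1
  rw [hK.rint_sub hS, h1.rint_eq, ← hK.map_rint hS hV.comm, BOp.apply_sub C _ (rint _ _ _ t)]

/-- Divide `rint_orbit_sub` by $r$ and let $r\to0$: the left side tends to $\int_0^tV(s)Cy\,ds$, the
right side to $C(V(t)x-Cx)$. Injectivity of $C$ removes the extra $C$. Together with the converse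
below, the generator is described by an integral identity without limits. -/
theorem GenRel.apply_sub {x y : S} (h : GenRel C V x y) (t : ℝ≥0) :
    V t x - C x = rint 𝕜 P (fun s => V s y) t := by
  refine hV.injective ?_
  have h1 := hK.tendstoEL_rint hS t h
  rw [← hK.map_rint hS hV.comm] at h1
  have h2 := ((hK.tendsto_average_shift hS x t).sub (hK.tendsto_average hS x)).map C
  rw [hV.zero] at h2
  refine h2.unique (h1.congr' (Eventually.of_forall fun r => ?_))
  simp only [diffQuot]
  rw [hK.rint_rsmul hS, rint_orbit_sub hS hV hK, ← BOp.apply_rsmul, add_comm r t]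
  congr 1
  simp only [rsmul_eq, ← smul_sub]
  congr 1
  abel

theorem genRel_of_apply_sub {x y : S} (h : ∀ t, V t x - C x = rint 𝕜 P (fun s => V s y) t) :
    GenRel C V x y := by
  have h1 := hK.tendsto_average hS y
  rw [hV.zero] at h1
  refine h1.congr' (Eventually.of_forall fun r => ?_)
  simp only [diffQuot, h]

/-- A difference quotient limit cannot be pulled back through $C$, since $C^{-1}$ need not be
continuous; the integral identity can, because $C$ is injective and commutes with the integral. -/
theorem GenRel.of_map {x y : S} (h : GenRel C V (C x) (C y)) : GenRel C V x y := by
  refine genRel_of_apply_sub hS hV hK fun t => hV.injective ?_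
  have := h.apply_sub hS hV hK t
  rw [BOp.apply_sub, hV.comm, this, hK.map_rint hS hV.comm]

/-- By `rint_orbit_sub`, $(V(r)-C)\int_0^tV(s)x\,ds=C(\int_0^{r+t}-\int_0^r-\int_0^t)V(s)x\,ds$. As
$t\to\infty$ the first and last integrals cancel, leaving $\int_0^rV(s)(-Cx)\,ds$. -/
theorem genRel_integral {x I : S} (h : HasImproperIntegral 𝕜 P (fun s => V s x) I) :
    GenRel C V I (-C x) := by
  obtain ⟨F, hF, hF'⟩ := h
  obtain rfl : F = rint 𝕜 P (fun s => V s x) := funext fun t => ((hF t).rint_eq).symm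
  refine genRel_of_apply_sub hS hV hK fun r => ?_
  have h1 := (hF'.map (V r)).sub (hF'.map C)
  have h2 : TendstoEL 𝕜 P (fun t => rint 𝕜 P (fun s => V s x) (r + t)) atTop I :=
    Tendsto.comp hF' (tendsto_atTop_mono (fun _ => le_add_self) tendsto_id)
  have h3 := ((h2.sub (tendstoEL_const (rint 𝕜 P (fun s => V s x) r))).sub hF').map C
  have h4 : I - rint 𝕜 P (fun s => V s x) r - I = 0 - rint 𝕜 P (fun s => V s x) r := by abel
  rw [h4, BOp.apply_sub, BOp.apply_zero, hK.map_rint hS hV.comm, ← hK.rint_zero hS r,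
    ← hK.rint_sub hS, zero_sub] at h3
  refine h1.unique (h3.congr' (Eventually.of_forall fun t => ?_))
  simp only
  rw [← rint_orbit_sub hS hV hK, hK.rint_sub hS, hK.map_rint hS hV.comm,
    hK.map_rint hS (hV.comm_apply r)]

/-- The integral identity with $y=0$ makes the orbit constantly $Cx$, which must then be its limit
$0$. -/
theorem GenRel.eq_zero {x : S} (h : GenRel C V x 0)
    (hx : TendstoEL 𝕜 P (fun s => V s x) atTop 0) : x = 0 := by
  have h1 : ∀ t, V t x = C x := fun t => by
    have := h.apply_sub hS hV hK t
    rwa [hK.rint_zero hS, sub_eq_zero] at this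
  simp only [h1] at hx
  refine hV.injective ?_
  rw [BOp.apply_zero]
  exact (tendstoEL_const (C x)).unique hx

end Bounded

/-! ### Exponential bounds for the rescaled family -/

section Growth

variable {W : ℝ≥0 → BOp 𝕜 P S} {M ξ : L0 ℝ P}

omit [IsProbabilityMeasure P] in
theorem ae_nonneg_of_nonneg {f : L0 ℝ P} (hf : 0 ≤ f) : ∀ᵐ ω ∂P, 0 ≤ f ω := by
  filter_upwards [AEEqFun.coeFn_le.2 hf, AEEqFun.coeFn_zero (μ := P) (β := ℝ)] with ω h1 h2
  rwa [h2] at h1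

variable (hbound : ∀ s : ℝ≥0, opNrm (W s) ≤ M * L0.exp ((s : ℝ) • ξ))
include hbound

theorem ae_nrm_escale_le (η : L0 ℝ P) (s : ℝ≥0) (x : S) : ∀ᵐ ω ∂P, nrm 𝕜 P (escale η W s x) ω ≤
    M ω * nrm 𝕜 P x ω * Real.exp (-((η ω - ξ ω) * s)) := by
  filter_upwards [AEEqFun.coeFn_le.2 (hbound s), AEEqFun.coeFn_mul M (L0.exp ((s : ℝ) • ξ)),
    L0.coeFn_exp ((s : ℝ) • ξ), AEEqFun.coeFn_smul (s : ℝ) ξ, nrm_map_le_opNrm (W s) x,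
    ae_nrm_smul (expScalar 𝕜 η s) (W s x), coeFn_expScalar (𝕜 := 𝕜) η s,
    ae_nrm_nonneg (𝕜 := 𝕜) (P := P) x] with ω h1 h2 h3 h4 h5 h6 h7 h8
  rw [h2, Pi.mul_apply, h3, h4, Pi.smul_apply, smul_eq_mul] at h1
  rw [escale_apply, h6, h7, RCLike.norm_ofReal, Real.abs_exp]
  have h9 : Real.exp (-((η ω - ξ ω) * s)) = Real.exp (-(s * η ω)) * Real.exp (s * ξ ω) := by
    rw [← Real.exp_add]
    congr 1
    ring
  rw [h9]
  calc Real.exp (-(s * η ω)) * nrm 𝕜 P (W s x) ω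
      ≤ Real.exp (-(s * η ω)) * (M ω * Real.exp (s * ξ ω) * nrm 𝕜 P x ω) :=
        mul_le_mul_of_nonneg_left (h5.trans (mul_le_mul_of_nonneg_right h1 h8))
          (Real.exp_nonneg _)
    _ = _ := by ring

theorem isBoundedFamily_escale (hW : StronglyContinuous W) (hM : 0 ≤ M) {η : L0 ℝ P}
    (hη : ∀ᵐ ω ∂P, ξ ω ≤ η ω) : IsBoundedFamily (escale η W) M := by
  refine ⟨hW.escale η, fun s x => ?_⟩
  filter_upwards [ae_nrm_escale_le hbound η s x, hη, ae_nonneg_of_nonneg hM,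
    ae_nrm_nonneg (𝕜 := 𝕜) (P := P) x] with ω h1 h2 h3 h4
  rw [abs_of_nonneg h3]
  refine h1.trans (mul_le_of_le_one_right (mul_nonneg h3 h4) (Real.exp_le_one_iff.2 ?_))
  exact neg_nonpos.2 (mul_nonneg (sub_nonneg.2 h2) s.coe_nonneg)

theorem exists_hasLaplaceTransform (hS : IsEpsLamComplete 𝕜 P S) (hW : StronglyContinuous W)
    (hM : 0 ≤ M) {η : L0 ℝ P} (hη : L0.LtOn ξ η) (x : S) :
    ∃ I, HasImproperIntegral 𝕜 P (fun s => escale η W s x) I := by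
  refine exists_hasImproperIntegral hS ((hW.escale η).tendstoEL x) (a := M * nrm 𝕜 P x)
    (θ := η - ξ) ?_ ?_ fun s => ?_
  · filter_upwards [ae_nonneg_of_nonneg hM, ae_nrm_nonneg (𝕜 := 𝕜) (P := P) x,
      AEEqFun.coeFn_mul M (nrm 𝕜 P x)] with ω h1 h2 h3
    rw [h3]
    exact mul_nonneg h1 h2
  · filter_upwards [hη, AEEqFun.coeFn_sub η ξ] with ω h1 h2
    rw [h2]
    exact sub_pos.2 h1
  · filter_upwards [ae_nrm_escale_le hbound η s x, AEEqFun.coeFn_sub η ξ,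
      AEEqFun.coeFn_mul M (nrm 𝕜 P x)] with ω h1 h2 h3
    rwa [h2, h3]

/-- Since $e^u\ge u$, the norm is at most $s^{-1}$ times the fixed random variable
$M\|x\|/(\eta-\xi)$, so no uniform positive lower bound on $\eta-\xi$ is needed. -/
theorem tendstoEL_escale_zero (hM : 0 ≤ M) {η : L0 ℝ P} (hη : L0.LtOn ξ η) (x : S) :
    TendstoEL 𝕜 P (fun s => escale η W s x) atTop 0 := by
  rw [tendstoEL_iff]
  have h0 : Tendsto (fun s : ℝ≥0 => (s : ℝ)⁻¹) atTop (𝓝 0) :=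
    tendsto_inv_atTop_zero.comp (NNReal.tendsto_coe_atTop.2 tendsto_id)
  refine (small_const h0).of_le_mul (g := fun ω => M ω * nrm 𝕜 P x ω * (η ω - ξ ω)⁻¹)
    ((M.aemeasurable.mul (nrm 𝕜 P x).aemeasurable).mul
      (η.aemeasurable.sub ξ.aemeasurable).inv) ?_
  filter_upwards [eventually_gt_atTop 0] with s hs
  have hs : (0 : ℝ) < s := NNReal.coe_pos.2 hs
  filter_upwards [ae_nrm_escale_le hbound η s x, hη, ae_nonneg_of_nonneg hM,
    ae_nrm_nonneg (𝕜 := 𝕜) (P := P) x] with ω h1 h2 h3 h4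
  have h5 : 0 < η ω - ξ ω := sub_pos.2 h2
  rw [sub_zero, abs_of_nonneg (by positivity), mul_assoc _ _ (s : ℝ)⁻¹, ← mul_inv]
  refine h1.trans (mul_le_mul_of_nonneg_left ?_ (mul_nonneg h3 h4))
  rw [Real.exp_neg]
  refine inv_anti₀ (by positivity) ?_
  linarith [Real.add_one_le_exp ((η ω - ξ ω) * s)]

end Growth

end Semigroup

/-! ### Graphs, $C$-resolvents and the resolvent equation -/

section Graph

variable {Ω : Type*} [MeasurableSpace Ω] {𝕜 : Type*} [RCLike 𝕜] {P : Measure Ω}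
  {S : Type*} [AddCommGroup S] [Module (L0 𝕜 P) S] [RNModule 𝕜 P S]
  {C : BOp 𝕜 P S} {A : S →ₗ.[L0 𝕜 P] S}

omit [RNModule 𝕜 P S] in
theorem mem_graph_iff_exists {x y : S} : (x, y) ∈ A.graph ↔ ∃ h : x ∈ A.domain, A ⟨x, h⟩ = y := by
  rw [LinearPMap.mem_graph_iff]
  constructor
  · rintro ⟨z, rfl, rfl⟩
    exact ⟨z.2, rfl⟩
  · rintro ⟨h, rfl⟩
    exact ⟨⟨x, h⟩, rfl, rfl⟩

/-- In terms of graphs, $A=C^{-1}AC$ says that the graph of $A$ is its own preimage under $C\times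
C$; the domain conditions then need no separate treatment. -/
theorem mem_graph_conj_iff (hC : Function.Injective C) {x y : S} :
    (x, y) ∈ (conj C hC A).graph ↔ (C x, C y) ∈ A.graph := by
  have key : ∀ h : x ∈ (conj C hC A).domain, C (conj C hC A ⟨x, h⟩) = A ⟨C x, h.1⟩ := by
    intro h
    exact congrArg Subtype.val ((LinearEquiv.ofInjective C.1 hC).apply_symm_apply
      ⟨A ⟨C x, h.1⟩, h.2⟩)
  rw [mem_graph_iff_exists, mem_graph_iff_exists]
  constructor
  · rintro ⟨h, rfl⟩
    exact ⟨h.1, (key h).symm⟩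
  · rintro ⟨h, hy⟩
    have h' : x ∈ (conj C hC A).domain := ⟨h, y, hy.symm⟩
    exact ⟨h', hC ((key h').trans hy)⟩

theorem mem_cResolventSet {η : L0 𝕜 P} (hinj : ∀ x, (x, η • x) ∈ A.graph → x = 0)
    (hsurj : ∀ x, ∃ z, (z, η • z - C x) ∈ A.graph) : η ∈ cResolventSet C A := by
  refine ⟨(injective_iff_map_eq_zero _).2 fun x hx => ?_, ?_⟩
  · refine Subtype.ext (hinj x (mem_graph_iff_exists.2 ⟨x.2, ?_⟩))
    have hx : η • (x : S) - A x = 0 := hx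
    exact (sub_eq_zero.1 hx).symm
  · rintro _ ⟨x, rfl⟩
    obtain ⟨z, hz⟩ := hsurj x
    obtain ⟨hz, hz'⟩ := mem_graph_iff_exists.1 hz
    refine ⟨⟨z, hz⟩, ?_⟩
    change η • z - A ⟨z, hz⟩ = C x
    rw [hz', sub_sub_cancel]

theorem cResolvent_mem_graph {η : L0 𝕜 P} (h : η ∈ cResolventSet C A) (x : S) :
    (cResolvent h x, η • cResolvent h x - C x) ∈ A.graph := by
  have h1 := congrArg Subtype.val ((LinearEquiv.ofInjective (etaSub η A) h.1).apply_symm_apply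
    ⟨C x, h.2 ⟨x, rfl⟩⟩)
  refine mem_graph_iff_exists.2 ⟨Subtype.property _, ?_⟩
  have h2 : η • cResolvent h x - A _ = C x := h1
  exact (sub_eq_iff_comm.1 h2).symm

theorem eq_cResolvent {η : L0 𝕜 P} (h : η ∈ cResolventSet C A) {x z : S}
    (hz : (z, η • z - C x) ∈ A.graph) : z = cResolvent h x := by
  obtain ⟨h1, h2⟩ := mem_graph_iff_exists.1 hz
  obtain ⟨h3, h4⟩ := mem_graph_iff_exists.1 (cResolvent_mem_graph h x)
  have h5 : etaSub η A ⟨z, h1⟩ = etaSub η A ⟨cResolvent h x, h3⟩ := by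
    change η • z - A _ = η • cResolvent h x - A _
    rw [h2, h4, sub_sub_cancel, sub_sub_cancel]
  exact congrArg Subtype.val (h.1 h5)

/-- $Cx=(\eta-A)R_C(\eta,A)x$ is recovered from the value of the resolvent, and $C$ is injective. -/
theorem eq_of_cResolvent_eq {η : L0 𝕜 P} (hC : Function.Injective C) (h : η ∈ cResolventSet C A)
    {x y : S} (hxy : cResolvent h x = cResolvent h y) : x = y := by
  obtain ⟨h1, h2⟩ := mem_graph_iff_exists.1 (cResolvent_mem_graph h x)
  obtain ⟨h3, h4⟩ := mem_graph_iff_exists.1 (cResolvent_mem_graph h y)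
  simp only [hxy] at h2
  exact hC (sub_right_injective (h2.symm.trans h4))

theorem cResolvent_map (hA : ∀ x y, (x, y) ∈ A.graph ↔ (C x, C y) ∈ A.graph) {η : L0 𝕜 P}
    (h : η ∈ cResolventSet C A) (x : S) : C (cResolvent h x) = cResolvent h (C x) := by
  refine eq_cResolvent h ?_
  have h1 := cResolvent_mem_graph h x
  rw [hA] at h1
  convert h1 using 2
  rw [map_sub, map_smul]

/-- The resolvent equation. -/
theorem cResolvent_sub (hA : ∀ x y, (x, y) ∈ A.graph ↔ (C x, C y) ∈ A.graph) {η ζ : L0 𝕜 P}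
    (hη : η ∈ cResolventSet C A) (hζ : ζ ∈ cResolventSet C A) (x : S) :
    (ζ - η) • cResolvent hη (cResolvent hζ x) =
      cResolvent hη (C x) - cResolvent hζ (C x) := by
  rw [eq_sub_iff_add_eq]
  refine eq_cResolvent hη ?_
  have h1 := A.graph.smul_mem (ζ - η) (cResolvent_mem_graph hη (cResolvent hζ x))
  have h2 := cResolvent_mem_graph hζ (C x)
  have h3 := A.graph.add_mem h1 h2
  rw [cResolvent_map hA] at h3
  convert h3 using 1
  refine Prod.ext rfl ?_
  simp only [Prod.smul_mk, Prod.mk_add_mk]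
  rw [smul_add, smul_sub, smul_comm η (ζ - η), sub_smul ζ η (cResolvent hζ (C x))]
  abel

variable [IsProbabilityMeasure P] {W : ℝ≥0 → BOp 𝕜 P S}

/-- Uniqueness of limits and injectivity of $C$ make the relation `GenRel` single valued, so domain
and values merge into one statement about the graph. -/
theorem isGenerator_iff (hC : Function.Injective C) :
    IsGenerator C W A ↔ ∀ x y, (x, y) ∈ A.graph ↔ GenRel C W x y := by
  constructor
  · intro h x y
    rw [mem_graph_iff_exists]
    constructor
    · rintro ⟨hx, rfl⟩
      exact h.apply ⟨x, hx⟩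
    · intro hxy
      have hx : x ∈ (A.domain : Set S) := by
        rw [h.domain]
        exact ⟨C y, ⟨y, rfl⟩, hxy⟩
      exact ⟨hx, hC (TendstoEL.unique (h.apply ⟨x, hx⟩) hxy)⟩
  · intro h
    refine ⟨?_, fun x => (h x (A x)).1 (mem_graph_iff_exists.2 ⟨x.2, rfl⟩)⟩
    ext x
    constructor
    · intro hx
      exact ⟨_, ⟨_, rfl⟩, (h x (A ⟨x, hx⟩)).1 (mem_graph_iff_exists.2 ⟨hx, rfl⟩)⟩
    · rintro ⟨_, ⟨y, rfl⟩, hy⟩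
      exact (mem_graph_iff_exists.1 ((h x y).2 hy)).1

end Graph

/-! ### The two implications -/

section HilleYosida

variable {Ω : Type*} [MeasurableSpace Ω] {𝕜 : Type*} [RCLike 𝕜] {P : Measure Ω}
  [IsProbabilityMeasure P] {S : Type*} [AddCommGroup S] [Module (L0 𝕜 P) S] [RNModule 𝕜 P S]
  {C : BOp 𝕜 P S} {A : S →ₗ.[L0 𝕜 P] S} {W : ℝ≥0 → BOp 𝕜 P S} {M ξ : L0 ℝ P}

theorem hasLaplaceTransform_iff {η : L0 ℝ P} {x I : S} :
    HasLaplaceTransform 𝕜 (fun s => W s x) η I ↔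
      HasImproperIntegral 𝕜 P (fun s => escale η W s x) I :=
  Iff.rfl

section Semigroup

variable (hS : IsEpsLamComplete 𝕜 P S) (hM : 0 ≤ M)
  (hbound : ∀ s : ℝ≥0, opNrm (W s) ≤ M * L0.exp ((s : ℝ) • ξ)) (hW : IsCSemigroup C W)
include hS hM hbound hW

/-- Rescaling by $e^{-\xi s}$ yields a bounded $C$-semigroup, where pulling back through $C$ is
possible; the shift by $\xi$ commutes with $C$. -/
theorem genRel_map_iff {x y : S} : GenRel C W (C x) (C y) ↔ GenRel C W x y := by
  refine ⟨fun h => ?_, fun h => h.map hW⟩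
  rw [← genRel_escale_iff ξ] at h ⊢
  rw [← BOp.apply_smul, ← BOp.apply_sub] at h
  exact h.of_map hS (hW.escale ξ) (isBoundedFamily_escale hbound hW.continuous hM
    (Eventually.of_forall fun _ => le_rfl))

theorem genRel_laplace {η : L0 ℝ P} (hη : L0.LtOn ξ η) {x I : S}
    (hI : HasLaplaceTransform 𝕜 (fun s => W s x) η I) :
    GenRel C W I (L0.ofReal 𝕜 η • I - C x) := by
  rw [← genRel_escale_iff η, sub_sub_cancel_left]
  exact genRel_integral hS (hW.escale η) (isBoundedFamily_escale hbound hW.continuous hM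
    (hη.mono fun _ => le_of_lt)) hI

theorem eq_zero_of_genRel_smul {η : L0 ℝ P} (hη : L0.LtOn ξ η) {x : S}
    (h : GenRel C W x (L0.ofReal 𝕜 η • x)) : x = 0 := by
  rw [← genRel_escale_iff η, sub_self] at h
  exact h.eq_zero hS (hW.escale η) (isBoundedFamily_escale hbound hW.continuous hM
    (hη.mono fun _ => le_of_lt)) (tendstoEL_escale_zero hbound hM hη x)

theorem eq_conj_of_isGenerator (hA : IsGenerator C W A) : A = conj C hW.injective A := by
  refine LinearPMap.eq_of_eq_graph (SetLike.ext fun ⟨x, y⟩ => ?_)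
  have h := (isGenerator_iff hW.injective).1 hA
  rw [mem_graph_conj_iff, h, h, genRel_map_iff hS hM hbound hW]

/-- The Laplace integral solves $(\eta-A)I=Cx$, and eigenvectors for $\eta$ vanish by decay of the
rescaled orbit; hence the integral is the $C$-resolvent. -/
theorem exists_mem_cResolventSet (hA : IsGenerator C W A) {η : L0 ℝ P} (hη : L0.LtOn ξ η) :
    ∃ h : L0.ofReal 𝕜 η ∈ cResolventSet C A,
      ∀ x : S, HasLaplaceTransform 𝕜 (fun s => W s x) η (cResolvent h x) := by
  have hg := (isGenerator_iff hW.injective).1 hA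
  have hex := exists_hasLaplaceTransform hbound hS hW.continuous hM hη
  have h : L0.ofReal 𝕜 η ∈ cResolventSet C A := by
    refine mem_cResolventSet (fun x hx => ?_) fun x => ?_
    · exact eq_zero_of_genRel_smul hS hM hbound hW hη ((hg _ _).1 hx)
    · obtain ⟨I, hI⟩ := hex x
      exact ⟨I, (hg _ _).2 (genRel_laplace hS hM hbound hW hη hI)⟩
  refine ⟨h, fun x => ?_⟩
  obtain ⟨I, hI⟩ := hex x
  rw [← eq_cResolvent h ((hg _ _).2 (genRel_laplace hS hM hbound hW hη hI))]
  exact hI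

end Semigroup

section Dominated

variable {f g : ℝ≥0 → S}

theorem IsDominated.exists_common {b c : L0 ℝ P} (hf : IsDominated 𝕜 f b)
    (hg : IsDominated 𝕜 g c) : ∃ d : L0 ℝ P, IsDominated 𝕜 f d ∧ IsDominated 𝕜 g d := by
  refine ⟨b ⊔ c, hf.mono ?_, hg.mono ?_⟩
  · filter_upwards [AEEqFun.coeFn_sup b c] with ω h
    exact h ▸ le_sup_left
  · filter_upwards [AEEqFun.coeFn_sup b c] with ω h
    exact h ▸ le_sup_right

theorem IsDominated.exists_map {b : L0 ℝ P} (hf : IsDominated 𝕜 f b) (T : BOp 𝕜 P S) :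
    ∃ c : L0 ℝ P, IsDominated 𝕜 (fun s => T (f s)) c := by
  obtain ⟨g, hg⟩ := T.exists_bound
  refine ⟨g.absVal * b, fun s => (hf.continuous s).map T, fun s => ?_⟩
  filter_upwards [hg (f s), hf.ae_le s, AEEqFun.coeFn_mul g.absVal b, L0.coeFn_absVal g]
    with ω h1 h2 h3 h4
  rw [h3, Pi.mul_apply, h4]
  exact h1.trans (mul_le_mul_of_nonneg_left h2 (abs_nonneg _))

end Dominated

/-! ### From Laplace transforms back to the $C$-semigroup and its generator -/

section Resolvent

omit [IsProbabilityMeasure P] in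
theorem ltOn_add_const (ξ : L0 ℝ P) {r : ℝ} (hr : 0 < r) :
    L0.LtOn ξ (ξ + AEEqFun.const Ω r) := by
  filter_upwards [AEEqFun.coeFn_add ξ (AEEqFun.const Ω r), AEEqFun.coeFn_const (μ := P) Ω r]
    with ω h1 h2
  rw [h1, Pi.add_apply, h2]
  exact lt_add_of_pos_right _ hr

omit [IsProbabilityMeasure P] in
theorem escale_add_const (r : ℝ) (s : ℝ≥0) (x : S) :
    escale (ξ + AEEqFun.const Ω r) W s x =
      rsmul 𝕜 P (Real.exp (-r * s)) (escale ξ W s x) := by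
  rw [escale_apply, expScalar_add_left, expScalar_const, mul_comm, mul_smul]
  rfl

/-- The operators `R q` are the Laplace transforms of `V` at the real numbers `q > 0`, they are
injective, commute with `C` and satisfy the resolvent equation. -/
structure IsLaplaceResolvent (C : BOp 𝕜 P S) (V : ℝ≥0 → BOp 𝕜 P S) (R : ℝ → S → S) : Prop where
  laplace : ∀ q : ℝ, 0 < q → ∀ x,
    HasImproperIntegral 𝕜 P (fun s => rsmul 𝕜 P (Real.exp (-q * s)) (V s x)) (R q x)
  injective : ∀ q : ℝ, 0 < q → Function.Injective (R q)
  map : ∀ q : ℝ, 0 < q → ∀ x, C (R q x) = R q (C x)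
  sub : ∀ q r : ℝ, 0 < q → 0 < r → ∀ x,
    rsmul 𝕜 P (r - q) (R q (R r x)) = R q (C x) - R r (C x)

theorem exists_isLaplaceResolvent (hC : Function.Injective C)
    (hA : ∀ x y, (x, y) ∈ A.graph ↔ (C x, C y) ∈ A.graph)
    (hR : ∀ η : L0 ℝ P, L0.LtOn ξ η → ∃ h : L0.ofReal 𝕜 η ∈ cResolventSet C A,
      ∀ x : S, HasLaplaceTransform 𝕜 (fun s => W s x) η (cResolvent h x)) :
    ∃ R, IsLaplaceResolvent C (escale ξ W) R := by
  choose h hlap using fun (q : ℝ) (hq : 0 < q) => hR _ (ltOn_add_const ξ hq)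
  -- Only $q>0$ matters; the value $0$ elsewhere makes $R$ a total function of $q$.
  refine ⟨fun q x => if hq : 0 < q then cResolvent (h q hq) x else 0, ?_, ?_, ?_, ?_⟩
  · intro q hq x
    have := hlap q hq x
    simp only [hasLaplaceTransform_iff, escale_add_const] at this
    simpa only [dif_pos hq] using this
  · intro q hq x y hxy
    simp only [dif_pos hq] at hxy
    exact eq_of_cResolvent_eq hC _ hxy
  · intro q hq x
    simp only [dif_pos hq]
    exact cResolvent_map hA _ x
  · intro q r hq hr x
    simp only [dif_pos hq, dif_pos hr]
    have hqr : constHom 𝕜 P (r - q) = L0.ofReal 𝕜 (ξ + AEEqFun.const Ω r) -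
        L0.ofReal 𝕜 (ξ + AEEqFun.const Ω q) := by
      rw [L0.ofReal_add, L0.ofReal_add, L0.ofReal_const, L0.ofReal_const,
        add_sub_add_left_eq_sub, map_sub]
    rw [← cResolvent_sub hA, rsmul_eq, hqr]

namespace IsLaplaceResolvent

variable {V : ℝ≥0 → BOp 𝕜 P S} {R : ℝ → S → S} {K : L0 ℝ P} (hS : IsEpsLamComplete 𝕜 P S)
  (hV : IsBoundedFamily V K) (hR : IsLaplaceResolvent C V R)
include hS hV hR

/-- Both sides have the Laplace transform $CR_qx=R_qCx$ at every positive integer $q$. -/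
theorem comm (s : ℝ≥0) (x : S) : C (V s x) = V s (C x) := by
  obtain ⟨_, h1⟩ := hV.isDominated x
  obtain ⟨_, h2⟩ := h1.exists_map C
  obtain ⟨_, h3⟩ := hV.isDominated (C x)
  obtain ⟨b, hf, hg⟩ := h2.exists_common h3
  refine hf.eq_of_laplace_eq hS hg (fun n => ?_) s
  have hn : (0 : ℝ) < n + 1 := by positivity
  have h4 := (hR.laplace _ hn x).map C
  rw [hR.map _ hn] at h4
  simp only [BOp.apply_rsmul] at h4
  exact ⟨_, h4, hR.laplace _ hn (C x)⟩

/-- As functions of $t$, both sides have the Laplace transform $V(s)R_rx$ at $r=n+1$: the left side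
because $V(s)$ passes through the integral, the right side by `IsDominated.hasLaplace_shift` with
$f=V(\cdot)Cx$ and $g=V(\cdot)R_rx$, whose hypothesis is the resolvent equation. -/
theorem apply_apply (s t : ℝ≥0) (x : S) : V s (V t x) = V (s + t) (C x) := by
  obtain ⟨_, h1⟩ := hV.isDominated x
  obtain ⟨_, h2⟩ := h1.exists_map (V s)
  obtain ⟨_, h3⟩ := hV.isDominated (C x)
  obtain ⟨b, hf, hg⟩ := h2.exists_common (h3.shift s)
  refine hf.eq_of_laplace_eq hS hg (fun n => ?_) t
  have hn : (0 : ℝ) < n + 1 := by positivity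
  have h4 := (hR.laplace _ hn x).map (V s)
  simp only [BOp.apply_rsmul] at h4
  refine ⟨_, h4, ?_⟩
  obtain ⟨_, h5⟩ := hV.isDominated (R (n + 1) x)
  obtain ⟨b', hf', hg'⟩ := h3.exists_common h5
  exact hf'.hasLaplace_shift hS hg' (fun q hq => hR.laplace q hq (C x))
    (fun q hq => hR.laplace q hq (R (n + 1) x)) hn (fun q hq => hR.sub q _ hq hn x) s

theorem isCSemigroup (hC : Function.Injective C) : IsCSemigroup C V where
  injective := hC
  mul s t x := by
    rw [hR.comm hS hV, hR.apply_apply hS hV, add_comm]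
  zero := by
    -- Since $V(s)V(0)x=V(s)Cx$, the vectors $V(0)x$ and $Cx$ have the same image under the
    -- injective map $R_1$.
    refine BOp.ext fun x => hR.injective 1 one_pos ?_
    refine (hR.laplace 1 one_pos (V 0 x)).unique ?_
    simp only [hR.apply_apply hS hV, add_zero]
    exact hR.laplace 1 one_pos (C x)
  continuous := hV.continuous

end IsLaplaceResolvent

theorem isCSemigroup_of_laplace (hS : IsEpsLamComplete 𝕜 P S) (hC : Function.Injective C)
    (hM : 0 ≤ M) (hbound : ∀ s : ℝ≥0, opNrm (W s) ≤ M * L0.exp ((s : ℝ) • ξ))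
    (hW : StronglyContinuous W) (hA : ∀ x y, (x, y) ∈ A.graph ↔ (C x, C y) ∈ A.graph)
    (hR : ∀ η : L0 ℝ P, L0.LtOn ξ η → ∃ h : L0.ofReal 𝕜 η ∈ cResolventSet C A,
      ∀ x : S, HasLaplaceTransform 𝕜 (fun s => W s x) η (cResolvent h x)) :
    IsCSemigroup C W := by
  obtain ⟨R, h⟩ := exists_isLaplaceResolvent hC hA hR
  have h1 := (h.isCSemigroup hS (isBoundedFamily_escale hbound hW hM
    (Eventually.of_forall fun _ => le_rfl)) hC).escale (-ξ)
  rwa [escale_neg_escale] at h1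

/-- One $\eta$ suffices. Put $z=\eta x-y$. The range of $\eta-A$ is only known to contain $R(C)$, so
$(x,y)$ is replaced by $(Cx,Cy)$, where $\eta Cx-Cy=Cz$. Both $A$ and the generator contain the pair
determined by $R_C(\eta,A)z$, and both have $\eta$ minus the operator injective; hence membership of
$(Cx,Cy)$ in either graph means $Cx=R_C(\eta,A)z$. -/
theorem isGenerator_of_laplace (hS : IsEpsLamComplete 𝕜 P S) (hM : 0 ≤ M)
    (hbound : ∀ s : ℝ≥0, opNrm (W s) ≤ M * L0.exp ((s : ℝ) • ξ)) (hW : IsCSemigroup C W)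
    (hA : ∀ x y, (x, y) ∈ A.graph ↔ (C x, C y) ∈ A.graph) {η : L0 ℝ P} (hη : L0.LtOn ξ η)
    (h : L0.ofReal 𝕜 η ∈ cResolventSet C A)
    (hR : ∀ x : S, HasLaplaceTransform 𝕜 (fun s => W s x) η (cResolvent h x)) :
    IsGenerator C W A := by
  refine (isGenerator_iff hW.injective).2 fun x y => ?_
  have hCy : C y = L0.ofReal 𝕜 η • C x - C (L0.ofReal 𝕜 η • x - y) := by
    rw [BOp.apply_sub, BOp.apply_smul, sub_sub_cancel]
  have hgen := genRel_laplace hS hM hbound hW hη (hR (L0.ofReal 𝕜 η • x - y))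
  rw [hA, ← genRel_map_iff hS hM hbound hW, hCy]
  constructor
  · intro hxy
    rwa [← eq_cResolvent h hxy] at hgen
  · intro hxy
    have h1 := GenRel.sub hxy hgen
    rw [sub_sub_sub_cancel_right, ← smul_sub] at h1
    rw [sub_eq_zero.1 (eq_zero_of_genRel_smul hS hM hbound hW hη h1)]
    exact cResolvent_mem_graph h _

end Resolvent

end HilleYosida

end RNM

theorem theorem4p7 {Ω : Type*} [MeasurableSpace Ω] (P : Measure Ω) [IsProbabilityMeasure P]
    (𝕜 : Type*) [RCLike 𝕜] (S : Type*) [AddCommGroup S] [Module (RNM.L0 𝕜 P) S]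
    [RNM.RNModule 𝕜 P S] (hS : RNM.IsEpsLamComplete 𝕜 P S)
    (C : RNM.BOp 𝕜 P S) (hC : Function.Injective C)
    (A : S →ₗ.[RNM.L0 𝕜 P] S)
    (W : ℝ≥0 → RNM.BOp 𝕜 P S) (hW : RNM.StronglyContinuous W)
    (M ξ : RNM.L0 ℝ P) (hM : 0 ≤ M)
    (hbound : ∀ s : ℝ≥0, RNM.opNrm (W s) ≤ M * RNM.L0.exp ((s : ℝ) • ξ)) :
    (RNM.IsCSemigroup C W ∧ RNM.IsGenerator C W A) ↔
      (A = RNM.conj C hC A ∧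
        ∀ η : RNM.L0 ℝ P, RNM.L0.LtOn ξ η →
          ∃ h : RNM.L0.ofReal 𝕜 η ∈ RNM.cResolventSet C A,
            ∀ x : S, RNM.HasLaplaceTransform 𝕜 (fun s => W s x) η (RNM.cResolvent h x)) := by
  constructor
  · rintro ⟨hsg, hgen⟩
    exact ⟨RNM.eq_conj_of_isGenerator hS hM hbound hsg hgen,
      fun η hη => RNM.exists_mem_cResolventSet hS hM hbound hsg hgen hη⟩
  · rintro ⟨hconj, hR⟩
    have hA : ∀ x y, (x, y) ∈ A.graph ↔ (C x, C y) ∈ A.graph := fun x y => by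
      rw [← RNM.mem_graph_conj_iff hC, ← hconj]
    have hsg := RNM.isCSemigroup_of_laplace hS hC hM hbound hW hA hR
    -- Any element of $G_\xi$ would do; $\xi+1$ is a concrete one.
    obtain ⟨h, hlap⟩ := hR _ (RNM.ltOn_add_const ξ one_pos)
    exact ⟨hsg, RNM.isGenerator_of_laplace hS hM hbound hsg hA
      (RNM.ltOn_add_const ξ one_pos) h hlap⟩
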